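/- Let $T>0$, $\nu,\alpha,\beta>0$, $\gamma\in(0,1)$, $\mathcal O=(0,1)$ and $u_0\in L^2(\mathcal O)$, and let $\mathscr E=C([0,T];L^2(\mathcal O))\cap L^2(0,T;H_0^1(\mathcal O))$ with the norm $\sup_{t\in[0,T]}\|v(t)\|_{L^2}+\|\partial_x v\|_{L^2(0,T;L^2(\mathcal O))}$ (or an equivalent one). For $\psi\in\mathscr E$ consider the problem $$dv_\psi(t)+\nu A v_\psi(t)\,dt=-\alpha B(v_\psi(t)+\psi(t))\,dt+\beta c(v_\psi(t)+\psi(t))\,dt,\quad t\in(0,T),\qquad v_\psi(0)=u_0,$$ where $A=-\partial_x^2$ with Dirichlet boundary conditions, $B(u)=u\,\partial_x u$ and $c(u)=u(1-u)(u-\gamma)$. A solution is a $v_\psi\in\mathscr E$ with $v_\psi(0)=u_0$ such that, for all $t\in[0,T]$ and all $\varphi\in H_0^1(\mathcal O)$, $$(v_\psi(t),\varphi)=(u_0,\varphi)+\int_0^t\Big[-\nu(\partial_x v_\psi(s),\partial_x\varphi)-\alpha\big(B(v_\psi(s)+\psi(s)),\varphi\big)+\beta\big(c(v_\psi(s)+\psi(s)),\varphi\big)\Big]ds,$$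 where $(\cdot,\cdot)$ is the inner product of $L^2(\mathcal O)$. Then for every $\psi\in\mathscr E$ there is exactly one solution $v_\psi\in\mathscr E$, and the map $\Psi:\psi\mapsto v_\psi$ is continuous from $\mathscr E$ to $\mathscr E$. -/

import Mathlib

open MeasureTheory Set Topology
open scoped ContDiff

noncomputable section

namespace BurgersHuxley

/-- The Hilbert space `L²(O)` for the space interval `O = (0,1)`. -/
abbrev L2 : Type := Lp ℝ 2 (volume.restrict (Ioo (0 : ℝ) 1))

/-- The pairs `(φ, φ')` in `L²(O) × L²(O)`, where `φ` runs through the infinitely differentiable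
functions with compact support in `O = (0,1)`. -/
def testGraph : Submodule ℝ (L2 × L2) where
  carrier := {p | ∃ φ : ℝ → ℝ, ContDiff ℝ ∞ φ ∧ HasCompactSupport φ ∧ tsupport φ ⊆ Ioo 0 1 ∧
    (p.1 : ℝ → ℝ) =ᵐ[volume.restrict (Ioo (0 : ℝ) 1)] φ ∧
    (p.2 : ℝ → ℝ) =ᵐ[volume.restrict (Ioo (0 : ℝ) 1)] deriv φ}
  zero_mem' := by
    refine ⟨0, contDiff_const, HasCompactSupport.zero, by simp [tsupport], Lp.coeFn_zero _ _ _, ?_⟩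
    have h : deriv (0 : ℝ → ℝ) = 0 := by
      ext x
      exact deriv_const x (0 : ℝ)
    rw [h]
    exact Lp.coeFn_zero _ _ _
  add_mem' := by
    rintro p q ⟨φ, h1, h2, h3, h4, h5⟩ ⟨χ, k1, k2, k3, k4, k5⟩
    refine ⟨φ + χ, h1.add k1, h2.add k2,
      (tsupport_add φ χ).trans (union_subset h3 k3), ?_, ?_⟩
    · exact (Lp.coeFn_add p.1 q.1).trans (h4.add k4)
    · have h : deriv (φ + χ) = deriv φ + deriv χ := by
        ext x
        exact deriv_add (h1.differentiable (by simp) x) (k1.differentiable (by simp) x)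
      rw [h]
      exact (Lp.coeFn_add p.2 q.2).trans (h5.add k5)
  smul_mem' := by
    rintro a p ⟨φ, h1, h2, h3, h4, h5⟩
    refine ⟨fun x => a • φ x, h1.const_smul a, h2.smul_left (f := fun _ => a),
      (tsupport_smul_subset_right (fun _ => a) φ).trans h3, ?_, ?_⟩
    · exact (Lp.coeFn_smul a p.1).trans (h4.const_smul a)
    · have h : deriv (fun x => a • φ x) = a • deriv φ := by
        ext x
        exact deriv_const_smul a (h1.differentiable (by simp) x)
      rw [h]
      exact (Lp.coeFn_smul a p.2).trans (h5.const_smul a)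

/-- The Sobolev space `H₀¹(O)`: the closure of the smooth compactly supported functions. An element
is stored as the pair `(u, ∂ₓu)` of a function and its weak derivative, which is determined by `u`.
The norm is `max ‖u‖ ‖∂ₓu‖`, which is equal to `‖∂ₓu‖` because of Poincaré's inequality
`‖u‖ ≤ π⁻¹ ‖∂ₓu‖`. -/
abbrev H01 : Type := testGraph.topologicalClosure

/-- The function in `L²(O)` that underlies an element of `H₀¹(O)`. -/
def H01.toL2 (u : H01) : L2 := u.1.1

/-- The weak derivative `∂ₓu` of an element of `H₀¹(O)`. -/
def H01.dx (u : H01) : L2 := u.1.2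

/-- `L²(0,T; H₀¹(O))`, a Bochner space. -/
abbrev L2H01 (T : ℝ) : Type := Lp H01 2 (volume.restrict (Ioo (0 : ℝ) T))

/-- The space `C([0,T]; L²(O)) ∩ L²(0,T; H₀¹(O))`: the pairs of an element of the first and an
element of the second space that are equal, as functions with values in `L²(O)`, at almost every
time. It carries the norm `max (sup_t ‖u(t)‖_{L²}) ‖u‖_{L²(0,T;H₀¹)}`. -/
def pathSpace (T : ℝ) : Submodule ℝ (C(Icc (0 : ℝ) T, L2) × L2H01 T) where
  carrier := {p | ∀ᵐ s ∂(volume.restrict (Ioo (0 : ℝ) T)), ∀ hs : s ∈ Icc (0 : ℝ) T,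
    p.1 ⟨s, hs⟩ = (p.2 s).toL2}
  zero_mem' := by
    filter_upwards [Lp.coeFn_zero H01 2 (volume.restrict (Ioo (0 : ℝ) T))] with s h hs
    change (0 : L2) = ((0 : L2H01 T) s).toL2
    rw [h]
    rfl
  add_mem' := by
    intro p q hp hq
    filter_upwards [hp, hq, Lp.coeFn_add p.2 q.2] with s h1 h2 h hs
    change p.1 ⟨s, hs⟩ + q.1 ⟨s, hs⟩ = ((p.2 + q.2 : L2H01 T) s).toL2
    rw [h, h1 hs, h2 hs]
    rfl
  smul_mem' := by
    intro a p hp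
    filter_upwards [hp, Lp.coeFn_smul a p.2] with s h1 h hs
    change a • p.1 ⟨s, hs⟩ = ((a • p.2 : L2H01 T) s).toL2
    rw [h, h1 hs]
    rfl

/-- The value `u(t)` in `L²(O)`, for every `t` in `[0,T]`. -/
def pathSpace.value {T : ℝ} (u : pathSpace T) (t : Icc (0 : ℝ) T) : L2 := u.1.1 t

/-- The value `u(s)` in `H₀¹(O)`, for almost every `s` in `(0,T)`. -/
def pathSpace.valueH01 {T : ℝ} (u : pathSpace T) (s : ℝ) : H01 := u.1.2 s

/-- `⟨A u, φ⟩ = (∂ₓu, ∂ₓφ)`, for `A = -∂ₓ²`. -/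
def pairA (u φ : H01) : ℝ := inner ℝ u.dx φ.dx

/-- `(B(u), φ) = ∫₀¹ u(x) ∂ₓu(x) φ(x) dx`, for `B(u) = u ∂ₓu`. -/
def pairB (u φ : H01) : ℝ := ∫ x in Ioo (0 : ℝ) 1, u.toL2 x * u.dx x * φ.toL2 x

/-- `(c(u), φ)`, for `c(u) = u (1 - u) (u - γ)`. -/
def pairC (γ : ℝ) (u φ : H01) : ℝ :=
  ∫ x in Ioo (0 : ℝ) 1, u.toL2 x * (1 - u.toL2 x) * (u.toL2 x - γ) * φ.toL2 x

/-- `v` solves `dv + ν A v dt = -α B(v + ψ) dt + β c(v + ψ) dt` on `(0,T)`, `v(0) = u₀`: the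
equation, integrated from `0` to `t`, is tested with every `φ` in `H₀¹(O)`, for every `t` in
`[0,T]`. -/
structure IsSolution {T : ℝ} (ν α β γ : ℝ) (u₀ : L2) (ψ v : pathSpace T) : Prop where
  initial : ∀ h : (0 : ℝ) ∈ Icc 0 T, pathSpace.value v ⟨0, h⟩ = u₀
  equation : ∀ (t : Icc (0 : ℝ) T) (φ : H01),
    inner ℝ (pathSpace.value v t) φ.toL2 = inner ℝ u₀ φ.toL2 +
      ∫ s in (0 : ℝ)..t,
        (-ν * pairA (pathSpace.valueH01 v s) φ
          - α * pairB (pathSpace.valueH01 v s + pathSpace.valueH01 ψ s) φ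
          + β * pairC γ (pathSpace.valueH01 v s + pathSpace.valueH01 ψ s) φ)

end BurgersHuxley

end

/-!
# Well-posedness

Write `u = v + ψ`. After an integration by parts the right-hand side is the functional
`φ ↦ -ν (∂ₓv, ∂ₓφ) + (α / 2) (u², ∂ₓφ) + β (c(u), φ)` on `H₀¹` (`nlin_burgersHuxley`), so that it
involves only superposition operators. These do not even map `L²` to itself, but Agmon's
inequality `‖u‖²_∞ ≤ 2 ‖u‖ ‖∂ₓu‖` (`agmon`, `ae_sq_le_agmon`) makes them Lipschitz with a
constant of size `1 + ‖u‖ ‖∂ₓu‖`, which is square integrable in time for a path in the solution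
space (`memLp_agmon`). Moreover the cubic term is bounded from one side: `(c(a) - c(b)) (a - b) ≤
4 (a - b)²`.

A weak solution of `dv = ℓ dt`, with `ℓ` in `L²(0,T; H⁻¹)`, satisfies the energy identity
`‖v(t)‖² = ‖v(0)‖² + 2 ∫₀ᵗ ℓ(v)` (`Weak.energy`): it is the sum, over the sine basis, of the
identities for the squares of the coefficients. Together with Gronwall's inequality for an
integrable coefficient it gives an a priori bound (`IsWeakSol.norm_sq_le`), where
`∫ v² ∂ₓv dx = 0` removes the term that is cubic in `v`, and a stability estimate for the
difference of two solutions (`IsWeakSol.norm_sub_sq_le`). Both are uniform over a class of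
nonlinearities (`Admissible`) that contains the truncations `g ∘ clamp R`, `c ∘ clamp R` of `a²` and
`c`, and the stability estimate also measures the distance of two pairs of nonlinearities (`Close`).

Uniqueness, and Lipschitz continuity of `ψ ↦ v_ψ` on bounded sets, are immediate. For existence, the
truncated nonlinearities are globally Lipschitz on `L²`, so the problem is a fixed point equation of
Volterra type for the heat equation (`exists_weak_heat`, solved by the sine series), and an iterate
of the map is a contraction (`exists_isWeakSol_of_lipschitz`). By the stability estimate the
solutions for `R = 1, 2, 3, …` form a Cauchy sequence, and the limit solves the problem
(`exists_isWeakSol`).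
-/

noncomputable section

namespace BurgersHuxley

open Filter pathSpace

/-- Lebesgue measure on `(0,1)`. -/
local notation "μI" => (volume.restrict (Ioo (0 : ℝ) 1))

/-! ### The space `L²(0,1)` -/

instance : IsProbabilityMeasure μI := ⟨by simp⟩

theorem L2.inner_eq (a b : L2) : inner ℝ a b = ∫ x in Ioo (0 : ℝ) 1, a x * b x := by
  rw [L2.inner_def]
  refine integral_congr_ae (ae_of_all _ fun x => ?_)
  simp [mul_comm]

theorem L2.norm_sq_eq (a : L2) : ‖a‖ ^ 2 = ∫ x in Ioo (0 : ℝ) 1, (a x) ^ 2 := by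
  rw [← real_inner_self_eq_norm_sq, L2.inner_eq]
  simp [pow_two]

theorem L2.integrable_mul (a b : L2) : Integrable (fun x => a x * b x) μI :=
  (Lp.memLp a).integrable_mul (Lp.memLp b)

theorem L2.integral_abs_mul_abs_le (a b : L2) :
    ∫ x in Ioo (0 : ℝ) 1, |a x| * |b x| ≤ ‖a‖ * ‖b‖ := by
  have h := real_inner_le_norm |a| |b|
  rw [norm_abs_eq_norm, norm_abs_eq_norm, L2.inner_eq] at h
  refine le_of_eq_of_le (integral_congr_ae ?_) h
  filter_upwards [Lp.coeFn_abs a, Lp.coeFn_abs b] with x h1 h2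
  rw [h1, h2]

theorem memLp_of_continuous {f : ℝ → ℝ} (hf : Continuous f) : MemLp f 2 μI := by
  obtain ⟨C, hC⟩ := (isCompact_Icc (a := (0 : ℝ)) (b := 1)).exists_bound_of_continuousOn
    hf.continuousOn
  refine MemLp.of_bound hf.aestronglyMeasurable C ?_
  filter_upwards [ae_restrict_mem measurableSet_Ioo] with x hx
  exact hC x (Ioo_subset_Icc_self hx)

/-- The class in `L²(0,1)` of a continuous function. -/
def contL2 (f : ℝ → ℝ) (hf : Continuous f) : L2 := (memLp_of_continuous hf).toLp f

theorem coeFn_contL2 (f : ℝ → ℝ) (hf : Continuous f) : (contL2 f hf : ℝ → ℝ) =ᵐ[μI] f :=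
  MemLp.coeFn_toLp _

theorem inner_contL2 (f : ℝ → ℝ) (hf : Continuous f) (a : L2) :
    inner ℝ (contL2 f hf) a = ∫ x in Ioo (0 : ℝ) 1, f x * a x := by
  rw [L2.inner_eq]
  refine integral_congr_ae ?_
  filter_upwards [coeFn_contL2 f hf] with x hx
  rw [hx]

theorem norm_le_of_ae_le {a b : L2} {K : ℝ} (h : ∀ᵐ x ∂μI, |a x| ≤ K * |b x|) :
    ‖a‖ ≤ K * ‖b‖ := Lp.norm_le_mul_norm_of_ae_le_mul (by simpa using h)

/-! ### The space `H₀¹(0,1)` -/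

/-- `H01.toL2` as a continuous linear map. -/
def toL2L : H01 →L[ℝ] L2 := (ContinuousLinearMap.fst ℝ L2 L2).comp (Submodule.subtypeL _)

/-- `H01.dx` as a continuous linear map. -/
def dxL : H01 →L[ℝ] L2 := (ContinuousLinearMap.snd ℝ L2 L2).comp (Submodule.subtypeL _)

@[simp] theorem H01.toL2_add (u v : H01) : (u + v).toL2 = u.toL2 + v.toL2 := rfl
@[simp] theorem H01.dx_add (u v : H01) : (u + v).dx = u.dx + v.dx := rfl
@[simp] theorem H01.toL2_sub (u v : H01) : (u - v).toL2 = u.toL2 - v.toL2 := rfl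
@[simp] theorem H01.dx_sub (u v : H01) : (u - v).dx = u.dx - v.dx := rfl
@[simp] theorem H01.toL2_smul (a : ℝ) (v : H01) : (a • v).toL2 = a • v.toL2 := rfl
@[simp] theorem H01.dx_smul (a : ℝ) (v : H01) : (a • v).dx = a • v.dx := rfl
@[simp] theorem H01.toL2_zero : (0 : H01).toL2 = 0 := rfl

theorem H01.norm_eq (u : H01) : ‖u‖ = max ‖u.toL2‖ ‖u.dx‖ := rfl
theorem H01.norm_toL2_le (u : H01) : ‖u.toL2‖ ≤ ‖u‖ := le_max_left _ _
theorem H01.norm_dx_le (u : H01) : ‖u.dx‖ ≤ ‖u‖ := le_max_right _ _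

/-- A closed property of pairs `(u, ∂ₓu)` that holds for test functions holds on `H₀¹`. -/
theorem H01.induction {P : L2 × L2 → Prop} (hc : IsClosed {p | P p})
    (ht : ∀ p ∈ testGraph, P p) (u : H01) : P (u.toL2, u.dx) :=
  hc.closure_subset_iff.2 ht u.2

theorem isClosed_setOf_ae_sq_le :
    IsClosed {p : L2 × L2 | ∀ᵐ x ∂μI, (p.1 x) ^ 2 ≤ 2 * ‖p.1‖ * ‖p.2‖} := by
  refine IsSeqClosed.isClosed fun p q hp hpq => ?_
  have h1 : Tendsto (fun n => (p n).1) atTop (𝓝 q.1) := (continuous_fst.tendsto q).comp hpq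
  have h2 : Tendsto (fun n => (p n).2) atTop (𝓝 q.2) := (continuous_snd.tendsto q).comp hpq
  obtain ⟨ns, hns, hae⟩ := (tendstoInMeasure_of_tendsto_Lp h1).exists_seq_tendsto_ae
  have hp' : ∀ᵐ x ∂μI, ∀ n, ((p n).1 x) ^ 2 ≤ 2 * ‖(p n).1‖ * ‖(p n).2‖ := ae_all_iff.2 hp
  filter_upwards [hae, hp'] with x hx hpx
  have h3 : Tendsto (fun n => 2 * ‖(p (ns n)).1‖ * ‖(p (ns n)).2‖) atTop
      (𝓝 (2 * ‖q.1‖ * ‖q.2‖)) :=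
    ((h1.norm.const_mul 2).mul h2.norm).comp hns.tendsto_atTop
  exact le_of_tendsto_of_tendsto' (hx.pow 2) h3 fun n => hpx (ns n)

/-- The constant `m(u) = 2 ‖u‖ ‖∂ₓu‖` of Agmon's inequality `u² ≤ m(u)`. -/
def agmon (u : H01) : ℝ := 2 * ‖u.toL2‖ * ‖u.dx‖

theorem agmon_nonneg (u : H01) : 0 ≤ agmon u := by unfold agmon; positivity

theorem test_eq_zero {φ : ℝ → ℝ} (h : tsupport φ ⊆ Ioo 0 1) {x : ℝ} (hx : x ∉ Ioo (0 : ℝ) 1) :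
    φ x = 0 := image_eq_zero_of_notMem_tsupport fun hx' => hx (h hx')

/-- Agmon's inequality. -/
theorem ae_sq_le_agmon (u : H01) : ∀ᵐ x ∂μI, (u.toL2 x) ^ 2 ≤ agmon u := by
  refine H01.induction (P := fun p => ∀ᵐ x ∂μI, (p.1 x) ^ 2 ≤ 2 * ‖p.1‖ * ‖p.2‖)
    isClosed_setOf_ae_sq_le ?_ u
  rintro p ⟨φ, h1, h2, h3, h4, h5⟩
  have hd : Continuous (deriv φ) := h1.continuous_deriv (by simp)
  filter_upwards [h4, ae_restrict_mem measurableSet_Ioo] with x hx hxI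
  rw [hx]
  -- For a test function, `φ(x)² = ∫₀ˣ 2 φ φ' ≤ 2 ∫₀¹ |φ| |φ'|`.
  have hder : ∀ y ∈ uIcc 0 x, HasDerivAt (fun y => φ y ^ 2) (2 * φ y * deriv φ y) y := by
    intro y _
    exact (((h1.differentiable (by simp) y).hasDerivAt).fun_pow 2).congr_deriv (by norm_num)
  have hint : IntervalIntegrable (fun y => 2 * φ y * deriv φ y) volume 0 x :=
    ((h1.continuous.const_mul 2 |>.comp continuous_id).mul hd).intervalIntegrable _ _
  have hftc := intervalIntegral.integral_eq_sub_of_hasDerivAt hder hint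
  rw [test_eq_zero h3 (x := 0) (by simp)] at hftc
  have hle : φ x ^ 2 ≤ 2 * ∫ y in Ioo (0 : ℝ) 1, |φ y| * |deriv φ y| := by
    have e1 : φ x ^ 2 = ∫ y in (0 : ℝ)..x, 2 * φ y * deriv φ y := by rw [hftc]; ring
    rw [e1, ← integral_const_mul, intervalIntegral.integral_of_le hxI.1.le,
      ← integral_Ioc_eq_integral_Ioo]
    have hi : IntegrableOn (fun y => 2 * (|φ y| * |deriv φ y|)) (Ioc 0 1) :=
      ((((h1.continuous.abs).mul hd.abs).const_mul 2).integrableOn_Icc).mono_set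
        Ioc_subset_Icc_self
    calc ∫ y in Ioc 0 x, 2 * φ y * deriv φ y
        ≤ ∫ y in Ioc 0 x, 2 * (|φ y| * |deriv φ y|) := by
          refine integral_mono ?_ ?_ fun y => ?_
          · exact (intervalIntegrable_iff_integrableOn_Ioc_of_le hxI.1.le).1 hint
          · exact hi.mono_set (Ioc_subset_Ioc_right hxI.2.le)
          · change 2 * φ y * deriv φ y ≤ 2 * (|φ y| * |deriv φ y|)
            rw [← abs_mul]
            nlinarith [le_abs_self (φ y * deriv φ y)]
      _ ≤ _ := setIntegral_mono_set hi (ae_of_all _ fun y => by positivity)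
          (Ioc_subset_Ioc_right hxI.2.le).eventuallyLE
  have hcs := L2.integral_abs_mul_abs_le p.1 p.2
  have : ∫ y in Ioo (0 : ℝ) 1, |φ y| * |deriv φ y| = ∫ x in Ioo (0 : ℝ) 1, |p.1 x| * |p.2 x| := by
    refine integral_congr_ae ?_
    filter_upwards [h4, h5] with y e1 e2
    rw [e1, e2]
  rw [this] at hle
  linarith

theorem ae_abs_le_agmon (u : H01) : ∀ᵐ x ∂μI, |u.toL2 x| ≤ √(agmon u) := by
  filter_upwards [ae_sq_le_agmon u] with x hx
  exact Real.abs_le_sqrt hx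

/-- Poincaré's inequality. -/
theorem H01.norm_toL2_le_dx (u : H01) : ‖u.toL2‖ ≤ 2 * ‖u.dx‖ := by
  have h : ‖u.toL2‖ ^ 2 ≤ agmon u := by
    rw [L2.norm_sq_eq]
    calc _ ≤ ∫ x in Ioo (0 : ℝ) 1, agmon u :=
          integral_mono_ae (by simpa [pow_two] using L2.integrable_mul u.toL2 u.toL2)
            (integrable_const _) (ae_sq_le_agmon u)
      _ = agmon u := by simp
  unfold agmon at h
  by_contra! hlt
  have : 0 < ‖u.toL2‖ := lt_of_le_of_lt (by positivity) hlt
  nlinarith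

theorem H01.norm_le_dx (u : H01) : ‖u‖ ≤ 2 * ‖u.dx‖ := by
  rw [H01.norm_eq]
  exact max_le u.norm_toL2_le_dx (by linarith [norm_nonneg u.dx])

/-- Integration by parts against a smooth function. -/
theorem H01.inner_contL2_dx (u : H01) {χ : ℝ → ℝ} (h1 : ContDiff ℝ ∞ χ) :
    inner ℝ (contL2 χ h1.continuous) u.dx
      = - inner ℝ (contL2 (deriv χ) (h1.continuous_deriv (by simp))) u.toL2 := by
  refine H01.induction (P := fun p => inner ℝ (contL2 χ h1.continuous) p.2
      = - inner ℝ (contL2 (deriv χ) (h1.continuous_deriv (by simp))) p.1) ?_ ?_ u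
  · exact isClosed_eq (continuous_const.inner continuous_snd)
      (continuous_const.inner continuous_fst).neg
  · rintro p ⟨φ, k1, k2, k3, k4, k5⟩
    rw [inner_contL2, inner_contL2]
    have e1 : ∫ x in Ioo (0 : ℝ) 1, χ x * p.2 x = ∫ x in (0 : ℝ)..1, χ x * deriv φ x := by
      rw [intervalIntegral.integral_of_le zero_le_one, integral_Ioc_eq_integral_Ioo]
      refine integral_congr_ae ?_
      filter_upwards [k5] with x hx
      rw [hx]
    have e2 : ∫ x in Ioo (0 : ℝ) 1, deriv χ x * p.1 x = ∫ x in (0 : ℝ)..1, deriv χ x * φ x := by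
      rw [intervalIntegral.integral_of_le zero_le_one, integral_Ioc_eq_integral_Ioo]
      refine integral_congr_ae ?_
      filter_upwards [k4] with x hx
      rw [hx]
    rw [e1, e2, intervalIntegral.integral_mul_deriv_eq_deriv_mul
      (fun x _ => (h1.differentiable (by simp) x).hasDerivAt)
      (fun x _ => (k1.differentiable (by simp) x).hasDerivAt)
      ((h1.continuous_deriv (by simp)).intervalIntegrable _ _)
      ((k1.continuous_deriv (by simp)).intervalIntegrable _ _),
      test_eq_zero k3 (x := 0) (by simp), test_eq_zero k3 (x := 1) (by simp)]
    simp

theorem L2.eq_zero_of_forall_test {a : L2}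
    (h : ∀ (χ : ℝ → ℝ) (h1 : ContDiff ℝ ∞ χ), HasCompactSupport χ → tsupport χ ⊆ Ioo 0 1 →
      inner ℝ (contL2 χ h1.continuous) a = 0) : a = 0 := by
  have hint : Integrable a μI := (Lp.memLp a).integrable (by norm_num)
  have := isOpen_Ioo.ae_eq_zero_of_integral_contDiff_smul_eq_zero (μ := volume) (f := a)
    (U := Ioo (0 : ℝ) 1) (IntegrableOn.locallyIntegrableOn hint) ?_
  · rw [Lp.eq_zero_iff_ae_eq_zero]
    rw [Filter.EventuallyEq, ae_restrict_iff' measurableSet_Ioo]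
    exact this
  · intro χ h1 h2 h3
    have := h χ h1 h2 h3
    rw [inner_contL2] at this
    refine Eq.trans ?_ this
    rw [← integral_indicator measurableSet_Ioo]
    refine integral_congr_ae (ae_of_all _ fun x => ?_)
    by_cases hx : x ∈ Ioo (0 : ℝ) 1
    · simp [hx]
    · simp [hx, test_eq_zero h3 hx]

/-- A function in `H₀¹` determines its weak derivative. -/
theorem H01.ext {u v : H01} (h : u.toL2 = v.toL2) : u = v := by
  have h0 : (u - v).toL2 = 0 := by simp [h]
  have hd : (u - v).dx = 0 := by
    refine L2.eq_zero_of_forall_test fun χ h1 _ _ => ?_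
    rw [H01.inner_contL2_dx _ h1, h0, inner_zero_right, neg_zero]
  rw [H01.dx_sub, sub_eq_zero] at hd
  exact Subtype.ext (Prod.ext h hd)

/-! ### Smooth functions that vanish at the end points -/

theorem L2.tendsto_of_dominated {a : ℕ → L2} {b : L2} {K : ℝ}
    (hb : ∀ n, ∀ᵐ x ∂μI, |a n x - b x| ≤ K)
    (hl : ∀ᵐ x ∂μI, Tendsto (fun n => a n x) atTop (𝓝 (b x))) :
    Tendsto a atTop (𝓝 b) := by
  have h2 : Tendsto (fun n => ‖a n - b‖ ^ 2) atTop (𝓝 0) := by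
    have e : ∀ n, ‖a n - b‖ ^ 2 = ∫ x in Ioo (0 : ℝ) 1, (a n x - b x) ^ 2 := by
      intro n
      rw [L2.norm_sq_eq]
      refine integral_congr_ae ?_
      filter_upwards [Lp.coeFn_sub (a n) b] with x hx
      rw [hx, Pi.sub_apply]
    simp_rw [e]
    suffices h0 : Tendsto (fun n => ∫ x in Ioo (0 : ℝ) 1, (a n x - b x) ^ 2) atTop
        (𝓝 (∫ x in Ioo (0 : ℝ) 1, (0 : ℝ))) by
      simpa using h0
    refine tendsto_integral_of_dominated_convergence (fun _ => K ^ 2) ?_ (integrable_const _) ?_ ?_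
    · intro n
      exact ((Lp.aestronglyMeasurable _).sub (Lp.aestronglyMeasurable _)).pow 2
    · intro n
      filter_upwards [hb n] with x hx
      rw [Real.norm_eq_abs, abs_pow]
      gcongr
    · filter_upwards [hl] with x hx
      have := (hx.sub_const (b x)).pow 2
      simpa using this
  rw [tendsto_iff_norm_sub_tendsto_zero]
  have := h2.sqrt
  simpa using this

/-- A smooth cutoff function supported where `n x (1 - x) ≥ 1`. -/
def cutoff (n : ℕ) (x : ℝ) : ℝ := Real.smoothTransition (n * (x * (1 - x)) - 1)

theorem contDiff_cutoff (n : ℕ) : ContDiff ℝ ∞ (cutoff n) := by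
  unfold cutoff
  refine Real.smoothTransition.contDiff.comp ?_
  fun_prop

theorem exists_bound_deriv_smoothTransition :
    ∃ S : ℝ, 0 ≤ S ∧ (∀ y, |deriv Real.smoothTransition y| ≤ S) ∧
      ∀ y, y ∉ Icc (0 : ℝ) 1 → deriv Real.smoothTransition y = 0 := by
  have hc : Continuous (deriv Real.smoothTransition) :=
    (Real.smoothTransition.contDiff (n := 1)).continuous_deriv (by simp)
  obtain ⟨C, hC⟩ := (isCompact_Icc (a := (0 : ℝ)) (b := 1)).exists_bound_of_continuousOn
    hc.continuousOn
  have hz : ∀ y, y ∉ Icc (0 : ℝ) 1 → deriv Real.smoothTransition y = 0 := by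
    intro y hy
    rw [mem_Icc, not_and_or, not_le, not_le] at hy
    rcases hy with hy | hy
    · have : Real.smoothTransition =ᶠ[𝓝 y] fun _ => 0 := by
        filter_upwards [Iio_mem_nhds hy] with z hz
        exact Real.smoothTransition.zero_of_nonpos hz.le
      rw [this.deriv_eq, deriv_const]
    · have : Real.smoothTransition =ᶠ[𝓝 y] fun _ => 1 := by
        filter_upwards [Ioi_mem_nhds hy] with z hz
        exact Real.smoothTransition.one_of_one_le hz.le
      rw [this.deriv_eq, deriv_const]
  refine ⟨max C 0, le_max_right _ _, fun y => ?_, hz⟩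
  by_cases hy : y ∈ Icc (0 : ℝ) 1
  · exact (hC y hy).trans (le_max_left _ _)
  · rw [hz y hy]; simp

/-- A smooth function that vanishes at the end points belongs to `H₀¹`: it is the limit of its
products with `cutoff n`. The derivatives of these products stay bounded, since the function is at
most of the order of `x (1 - x)`. -/
theorem mem_closure_testGraph {e : ℝ → ℝ} (he : ContDiff ℝ ∞ e) {C : ℝ}
    (hC : ∀ x ∈ Ioo (0 : ℝ) 1, |e x| ≤ C * (x * (1 - x))) :
    (contL2 e he.continuous, contL2 (deriv e) (he.continuous_deriv (by simp)))
      ∈ testGraph.topologicalClosure := by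
  obtain ⟨S, hS0, hS, hSz⟩ := exists_bound_deriv_smoothTransition
  have hsm : ∀ n, ContDiff ℝ ∞ (fun x => cutoff n x * e x) := fun n => (contDiff_cutoff n).mul he
  have hcd : ∀ n, Continuous (deriv (fun x => cutoff n x * e x)) :=
    fun n => (hsm n).continuous_deriv (by simp)
  have hdcut : ∀ (n : ℕ) (x : ℝ), HasDerivAt (cutoff n)
      (deriv Real.smoothTransition (n * (x * (1 - x)) - 1) * (n * (1 - 2 * x))) x := by
    intro n x
    have h1 : HasDerivAt Real.smoothTransition (deriv Real.smoothTransition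
        (n * (x * (1 - x)) - 1)) (n * (x * (1 - x)) - 1) :=
      ((Real.smoothTransition.contDiff (n := 1)).differentiable (by simp) _).hasDerivAt
    refine h1.comp x ?_
    exact ((((hasDerivAt_id x).fun_mul ((hasDerivAt_id x).const_sub 1)).const_mul
      (n : ℝ)).sub_const 1).congr_deriv (by simp only [id]; ring)
  have hder : ∀ (n : ℕ) (x : ℝ), deriv (fun x => cutoff n x * e x) x =
      deriv Real.smoothTransition (n * (x * (1 - x)) - 1) * (n * (1 - 2 * x)) * e x
        + cutoff n x * deriv e x := fun n x =>
    ((hdcut n x).fun_mul ((he.differentiable (by simp) x).hasDerivAt)).deriv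
  obtain ⟨C0, hC0⟩ := (isCompact_Icc (a := (0 : ℝ)) (b := 1)).exists_bound_of_continuousOn
    he.continuous.continuousOn
  obtain ⟨C1, hC1⟩ := (isCompact_Icc (a := (0 : ℝ)) (b := 1)).exists_bound_of_continuousOn
    (he.continuous_deriv (by simp)).continuousOn
  have hcut01 : ∀ n x, 0 ≤ cutoff n x ∧ cutoff n x ≤ 1 := fun n x =>
    ⟨Real.smoothTransition.nonneg _, Real.smoothTransition.le_one _⟩
  have hlarge : ∀ x ∈ Ioo (0 : ℝ) 1, ∀ᶠ n : ℕ in atTop, 1 < n * (x * (1 - x)) - 1 := by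
    intro x hx
    have hq : 0 < x * (1 - x) := mul_pos hx.1 (by linarith [hx.2])
    filter_upwards [(tendsto_natCast_atTop_atTop (R := ℝ)).eventually_gt_atTop
      (2 / (x * (1 - x)))] with n hn
    rw [div_lt_iff₀ hq] at hn
    linarith
  have hcut1 : ∀ x ∈ Ioo (0 : ℝ) 1, ∀ᶠ n : ℕ in atTop, cutoff n x = 1 := by
    intro x hx
    filter_upwards [hlarge x hx] with n hn
    exact Real.smoothTransition.one_of_one_le hn.le
  refine mem_closure_of_tendsto
    (f := fun n : ℕ => (contL2 _ (hsm n).continuous, contL2 _ (hcd n))) (b := atTop)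
    (Tendsto.prodMk_nhds ?_ ?_) (Eventually.of_forall fun n => ?_)
  · refine L2.tendsto_of_dominated (K := C0) (fun n => ?_) ?_
    · filter_upwards [coeFn_contL2 _ (hsm n).continuous, coeFn_contL2 e he.continuous,
        ae_restrict_mem measurableSet_Ioo] with x h1 h2 hx
      rw [h1, h2]
      have := hC0 x (Ioo_subset_Icc_self hx)
      rw [Real.norm_eq_abs] at this
      have h3 : cutoff n x * e x - e x = -((1 - cutoff n x) * e x) := by ring
      rw [h3, abs_neg, abs_mul, abs_of_nonneg (by linarith [(hcut01 n x).2])]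
      nlinarith [abs_nonneg (e x), hcut01 n x]
    · filter_upwards [ae_all_iff.2 fun n => coeFn_contL2 _ (hsm n).continuous,
        coeFn_contL2 e he.continuous, ae_restrict_mem measurableSet_Ioo] with x h1 h2 hx
      rw [h2]
      refine tendsto_const_nhds.congr' ?_
      filter_upwards [hcut1 x hx] with n hn
      rw [h1, hn, one_mul]
  · refine L2.tendsto_of_dominated (K := 2 * S * C + C1) (fun n => ?_) ?_
    · filter_upwards [coeFn_contL2 _ (hcd n), coeFn_contL2 _ (he.continuous_deriv (by simp)),
        ae_restrict_mem measurableSet_Ioo] with x h1 h2 hx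
      rw [h1, h2, hder]
      have hb := hC1 x (Ioo_subset_Icc_self hx)
      rw [Real.norm_eq_abs] at hb
      have hq : 0 < x * (1 - x) := mul_pos hx.1 (by linarith [hx.2])
      have hC' : 0 ≤ C := by
        by_contra! hneg
        have := (abs_nonneg _).trans (hC x hx)
        nlinarith
      -- On the support of `(cutoff n)'` one has `n x (1 - x) ≤ 2`, so the factor `n` is absorbed.
      have hA : |deriv Real.smoothTransition (n * (x * (1 - x)) - 1) * (n * (1 - 2 * x)) * e x|
          ≤ 2 * S * C := by
        by_cases hmem : (n * (x * (1 - x)) - 1) ∈ Icc (0 : ℝ) 1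
        · rw [abs_mul, abs_mul, abs_mul, Nat.abs_cast]
          have h12 : |1 - 2 * x| ≤ 1 := by rw [abs_le]; constructor <;> linarith [hx.1, hx.2]
          calc _ ≤ S * (n * 1) * (C * (x * (1 - x))) := by
                gcongr
                · exact hS _
                · exact hC x hx
            _ = S * C * (n * (x * (1 - x))) := by ring
            _ ≤ S * C * 2 := by
                gcongr
                linarith [hmem.2]
            _ = _ := by ring
        · rw [hSz _ hmem]
          simp only [zero_mul, abs_zero]
          positivity
      have hB : |cutoff n x * deriv e x - deriv e x| ≤ C1 := by
        have h3 : cutoff n x * deriv e x - deriv e x = -((1 - cutoff n x) * deriv e x) := by ring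
        rw [h3, abs_neg, abs_mul, abs_of_nonneg (by linarith [(hcut01 n x).2])]
        nlinarith [abs_nonneg (deriv e x), hcut01 n x]
      rw [add_sub_assoc]
      exact (abs_add_le _ _).trans (add_le_add hA hB)
    · filter_upwards [ae_all_iff.2 fun n => coeFn_contL2 _ (hcd n),
        coeFn_contL2 _ (he.continuous_deriv (by simp)),
        ae_restrict_mem measurableSet_Ioo] with x h1 h2 hx
      rw [h2]
      refine tendsto_const_nhds.congr' ?_
      filter_upwards [hcut1 x hx, hlarge x hx] with n hn hn2
      rw [h1, hder, hn, hSz _ (fun h => absurd h.2 (not_le.2 hn2))]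
      ring
  · have hsub : tsupport (fun x => cutoff n x * e x) ⊆ Ioo 0 1 := by
      have hcl : IsClosed {x : ℝ | 1 ≤ n * (x * (1 - x))} :=
        isClosed_le continuous_const (by fun_prop)
      have h1 : tsupport (fun x => cutoff n x * e x) ⊆ {x : ℝ | 1 ≤ n * (x * (1 - x))} := by
        refine closure_minimal (fun x hx => ?_) hcl
        by_contra hlt
        rw [mem_ofPred_eq, not_le] at hlt
        refine hx ?_
        have : cutoff n x = 0 := Real.smoothTransition.zero_of_nonpos (by linarith)
        simp [this]
      intro x hx
      have h2 := h1 hx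
      rw [mem_ofPred_eq] at h2
      have h3 : 0 < x * (1 - x) := by
        by_contra! hle
        have := mul_nonpos_of_nonneg_of_nonpos (Nat.cast_nonneg (α := ℝ) n) hle
        linarith
      constructor <;> nlinarith
    refine ⟨_, hsm n, ?_, hsub, coeFn_contL2 _ (hsm n).continuous, coeFn_contL2 _ (hcd n)⟩
    exact HasCompactSupport.of_support_subset_isCompact isCompact_Icc
      ((subset_tsupport _).trans (hsub.trans Ioo_subset_Icc_self))

/-! ### The basis of sines -/

theorem H01.toL2_sum {ι : Type*} (s : Finset ι) (f : ι → H01) :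
    (∑ k ∈ s, f k).toL2 = ∑ k ∈ s, (f k).toL2 := map_sum toL2L _ _

theorem H01.dx_sum {ι : Type*} (s : Finset ι) (f : ι → H01) :
    (∑ k ∈ s, f k).dx = ∑ k ∈ s, (f k).dx := map_sum dxL _ _

/-- The frequency `(k + 1) π`. -/
def freq (k : ℕ) : ℝ := (k + 1) * Real.pi

theorem freq_pos (k : ℕ) : 0 < freq k := by unfold freq; positivity

/-- The normalized eigenfunction `√2 sin ((k + 1) π x)` of `A`. -/
def sine (k : ℕ) (x : ℝ) : ℝ := √2 * Real.sin (freq k * x)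

theorem contDiff_sine (k : ℕ) : ContDiff ℝ ∞ (sine k) := by unfold sine; fun_prop

theorem deriv_sine (k : ℕ) : deriv (sine k) = fun x => √2 * (freq k * Real.cos (freq k * x)) := by
  ext x
  have h := ((hasDerivAt_id x).const_mul (freq k)).sin.const_mul (√2)
  refine Eq.trans (HasDerivAt.deriv h) ?_
  simp only [id]; ring

theorem contDiff_deriv_sine (k : ℕ) : ContDiff ℝ ∞ (deriv (sine k)) := by
  rw [deriv_sine]; fun_prop

theorem deriv_deriv_sine (k : ℕ) : deriv (deriv (sine k)) = fun x => -(freq k ^ 2 * sine k x) := by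
  rw [deriv_sine]
  ext x
  have h := (((hasDerivAt_id x).const_mul (freq k)).cos.const_mul (freq k)).const_mul (√2)
  refine Eq.trans (HasDerivAt.deriv h) ?_
  simp only [id, sine]; ring

theorem abs_sine_le (k : ℕ) {x : ℝ} (hx : x ∈ Ioo (0 : ℝ) 1) :
    |sine k x| ≤ (√2 * (2 * freq k)) * (x * (1 - x)) := by
  have h1 : |Real.sin (freq k * x)| ≤ freq k * x := by
    refine Real.abs_sin_le_abs.trans_eq (abs_of_nonneg ?_)
    exact mul_nonneg (freq_pos k).le hx.1.le
  have h2 : |Real.sin (freq k * x)| ≤ freq k * (1 - x) := by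
    have e : |Real.sin (freq k * x)| = |Real.sin (freq k * (1 - x))| := by
      have : freq k * (1 - x) = ((k + 1 : ℕ) : ℝ) * Real.pi - freq k * x := by
        unfold freq; push_cast; ring
      rw [this, Real.sin_nat_mul_pi_sub]
      simp [abs_mul]
    rw [e]
    refine Real.abs_sin_le_abs.trans_eq (abs_of_nonneg ?_)
    exact mul_nonneg (freq_pos k).le (by linarith [hx.2])
  have h3 : |Real.sin (freq k * x)| ≤ 2 * freq k * (x * (1 - x)) := by
    have hf := freq_pos k
    rcases le_total x (1 / 2) with hle | hle
    · refine h1.trans ?_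
      have : 0 ≤ freq k * x * (1 - 2 * x) :=
        mul_nonneg (mul_nonneg hf.le hx.1.le) (by linarith)
      linarith
    · refine h2.trans ?_
      have : 0 ≤ freq k * (1 - x) * (2 * x - 1) :=
        mul_nonneg (mul_nonneg hf.le (by linarith [hx.2])) (by linarith)
      linarith
  unfold sine
  rw [abs_mul, abs_of_nonneg (Real.sqrt_nonneg 2), mul_assoc]
  gcongr

/-- The eigenfunctions `sine k` as elements of `H₀¹`. -/
def eig (k : ℕ) : H01 :=
  ⟨_, mem_closure_testGraph (contDiff_sine k) fun _ hx => abs_sine_le k hx⟩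

theorem eig_toL2 (k : ℕ) : (eig k).toL2 = contL2 (sine k) (contDiff_sine k).continuous := rfl

theorem eig_dx (k : ℕ) : (eig k).dx
    = contL2 (deriv (sine k)) ((contDiff_sine k).continuous_deriv (by simp)) := rfl

theorem inner_eig_dx (k : ℕ) (u : H01) :
    inner ℝ (eig k).dx u.dx = freq k ^ 2 * inner ℝ (eig k).toL2 u.toL2 := by
  rw [eig_dx, H01.inner_contL2_dx u (contDiff_deriv_sine k), inner_contL2, eig_toL2, inner_contL2,
    ← integral_const_mul, ← integral_neg]
  refine integral_congr_ae (ae_of_all _ fun x => ?_)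
  simp only [deriv_deriv_sine]
  ring

theorem norm_eig (k : ℕ) : ‖(eig k).toL2‖ = 1 := by
  have h : ‖(eig k).toL2‖ ^ 2 = 1 := by
    rw [← real_inner_self_eq_norm_sq]
    conv_lhs => enter [2]; rw [eig_toL2]
    rw [inner_contL2]
    have e1 : ∫ x in Ioo (0 : ℝ) 1, sine k x * (eig k).toL2 x
        = ∫ x in (0 : ℝ)..1, sine k x * sine k x := by
      rw [intervalIntegral.integral_of_le zero_le_one, integral_Ioc_eq_integral_Ioo]
      refine integral_congr_ae ?_
      filter_upwards [coeFn_contL2 (sine k) (contDiff_sine k).continuous] with x hx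
      rw [eig_toL2, hx]
    rw [e1]
    have hf := (freq_pos k).ne'
    have hder : ∀ x ∈ uIcc (0 : ℝ) 1, HasDerivAt
        (fun x => x - Real.sin (freq k * x) * Real.cos (freq k * x) / freq k)
        (sine k x * sine k x) x := by
      intro x _
      have hl := (hasDerivAt_id x).const_mul (freq k)
      refine ((hasDerivAt_id x).sub ((hl.sin.fun_mul hl.cos).div_const (freq k))).congr_deriv ?_
      simp only [id, sine]
      field_simp
      have h2 : √2 ^ 2 = 2 := Real.sq_sqrt (by norm_num)
      rw [h2]
      linear_combination -Real.sin_sq_add_cos_sq (freq k * x)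
    rw [intervalIntegral.integral_eq_sub_of_hasDerivAt hder]
    · have : Real.sin (freq k * 1) = 0 := by
        rw [mul_one]
        have := Real.sin_nat_mul_pi (k + 1)
        unfold freq; exact_mod_cast this
      rw [this]; simp
    · exact ((contDiff_sine k).continuous.mul (contDiff_sine k).continuous).intervalIntegrable _ _
  nlinarith [norm_nonneg (eig k).toL2]

theorem orthonormal_eig : Orthonormal ℝ fun k => (eig k).toL2 := by
  refine ⟨norm_eig, fun j k hjk => ?_⟩
  have h1 := inner_eig_dx j (eig k)
  have h2 := inner_eig_dx k (eig j)
  rw [real_inner_comm, real_inner_comm (eig j).toL2] at h2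
  have h3 : (freq j ^ 2 - freq k ^ 2) * inner ℝ (eig j).toL2 (eig k).toL2 = 0 := by linarith
  rcases mul_eq_zero.1 h3 with h | h
  · exfalso
    have h4 : freq j = freq k :=
      (pow_left_inj₀ (freq_pos j).le (freq_pos k).le two_ne_zero).1 (sub_eq_zero.1 h)
    unfold freq at h4
    have := mul_right_cancel₀ Real.pi_ne_zero h4
    exact hjk (by exact_mod_cast add_right_cancel this)
  · exact h

theorem integrable_L2_mul_continuous (a : L2) {f : ℝ → ℝ} (hf : Continuous f) :
    Integrable (fun x => a x * f x) μI :=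
  (Lp.memLp a).integrable_mul (memLp_of_continuous hf)

/-- The sines are complete in `L²(0,1)`: a function orthogonal to all of them is orthogonal to
`sin (π x) p(cos (π x))` for every polynomial `p`, and the `p(cos (π x))` are dense in the
continuous functions on `[0,1]`. -/
theorem L2.eq_zero_of_forall_inner_eig {a : L2} (h : ∀ k, inner ℝ (eig k).toL2 a = 0) :
    a = 0 := by
  have hcont : ∀ (m k : ℕ), Continuous fun x : ℝ =>
      Real.sin (k * (Real.pi * x)) * Real.cos (Real.pi * x) ^ m := fun m k => by fun_prop
  -- Induction on `m`, with `2 sin (k θ) cos θ = sin ((k + 1) θ) + sin ((k - 1) θ)`.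
  have h1 : ∀ m k : ℕ, ∫ x in Ioo (0 : ℝ) 1,
      a x * (Real.sin (k * (Real.pi * x)) * Real.cos (Real.pi * x) ^ m) = 0 := by
    intro m
    induction m with
    | zero =>
      intro k
      cases k with
      | zero => simp
      | succ k =>
        have := h k
        rw [eig_toL2, inner_contL2] at this
        have h2 : √2 * ∫ x in Ioo (0 : ℝ) 1,
            a x * (Real.sin ((k + 1 : ℕ) * (Real.pi * x)) * Real.cos (Real.pi * x) ^ 0) = 0 := by
          rw [← integral_const_mul]
          refine Eq.trans (integral_congr_ae (ae_of_all _ fun x => ?_)) this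
          simp only [sine, freq]
          push_cast
          ring_nf
        exact (mul_eq_zero.1 h2).resolve_left (by positivity)
    | succ m ih =>
      intro k
      cases k with
      | zero => simp
      | succ k =>
        have e : ∀ x : ℝ, a x * (Real.sin ((k + 1 : ℕ) * (Real.pi * x))
              * Real.cos (Real.pi * x) ^ (m + 1))
            = 2⁻¹ * (a x * (Real.sin ((k + 2 : ℕ) * (Real.pi * x)) * Real.cos (Real.pi * x) ^ m)
              + a x * (Real.sin (k * (Real.pi * x)) * Real.cos (Real.pi * x) ^ m)) := by
          intro x
          have e1 : ((k + 2 : ℕ) : ℝ) * (Real.pi * x)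
              = (k + 1 : ℕ) * (Real.pi * x) + Real.pi * x := by push_cast; ring
          have e2 : (k : ℝ) * (Real.pi * x)
              = (k + 1 : ℕ) * (Real.pi * x) - Real.pi * x := by push_cast; ring
          rw [e1, e2, Real.sin_add, Real.sin_sub]
          ring
        simp_rw [e]
        rw [integral_const_mul, integral_add (integrable_L2_mul_continuous a (hcont m (k + 2)))
          (integrable_L2_mul_continuous a (hcont m k)), ih (k + 2), ih k]
        simp
  have hcp : ∀ p : Polynomial ℝ, Continuous fun x : ℝ =>
      Real.sin (Real.pi * x) * p.eval (Real.cos (Real.pi * x)) := fun p => by fun_prop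
  have h2 : ∀ p : Polynomial ℝ, ∫ x in Ioo (0 : ℝ) 1,
      a x * (Real.sin (Real.pi * x) * p.eval (Real.cos (Real.pi * x))) = 0 := by
    intro p
    induction p using Polynomial.induction_on' with
    | add p q hp hq =>
      simp_rw [Polynomial.eval_add, mul_add]
      have ip := integrable_L2_mul_continuous a (hcp p)
      have iq := integrable_L2_mul_continuous a (hcp q)
      rw [integral_add ip iq, hp, hq, add_zero]
    | monomial n c =>
      have := h1 n 1
      simp_rw [Polynomial.eval_monomial]
      have e : ∀ x, a x * (Real.sin (Real.pi * x) * (c * Real.cos (Real.pi * x) ^ n))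
          = c * (a x * (Real.sin ((1 : ℕ) * (Real.pi * x)) * Real.cos (Real.pi * x) ^ n)) := by
        intro x; push_cast; ring_nf
      simp_rw [e]
      rw [integral_const_mul, this, mul_zero]
  -- By Weierstrass' theorem, `x ↦ a(x) sin (π x)` is orthogonal to every test function, and
  -- `sin (π x)` has no zero in `(0,1)`.
  have hmem : MemLp (fun x => a x * Real.sin (Real.pi * x)) 2 μI := by
    refine (Lp.memLp a).of_le ((Lp.aestronglyMeasurable a).mul
      (Continuous.aestronglyMeasurable (by fun_prop))) (ae_of_all _ fun x => ?_)
    rw [norm_mul]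
    exact mul_le_of_le_one_right (norm_nonneg _) (Real.abs_sin_le_one _)
  have hb : hmem.toLp _ = 0 := by
    refine L2.eq_zero_of_forall_test fun χ hχ _ _ => ?_
    have ha1 : Integrable (fun x => |a x|) μI := ((Lp.memLp a).integrable (by norm_num)).abs
    rw [inner_contL2]
    have e : ∫ x in Ioo (0 : ℝ) 1, χ x * hmem.toLp _ x
        = ∫ x in Ioo (0 : ℝ) 1, a x * (Real.sin (Real.pi * x) * χ x) := by
      refine integral_congr_ae ?_
      filter_upwards [hmem.coeFn_toLp] with x hx
      rw [hx]; ring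
    rw [e]
    refine abs_eq_zero.1 (le_antisymm (le_of_forall_pos_le_add fun ε hε => ?_) (abs_nonneg _))
    set M := ∫ x in Ioo (0 : ℝ) 1, |a x| with hM
    have hM0 : 0 ≤ M := integral_nonneg fun x => abs_nonneg _
    obtain ⟨p, hp⟩ := exists_polynomial_near_of_continuousOn (-1) 1
      (fun y => χ (Real.arccos y / Real.pi))
      (hχ.continuous.comp (g := χ) (Real.continuous_arccos.div_const _)).continuousOn
      (ε / (M + 1)) (by positivity)
    have hi := integrable_L2_mul_continuous a
      (f := fun x => Real.sin (Real.pi * x) * χ x)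
      ((Real.continuous_sin.comp (continuous_const.mul continuous_id)).mul hχ.continuous)
    have hi2 := integrable_L2_mul_continuous a (hcp p)
    have e2 : ∫ x in Ioo (0 : ℝ) 1, a x * (Real.sin (Real.pi * x) * χ x)
        = ∫ x in Ioo (0 : ℝ) 1, (a x * (Real.sin (Real.pi * x) * χ x)
          - a x * (Real.sin (Real.pi * x) * p.eval (Real.cos (Real.pi * x)))) := by
      rw [integral_sub hi hi2, h2 p, sub_zero]
    rw [e2, zero_add, ← Real.norm_eq_abs]
    calc _ ≤ ∫ x in Ioo (0 : ℝ) 1, |a x| * (ε / (M + 1)) := by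
          refine norm_integral_le_of_norm_le (ha1.mul_const _) ?_
          filter_upwards [ae_restrict_mem measurableSet_Ioo] with x hx
          rw [← mul_sub, ← mul_sub, norm_mul, norm_mul, Real.norm_eq_abs, Real.norm_eq_abs,
            Real.norm_eq_abs]
          have h3 := hp (Real.cos (Real.pi * x)) ⟨Real.neg_one_le_cos _, Real.cos_le_one _⟩
          rw [Real.arccos_cos (mul_nonneg Real.pi_pos.le hx.1.le)
            (by nlinarith [Real.pi_pos, hx.2]), mul_div_cancel_left₀ _ Real.pi_ne_zero,
            abs_sub_comm] at h3
          gcongr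
          calc _ ≤ 1 * (ε / (M + 1)) :=
                mul_le_mul (Real.abs_sin_le_one _) h3.le (abs_nonneg _) zero_le_one
            _ = _ := one_mul _
      _ = M * (ε / (M + 1)) := by rw [integral_mul_const]
      _ ≤ ε := by
          rw [mul_div_assoc', div_le_iff₀ (by positivity)]
          nlinarith
  rw [Lp.eq_zero_iff_ae_eq_zero]
  rw [Lp.eq_zero_iff_ae_eq_zero] at hb
  filter_upwards [hb, hmem.coeFn_toLp, ae_restrict_mem measurableSet_Ioo] with x h3 h4 hx
  rw [h3] at h4
  have hs : 0 < Real.sin (Real.pi * x) := Real.sin_pos_of_pos_of_lt_pi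
    (mul_pos Real.pi_pos hx.1) (by nlinarith [Real.pi_pos, hx.2])
  exact (mul_eq_zero.1 h4.symm).resolve_right hs.ne'

/-- The Hilbert basis of sines. -/
def sineBasis : HilbertBasis ℕ ℝ L2 := HilbertBasis.mkOfOrthogonalEqBot orthonormal_eig (by
  rw [Submodule.eq_bot_iff]
  intro a ha
  refine L2.eq_zero_of_forall_inner_eig fun k => ?_
  exact (Submodule.mem_orthogonal _ _).1 ha _ (Submodule.subset_span ⟨k, rfl⟩))

theorem coe_sineBasis (k : ℕ) : sineBasis k = (eig k).toL2 := by
  simp [sineBasis]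

theorem norm_sq_sum_eig (s : Finset ℕ) (c : ℕ → ℝ) :
    ‖(∑ k ∈ s, c k • eig k).toL2‖ ^ 2 = ∑ k ∈ s, c k ^ 2 := by
  rw [H01.toL2_sum, ← real_inner_self_eq_norm_sq]
  simp_rw [H01.toL2_smul]
  rw [orthonormal_eig.inner_sum]
  simp [pow_two]

/-- The normalized cosines `∂ₓ(eig k) / freq k`. -/
theorem orthonormal_eig_dx : Orthonormal ℝ fun k => (freq k)⁻¹ • (eig k).dx := by
  have h := orthonormal_iff_ite.1 orthonormal_eig
  refine orthonormal_iff_ite.2 fun j k => ?_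
  rw [inner_smul_left, inner_smul_right, inner_eig_dx, h j k]
  have := (freq_pos j).ne'
  split_ifs with hjk
  · subst hjk
    simp
    field_simp
  · simp

theorem norm_sq_sum_eig_dx (s : Finset ℕ) (c : ℕ → ℝ) :
    ‖(∑ k ∈ s, c k • eig k).dx‖ ^ 2 = ∑ k ∈ s, freq k ^ 2 * c k ^ 2 := by
  have e : (∑ k ∈ s, c k • eig k).dx = ∑ k ∈ s, (freq k * c k) • ((freq k)⁻¹ • (eig k).dx) := by
    rw [H01.dx_sum]
    refine Finset.sum_congr rfl fun k _ => ?_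
    rw [H01.dx_smul, smul_smul]
    have := (freq_pos k).ne'
    congr 1
    field_simp
  rw [e, ← real_inner_self_eq_norm_sq, orthonormal_eig_dx.inner_sum]
  refine Finset.sum_congr rfl fun k _ => ?_
  simp; ring

/-- The projection of `u` to the span of the first `n` eigenfunctions. -/
def proj (n : ℕ) (u : H01) : H01 := ∑ k ∈ Finset.range n, inner ℝ (eig k).toL2 u.toL2 • eig k

theorem dx_proj (n : ℕ) (u : H01) : (proj n u).dx = ∑ k ∈ Finset.range n,
    inner ℝ ((freq k)⁻¹ • (eig k).dx) u.dx • ((freq k)⁻¹ • (eig k).dx) := by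
  unfold proj
  rw [H01.dx_sum]
  refine Finset.sum_congr rfl fun k _ => ?_
  rw [H01.dx_smul, inner_smul_left, inner_eig_dx, smul_smul]
  have := (freq_pos k).ne'
  congr 1
  simp
  field_simp

theorem norm_proj_le (n : ℕ) (u : H01) : ‖proj n u‖ ≤ 2 * ‖u‖ := by
  refine (H01.norm_le_dx _).trans ?_
  have h : ‖(proj n u).dx‖ ^ 2 ≤ ‖u.dx‖ ^ 2 := by
    rw [dx_proj, ← real_inner_self_eq_norm_sq, orthonormal_eig_dx.inner_sum]
    refine le_of_eq_of_le ?_ (orthonormal_eig_dx.sum_inner_products_le u.dx (s := Finset.range n))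
    refine Finset.sum_congr rfl fun k _ => ?_
    simp [pow_two]
  have := (pow_le_pow_iff_left₀ (norm_nonneg _) (norm_nonneg _) two_ne_zero).1 h
  linarith [u.norm_dx_le]

theorem tendsto_proj_toL2 (u : H01) :
    Tendsto (fun n => (proj n u).toL2) atTop (𝓝 u.toL2) := by
  have h := (sineBasis.hasSum_repr u.toL2).tendsto_sum_nat
  refine h.congr fun n => ?_
  unfold proj
  rw [H01.toL2_sum]
  refine Finset.sum_congr rfl fun k _ => ?_
  rw [sineBasis.repr_apply_apply, coe_sineBasis, H01.toL2_smul]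

theorem tendsto_proj (u : H01) : Tendsto (fun n => proj n u) atTop (𝓝 u) := by
  have hs : Summable fun k => inner ℝ ((freq k)⁻¹ • (eig k).dx) u.dx • ((freq k)⁻¹ • (eig k).dx) := by
    have := (orthonormal_eig_dx.orthogonalFamily.summable_iff_norm_sq_summable
      (fun k => inner ℝ ((freq k)⁻¹ • (eig k).dx) u.dx)).2
      (orthonormal_eig_dx.inner_products_summable u.dx)
    simpa using this
  have h2 := hs.hasSum.tendsto_sum_nat
  have h3 : Tendsto (fun n => (proj n u).1) atTop (𝓝 (u.toL2, _)) :=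
    (tendsto_proj_toL2 u).prodMk_nhds (h2.congr fun n => (dx_proj n u).symm)
  have hmem := mem_closure_of_tendsto h3 (Eventually.of_forall fun n => (proj n u).2)
  rw [Submodule.topologicalClosure_coe, closure_closure] at hmem
  have hu : (⟨_, hmem⟩ : H01) = u := H01.ext rfl
  have h4 : (⟨_, hmem⟩ : H01).1 = u.1 := congrArg Subtype.val hu
  dsimp only at h4
  rw [h4] at h3
  exact tendsto_subtype_rng.2 h3

/-! ### Truncation -/

/-- The truncation of `a` to the interval `[-R, R]`. -/
def clamp (R a : ℝ) : ℝ := max (-R) (min a R)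

theorem continuous_clamp (R : ℝ) : Continuous (clamp R) := by unfold clamp; fun_prop

theorem clamp_of_abs_le {R a : ℝ} (h : |a| ≤ R) : clamp R a = a := by
  rw [abs_le] at h
  simp [clamp, h.1, h.2]

theorem abs_clamp_le {R : ℝ} (hR : 0 ≤ R) (a : ℝ) : |clamp R a| ≤ R := by
  unfold clamp; grind

theorem abs_clamp_le_abs {R : ℝ} (hR : 0 ≤ R) (a : ℝ) : |clamp R a| ≤ |a| := by
  unfold clamp; grind

theorem abs_clamp_sub_clamp_le (R a b : ℝ) : |clamp R a - clamp R b| ≤ |a - b| := by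
  unfold clamp; grind

theorem clamp_mono (R : ℝ) : Monotone (clamp R) := fun a b h => by
  unfold clamp; gcongr

theorem abs_sub_clamp_le {R : ℝ} (hR : 0 < R) (a : ℝ) : |clamp R a - a| ≤ a ^ 2 / R := by
  rcases le_or_gt |a| R with h | h
  · rw [clamp_of_abs_le h]; simp; positivity
  · have h1 : |clamp R a - a| ≤ |a| := by unfold clamp; grind
    refine h1.trans ?_
    rw [le_div_iff₀ hR, ← sq_abs]
    nlinarith

/-! ### Admissible nonlinearities -/

/-- The properties of the functions `g a = a²` and `c a = a (1 - a) (a - γ)` on which the estimates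
rest: a local Lipschitz condition for each, and a one-sided global Lipschitz condition for `c`.
Truncation preserves them, with the same constants. -/
structure Admissible (g c : ℝ → ℝ) : Prop where
  cont_g : Continuous g
  cont_c : Continuous c
  g_zero : g 0 = 0
  c_zero : c 0 = 0
  g_sub : ∀ a b, |g a - g b| ≤ (|a| + |b|) * |a - b|
  c_sub : ∀ a b, |c a - c b| ≤ 4 * (1 + a ^ 2 + b ^ 2) * |a - b|
  c_mono : ∀ a b, (c a - c b) * (a - b) ≤ 4 * (a - b) ^ 2

/-- Two pairs of nonlinearities are `δ`-close, relative to weights that are integrable along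
functions in the solution space. -/
structure Close (δ : ℝ) (g₁ c₁ g₂ c₂ : ℝ → ℝ) : Prop where
  nonneg : 0 ≤ δ
  g : ∀ a, |g₁ a - g₂ a| ≤ δ * (1 + a ^ 2) * |a|
  c : ∀ a, |c₁ a - c₂ a| ≤ δ * (1 + a ^ 2) ^ 2 * |a|

theorem Close.refl (g c : ℝ → ℝ) : Close 0 g c g c := ⟨le_rfl, by simp, by simp⟩

theorem Close.symm {δ : ℝ} {g₁ c₁ g₂ c₂ : ℝ → ℝ} (h : Close δ g₁ c₁ g₂ c₂) :
    Close δ g₂ c₂ g₁ c₁ :=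
  ⟨h.nonneg, fun a => by rw [abs_sub_comm]; exact h.g a,
    fun a => by rw [abs_sub_comm]; exact h.c a⟩

theorem Close.trans {δ δ' : ℝ} {g₁ c₁ g₂ c₂ g₃ c₃ : ℝ → ℝ} (h : Close δ g₁ c₁ g₂ c₂)
    (h' : Close δ' g₂ c₂ g₃ c₃) : Close (δ + δ') g₁ c₁ g₃ c₃ :=
  ⟨add_nonneg h.nonneg h'.nonneg,
    fun a => by
      have := abs_sub_le (g₁ a) (g₂ a) (g₃ a)
      linarith [h.g a, h'.g a],
    fun a => by
      have := abs_sub_le (c₁ a) (c₂ a) (c₃ a)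
      linarith [h.c a, h'.c a]⟩

section Truncation

variable {g c : ℝ → ℝ}

theorem sq_clamp_le {R : ℝ} (hR : 0 ≤ R) (a : ℝ) : clamp R a ^ 2 ≤ a ^ 2 :=
  sq_le_sq.2 (abs_clamp_le_abs hR a)

theorem Admissible.truncate (h : Admissible g c) {R : ℝ} (hR : 0 ≤ R) :
    Admissible (fun a => g (clamp R a)) (fun a => c (clamp R a)) where
  cont_g := h.cont_g.comp (continuous_clamp R)
  cont_c := h.cont_c.comp (continuous_clamp R)
  g_zero := by rw [clamp_of_abs_le (by simpa using hR), h.g_zero]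
  c_zero := by rw [clamp_of_abs_le (by simpa using hR), h.c_zero]
  g_sub a b := (h.g_sub _ _).trans (by
    have h1 := abs_clamp_le_abs hR a
    have h2 := abs_clamp_le_abs hR b
    have h3 := abs_clamp_sub_clamp_le R a b
    gcongr ?_ * ?_
    linarith)
  c_sub a b := (h.c_sub _ _).trans (by
    have h1 := sq_clamp_le hR a
    have h2 := sq_clamp_le hR b
    have h3 := abs_clamp_sub_clamp_le R a b
    gcongr ?_ * ?_
    linarith)
  c_mono a b := by
    have h1 := h.c_mono (clamp R a) (clamp R b)
    have h2 := abs_clamp_sub_clamp_le R a b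
    set X := c (clamp R a) - c (clamp R b)
    rcases lt_trichotomy (clamp R a - clamp R b) 0 with hd | hd | hd
    · have hab : a < b := by
        by_contra! hle
        linarith [clamp_mono R hle]
      rw [abs_of_neg hd, abs_of_neg (by linarith)] at h2
      have hX : 4 * (clamp R a - clamp R b) ≤ X := by nlinarith
      nlinarith
    · have : X = 0 := by simp [X, sub_eq_zero.1 hd]
      rw [this, zero_mul]; positivity
    · have hab : b < a := by
        by_contra! hle
        linarith [clamp_mono R hle]
      rw [abs_of_pos hd, abs_of_pos (by linarith)] at h2
      have hX : X ≤ 4 * (clamp R a - clamp R b) := by nlinarith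
      nlinarith

theorem Admissible.close_truncate (h : Admissible g c) {R : ℝ} (hR : 0 < R) :
    Close (8 / R) (fun a => g (clamp R a)) (fun a => c (clamp R a)) g c where
  nonneg := by positivity
  g a := by
    have h1 := abs_clamp_le_abs hR.le a
    have h2 := abs_sub_clamp_le hR a
    calc _ ≤ (|clamp R a| + |a|) * |clamp R a - a| := h.g_sub _ _
      _ ≤ (|a| + |a|) * (a ^ 2 / R) := by gcongr
      _ = (2 / R * a ^ 2) * |a| := by ring
      _ ≤ _ := by
        have : 2 / R ≤ 8 / R := by gcongr; norm_num
        gcongr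
        linarith
  c a := by
    have h1 := sq_clamp_le hR.le a
    have h2 := abs_sub_clamp_le hR a
    calc _ ≤ 4 * (1 + clamp R a ^ 2 + a ^ 2) * |clamp R a - a| := h.c_sub _ _
      _ ≤ 4 * (2 * (1 + a ^ 2)) * (a ^ 2 / R) := by gcongr; linarith
      _ = 8 / R * (1 + a ^ 2) * |a| * |a| := by
        rw [mul_assoc (8 / R * (1 + a ^ 2)), abs_mul_abs_self]; ring
      _ ≤ 8 / R * (1 + a ^ 2) * (1 + a ^ 2) * |a| := by
        gcongr
        nlinarith [sq_abs a, sq_nonneg (|a| - 1), abs_nonneg a]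
      _ = _ := by ring

theorem Admissible.truncate_g_sub_le (h : Admissible g c) {R : ℝ} (hR : 0 ≤ R) (a b : ℝ) :
    |g (clamp R a) - g (clamp R b)| ≤ 2 * R * |a - b| :=
  (h.g_sub _ _).trans (by
    have h1 := abs_clamp_le hR a
    have h2 := abs_clamp_le hR b
    have h3 := abs_clamp_sub_clamp_le R a b
    gcongr ?_ * ?_
    linarith)

theorem Admissible.truncate_c_sub_le (h : Admissible g c) {R : ℝ} (hR : 0 ≤ R) (a b : ℝ) :
    |c (clamp R a) - c (clamp R b)| ≤ 4 * (1 + 2 * R ^ 2) * |a - b| :=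
  (h.c_sub _ _).trans (by
    have h1 : clamp R a ^ 2 ≤ R ^ 2 := sq_le_sq.2 ((abs_clamp_le hR a).trans (le_abs_self R))
    have h2 : clamp R b ^ 2 ≤ R ^ 2 := sq_le_sq.2 ((abs_clamp_le hR b).trans (le_abs_self R))
    have h3 := abs_clamp_sub_clamp_le R a b
    gcongr ?_ * ?_
    linarith)

end Truncation

/-- The nonlinearities of the Burgers–Huxley equation are admissible. -/
theorem admissible_burgersHuxley {γ : ℝ} (hγ : γ ∈ Ioo (0 : ℝ) 1) :
    Admissible (fun a => a ^ 2) (fun a => a * (1 - a) * (a - γ)) where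
  cont_g := by fun_prop
  cont_c := by fun_prop
  g_zero := by simp
  c_zero := by simp
  g_sub a b := by
    rw [show a ^ 2 - b ^ 2 = (a + b) * (a - b) by ring, abs_mul]
    gcongr
    exact abs_add_le a b
  c_sub a b := by
    rw [show a * (1 - a) * (a - γ) - b * (1 - b) * (b - γ)
      = (-(a ^ 2 + a * b + b ^ 2) + (1 + γ) * (a + b) - γ) * (a - b) by ring, abs_mul]
    gcongr
    obtain ⟨h0, h1⟩ := hγ
    have ha := sq_nonneg (a - 1)
    have ha' := sq_nonneg (a + 1)
    have hb := sq_nonneg (b - 1)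
    have hb' := sq_nonneg (b + 1)
    rw [abs_le]
    constructor <;> nlinarith [sq_nonneg (a - b), sq_nonneg (a + b), sq_nonneg (a + b - 1),
      sq_nonneg (a + b + 1)]
  c_mono a b := by
    rw [show (a * (1 - a) * (a - γ) - b * (1 - b) * (b - γ)) * (a - b)
      = (-(a ^ 2 + a * b + b ^ 2) + (1 + γ) * (a + b) - γ) * (a - b) ^ 2 by ring]
    gcongr
    obtain ⟨h0, h1⟩ := hγ
    nlinarith [sq_nonneg (a - b), sq_nonneg (3 * (a + b) - 2 * (1 + γ))]

/-! ### Superposition operators -/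

/-- The function `x ↦ f (u x)`, if it belongs to `L²(0,1)`, and the junk value `0` otherwise. -/
def nem (f : ℝ → ℝ) (u : L2) : L2 :=
  open Classical in if h : MemLp (fun x => f (u x)) 2 μI then h.toLp _ else 0

theorem coeFn_nem_of_memLp {f : ℝ → ℝ} {u : L2} (h : MemLp (fun x => f (u x)) 2 μI) :
    nem f u =ᵐ[μI] fun x => f (u x) := by
  unfold nem
  rw [dif_pos h]
  exact h.coeFn_toLp

theorem memLp_comp_H01 {f : ℝ → ℝ} (hf : Continuous f) (u : H01) :
    MemLp (fun x => f (u.toL2 x)) 2 μI := by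
  obtain ⟨C, hC⟩ := (isCompact_Icc (a := -√(agmon u)) (b := √(agmon u))).exists_bound_of_continuousOn
    hf.continuousOn
  refine MemLp.of_bound (hf.comp_aestronglyMeasurable (Lp.aestronglyMeasurable _)) C ?_
  filter_upwards [ae_abs_le_agmon u] with x hx
  exact hC _ (abs_le.1 hx)

theorem coeFn_nem {f : ℝ → ℝ} (hf : Continuous f) (u : H01) :
    nem f u.toL2 =ᵐ[μI] fun x => f (u.toL2 x) := coeFn_nem_of_memLp (memLp_comp_H01 hf u)

theorem coeFn_nem_of_lipschitz {f : ℝ → ℝ} {K : NNReal} (hf : LipschitzWith K f) (h0 : f 0 = 0)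
    (u : L2) : nem f u =ᵐ[μI] fun x => f (u x) :=
  coeFn_nem_of_memLp (hf.comp_memLp h0 (Lp.memLp u))

theorem nem_zero {f : ℝ → ℝ} (hf : Continuous f) (h0 : f 0 = 0) : nem f 0 = 0 := by
  refine Lp.ext ?_
  filter_upwards [coeFn_nem hf 0, Lp.coeFn_zero ℝ 2 μI] with x hx hx0
  rw [H01.toL2_zero] at hx
  rw [hx, hx0]
  exact h0

theorem lipschitzWith_nem {f : ℝ → ℝ} {K : NNReal} (hf : LipschitzWith K f) (h0 : f 0 = 0) :
    LipschitzWith K (nem f) := by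
  refine LipschitzWith.of_dist_le_mul fun u v => ?_
  rw [dist_eq_norm, dist_eq_norm]
  refine norm_le_of_ae_le ?_
  filter_upwards [coeFn_nem_of_lipschitz hf h0 u, coeFn_nem_of_lipschitz hf h0 v,
    Lp.coeFn_sub u v, Lp.coeFn_sub (nem f u) (nem f v)] with x h1 h2 h3 h4
  rw [h3, h4, Pi.sub_apply, Pi.sub_apply, h1, h2]
  exact hf.dist_le_mul _ _

section Estimates

variable {g c : ℝ → ℝ}

theorem abs_le_one_add_of_sq_le {a m : ℝ} (h : a ^ 2 ≤ m) : |a| ≤ 1 + m := by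
  nlinarith [sq_abs a, sq_nonneg (|a| - 1), abs_nonneg a]

theorem Admissible.norm_nem_g_sub_le (h : Admissible g c) (u v : H01) :
    ‖nem g u.toL2 - nem g v.toL2‖ ≤ 2 * (1 + agmon u + agmon v) * ‖u.toL2 - v.toL2‖ := by
  refine norm_le_of_ae_le ?_
  filter_upwards [coeFn_nem h.cont_g u, coeFn_nem h.cont_g v, Lp.coeFn_sub u.toL2 v.toL2,
    Lp.coeFn_sub (nem g u.toL2) (nem g v.toL2), ae_sq_le_agmon u, ae_sq_le_agmon v]
    with x h1 h2 h3 h4 h5 h6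
  rw [h3, h4, Pi.sub_apply, Pi.sub_apply, h1, h2]
  refine (h.g_sub _ _).trans ?_
  gcongr ?_ * |_|
  linarith [abs_le_one_add_of_sq_le h5, abs_le_one_add_of_sq_le h6, agmon_nonneg u,
    agmon_nonneg v]

/-- In this variant only the perturbation `ψ` is measured in the maximum norm. -/
theorem Admissible.norm_nem_g_add_sub_le (h : Admissible g c) (v ψ : H01) :
    ‖nem g (v + ψ).toL2 - nem g v.toL2‖ ≤ (1 + agmon ψ) * (2 * ‖v.toL2‖ + ‖ψ.toL2‖) := by
  have hb : ‖nem g (v + ψ).toL2 - nem g v.toL2‖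
      ≤ (1 + agmon ψ) * ‖(2 : ℝ) • |v.toL2| + |ψ.toL2|‖ := by
    refine norm_le_of_ae_le ?_
    filter_upwards [coeFn_nem h.cont_g (v + ψ), coeFn_nem h.cont_g v, Lp.coeFn_add v.toL2 ψ.toL2,
      Lp.coeFn_sub (nem g (v + ψ).toL2) (nem g v.toL2), ae_sq_le_agmon ψ,
      Lp.coeFn_add ((2 : ℝ) • |v.toL2|) |ψ.toL2|, Lp.coeFn_smul (2 : ℝ) |v.toL2|,
      Lp.coeFn_abs v.toL2, Lp.coeFn_abs ψ.toL2] with x h1 h2 h3 h4 h5 h6 h7 h8 h9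
    rw [h4, Pi.sub_apply, h1, h2, h6, Pi.add_apply, h7, Pi.smul_apply, h8, h9, H01.toL2_add, h3,
      Pi.add_apply, smul_eq_mul]
    refine (h.g_sub _ _).trans ?_
    rw [add_sub_cancel_left, mul_comm]
    rw [abs_of_nonneg (a := 2 * |v.toL2 x| + |ψ.toL2 x|) (by positivity)]
    have := abs_add_le (v.toL2 x) (ψ.toL2 x)
    have h10 := abs_le_one_add_of_sq_le h5
    have h11 := agmon_nonneg ψ
    gcongr ?_ * ?_
    linarith
  refine hb.trans ?_
  have := agmon_nonneg ψ
  gcongr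
  refine (norm_add_le _ _).trans ?_
  rw [norm_smul, norm_abs_eq_norm, norm_abs_eq_norm]
  simp

theorem Admissible.norm_nem_c_sub_le (h : Admissible g c) (u v : H01) :
    ‖nem c u.toL2 - nem c v.toL2‖ ≤ 4 * (1 + agmon u + agmon v) * ‖u.toL2 - v.toL2‖ := by
  refine norm_le_of_ae_le ?_
  filter_upwards [coeFn_nem h.cont_c u, coeFn_nem h.cont_c v, Lp.coeFn_sub u.toL2 v.toL2,
    Lp.coeFn_sub (nem c u.toL2) (nem c v.toL2), ae_sq_le_agmon u, ae_sq_le_agmon v]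
    with x h1 h2 h3 h4 h5 h6
  rw [h3, h4, Pi.sub_apply, Pi.sub_apply, h1, h2]
  refine (h.c_sub _ _).trans ?_
  gcongr

theorem Admissible.inner_nem_c_sub_le (h : Admissible g c) (u v : H01) :
    inner ℝ (nem c u.toL2 - nem c v.toL2) (u.toL2 - v.toL2) ≤ 4 * ‖u.toL2 - v.toL2‖ ^ 2 := by
  have e : 4 * ‖u.toL2 - v.toL2‖ ^ 2
      = inner ℝ ((4 : ℝ) • (u.toL2 - v.toL2)) (u.toL2 - v.toL2) := by
    rw [real_inner_smul_left, real_inner_self_eq_norm_sq]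
  rw [e, L2.inner_eq, L2.inner_eq]
  refine integral_mono_ae (L2.integrable_mul _ _) (L2.integrable_mul _ _) ?_
  filter_upwards [coeFn_nem h.cont_c u, coeFn_nem h.cont_c v, Lp.coeFn_sub u.toL2 v.toL2,
    Lp.coeFn_sub (nem c u.toL2) (nem c v.toL2), Lp.coeFn_smul (4 : ℝ) (u.toL2 - v.toL2)]
    with x h1 h2 h3 h4 h5
  rw [h4, h5, Pi.smul_apply, h3, Pi.sub_apply, Pi.sub_apply, h1, h2, smul_eq_mul]
  refine (h.c_mono _ _).trans_eq ?_
  ring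

theorem Close.norm_nem_g_sub_le {δ : ℝ} {g₁ c₁ g₂ c₂ : ℝ → ℝ} (h : Close δ g₁ c₁ g₂ c₂)
    (h₁ : Continuous g₁) (h₂ : Continuous g₂) (u : H01) :
    ‖nem g₁ u.toL2 - nem g₂ u.toL2‖ ≤ δ * (1 + agmon u) * ‖u.toL2‖ := by
  refine norm_le_of_ae_le ?_
  filter_upwards [coeFn_nem h₁ u, coeFn_nem h₂ u,
    Lp.coeFn_sub (nem g₁ u.toL2) (nem g₂ u.toL2), ae_sq_le_agmon u] with x e1 e2 e3 e4
  rw [e3, Pi.sub_apply, e1, e2]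
  refine (h.g _).trans ?_
  have := h.nonneg
  gcongr

theorem Close.norm_nem_c_sub_le {δ : ℝ} {g₁ c₁ g₂ c₂ : ℝ → ℝ} (h : Close δ g₁ c₁ g₂ c₂)
    (h₁ : Continuous c₁) (h₂ : Continuous c₂) (u : H01) :
    ‖nem c₁ u.toL2 - nem c₂ u.toL2‖ ≤ δ * (1 + agmon u) ^ 2 * ‖u.toL2‖ := by
  refine norm_le_of_ae_le ?_
  filter_upwards [coeFn_nem h₁ u, coeFn_nem h₂ u,
    Lp.coeFn_sub (nem c₁ u.toL2) (nem c₂ u.toL2), ae_sq_le_agmon u] with x e1 e2 e3 e4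
  rw [e3, Pi.sub_apply, e1, e2]
  refine (h.c _).trans ?_
  have := h.nonneg
  gcongr

/-- `∫ g(v) ∂ₓv = 0`, as `g(v) ∂ₓv` is the derivative of `G(v)` for a primitive `G` of `g`. The
passage from test functions to `H₀¹` uses a truncation at the maximum of `|v|`, which does not
change `g(v)` and makes both sides continuous on `L² × L²`. -/
theorem Admissible.inner_nem_g_dx (h : Admissible g c) (v : H01) :
    inner ℝ (nem g v.toL2) v.dx = 0 := by
  set R := √(agmon v)
  have hR : 0 ≤ R := Real.sqrt_nonneg _
  have hL : LipschitzWith (2 * R).toNNReal (fun a => g (clamp R a)) :=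
    LipschitzWith.of_dist_le_mul fun a b => by
      rw [Real.coe_toNNReal _ (by positivity), Real.dist_eq, Real.dist_eq]
      exact h.truncate_g_sub_le hR a b
  have hA := h.truncate hR
  have e : nem g v.toL2 = nem (fun a => g (clamp R a)) v.toL2 := by
    refine Lp.ext ?_
    filter_upwards [coeFn_nem h.cont_g v, coeFn_nem hA.cont_g v, ae_abs_le_agmon v]
      with x h1 h2 h3
    rw [h1, h2, clamp_of_abs_le h3]
  rw [e]
  refine H01.induction (P := fun p => inner ℝ (nem (fun a => g (clamp R a)) p.1) p.2 = 0) ?_ ?_ v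
  · exact isClosed_eq
      (((lipschitzWith_nem hL hA.g_zero).continuous.comp continuous_fst).inner continuous_snd)
      continuous_const
  · rintro p ⟨φ, h1, h2, h3, h4, h5⟩
    rw [L2.inner_eq]
    have e1 : ∫ x in Ioo (0 : ℝ) 1, nem (fun a => g (clamp R a)) p.1 x * p.2 x
        = ∫ x in (0 : ℝ)..1, g (clamp R (φ x)) * deriv φ x := by
      rw [intervalIntegral.integral_of_le zero_le_one, integral_Ioc_eq_integral_Ioo]
      refine integral_congr_ae ?_
      filter_upwards [coeFn_nem_of_lipschitz hL hA.g_zero p.1, h4, h5] with x k1 k2 k3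
      rw [k1, k2, k3]
    rw [e1, intervalIntegral.integral_eq_sub_of_hasDerivAt
      (f := fun x => ∫ y in (0 : ℝ)..φ x, g (clamp R y))]
    · rw [test_eq_zero h3 (x := 0) (by simp), test_eq_zero h3 (x := 1) (by simp)]
      simp
    · intro x _
      exact (hA.cont_g.integral_hasStrictDerivAt 0 (φ x)).hasDerivAt.comp x
        (h1.differentiable (by simp) x).hasDerivAt
    · exact ((hA.cont_g.comp h1.continuous).mul
        (h1.continuous_deriv (by simp))).intervalIntegrable _ _

end Estimates

/-- `(B(u), φ) = -½ (u², ∂ₓφ)`. Since `∫ v² ∂ₓv = 0` for every `v` in `H₀¹`, this follows by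
polarization, with `v = u ± φ`. -/
theorem pairB_eq (u φ : H01) :
    pairB u φ = -(1 / 2) * inner ℝ (nem (fun a => a ^ 2) u.toL2) φ.dx := by
  have hA := admissible_burgersHuxley (γ := 1 / 2) (by norm_num)
  have hp := hA.inner_nem_g_dx (u + φ)
  have hm := hA.inner_nem_g_dx (u - φ)
  have hφ := hA.inner_nem_g_dx φ
  set sq : ℝ → ℝ := fun a => a ^ 2 with hsq
  have e1 : nem sq (u + φ).toL2 + nem sq (u - φ).toL2
      = (2 : ℝ) • (nem sq u.toL2 + nem sq φ.toL2) := by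
    refine Lp.ext ?_
    filter_upwards [Lp.coeFn_add (nem sq (u + φ).toL2) (nem sq (u - φ).toL2),
      Lp.coeFn_smul (2 : ℝ) (nem sq u.toL2 + nem sq φ.toL2),
      Lp.coeFn_add (nem sq u.toL2) (nem sq φ.toL2), coeFn_nem hA.cont_g (u + φ),
      coeFn_nem hA.cont_g (u - φ), coeFn_nem hA.cont_g u, coeFn_nem hA.cont_g φ,
      Lp.coeFn_add u.toL2 φ.toL2, Lp.coeFn_sub u.toL2 φ.toL2] with x h1 h2 h3 h4 h5 h6 h7 h8 h9
    rw [h1, h2, Pi.add_apply, Pi.smul_apply, h3, Pi.add_apply, h4, h5, h6, h7, H01.toL2_add,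
      H01.toL2_sub, h8, h9, Pi.add_apply, Pi.sub_apply, smul_eq_mul]
    ring
  have e2 : inner ℝ (nem sq (u + φ).toL2 - nem sq (u - φ).toL2) u.dx = 4 * pairB u φ := by
    unfold pairB
    rw [L2.inner_eq, ← integral_const_mul]
    refine integral_congr_ae ?_
    filter_upwards [Lp.coeFn_sub (nem sq (u + φ).toL2) (nem sq (u - φ).toL2),
      coeFn_nem hA.cont_g (u + φ), coeFn_nem hA.cont_g (u - φ),
      Lp.coeFn_add u.toL2 φ.toL2, Lp.coeFn_sub u.toL2 φ.toL2] with x h1 h4 h5 h8 h9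
    rw [h1, Pi.sub_apply, h4, h5, H01.toL2_add, H01.toL2_sub, h8, h9, Pi.add_apply, Pi.sub_apply]
    ring
  have e3 : inner ℝ (nem sq (u + φ).toL2 + nem sq (u - φ).toL2) φ.dx
      = 2 * inner ℝ (nem sq u.toL2) φ.dx := by
    rw [e1, inner_smul_left, inner_add_left, hφ]
    simp
  rw [H01.dx_add, inner_add_right] at hp
  rw [H01.dx_sub, inner_sub_right] at hm
  rw [inner_sub_left] at e2
  rw [inner_add_left] at e3
  linarith

/-! ### The nonlinear functional -/

/-- The functional `φ ↦ -α (B(u), φ) + β (c(u), φ)` on `H₀¹`, with the first term integrated by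
parts and the function `a²` replaced by `g`. -/
def nlin (α β : ℝ) (g c : ℝ → ℝ) (u : H01) : H01 →L[ℝ] ℝ :=
  (α / 2) • (innerSL ℝ (nem g u.toL2)).comp dxL + β • (innerSL ℝ (nem c u.toL2)).comp toL2L

theorem nlin_apply (α β : ℝ) (g c : ℝ → ℝ) (u φ : H01) :
    nlin α β g c u φ
      = α / 2 * inner ℝ (nem g u.toL2) φ.dx + β * inner ℝ (nem c u.toL2) φ.toL2 := rfl

/-- The functional `φ ↦ (∂ₓu, ∂ₓφ)` on `H₀¹`. -/
def pairAL (u : H01) : H01 →L[ℝ] ℝ := (innerSL ℝ u.dx).comp dxL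

theorem pairAL_apply (u φ : H01) : pairAL u φ = pairA u φ := rfl

theorem pairA_self (u : H01) : pairA u u = ‖u.dx‖ ^ 2 := real_inner_self_eq_norm_sq _

theorem norm_pairAL_le (u : H01) : ‖pairAL u‖ ≤ ‖u‖ := by
  refine ContinuousLinearMap.opNorm_le_bound _ (norm_nonneg _) fun φ => ?_
  refine (norm_inner_le_norm (𝕜 := ℝ) u.dx φ.dx).trans ?_
  have h1 := u.norm_dx_le
  have h2 := φ.norm_dx_le
  gcongr

theorem continuous_pairAL_apply (φ : H01) : Continuous fun u => pairAL u φ := by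
  simp_rw [pairAL_apply]
  exact Continuous.inner (𝕜 := ℝ) (E := L2) (f := fun u : H01 => u.dx) (g := fun _ => φ.dx)
    dxL.continuous continuous_const

theorem continuous_agmon : Continuous agmon :=
  (continuous_const.mul toL2L.continuous.norm).mul dxL.continuous.norm

theorem agmon_zero : agmon 0 = 0 := by simp [agmon]

theorem nlin_burgersHuxley (α β γ : ℝ) (u φ : H01) :
    nlin α β (fun a => a ^ 2) (fun a => a * (1 - a) * (a - γ)) u φ
      = -α * pairB u φ + β * pairC γ u φ := by
  have e : inner ℝ (nem (fun a => a * (1 - a) * (a - γ)) u.toL2) φ.toL2 = pairC γ u φ := by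
    rw [L2.inner_eq]
    refine integral_congr_ae ?_
    filter_upwards [coeFn_nem (f := fun a => a * (1 - a) * (a - γ)) (by fun_prop) u] with x hx
    rw [hx]
  rw [nlin_apply, pairB_eq, e]
  ring

section Estimates

variable {α β : ℝ} {g c : ℝ → ℝ}

theorem Admissible.norm_nlin_sub_le (h : Admissible g c) (hα : 0 < α) (hβ : 0 < β) (u v : H01) :
    ‖nlin α β g c u - nlin α β g c v‖
      ≤ (α + 4 * β) * (1 + agmon u + agmon v) * ‖u.toL2 - v.toL2‖ := by
  have hu := agmon_nonneg u
  have hv := agmon_nonneg v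
  refine ContinuousLinearMap.opNorm_le_bound _ (by positivity) fun φ => ?_
  rw [sub_apply, nlin_apply, nlin_apply]
  have e : α / 2 * inner ℝ (nem g u.toL2) φ.dx + β * inner ℝ (nem c u.toL2) φ.toL2
      - (α / 2 * inner ℝ (nem g v.toL2) φ.dx + β * inner ℝ (nem c v.toL2) φ.toL2)
      = α / 2 * inner ℝ (nem g u.toL2 - nem g v.toL2) φ.dx
        + β * inner ℝ (nem c u.toL2 - nem c v.toL2) φ.toL2 := by
    rw [inner_sub_left, inner_sub_left]; ring
  rw [e]
  refine (norm_add_le _ _).trans ?_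
  rw [norm_mul, norm_mul, Real.norm_of_nonneg (by positivity : 0 ≤ α / 2), Real.norm_of_nonneg hβ.le]
  calc _ ≤ α / 2 * (‖nem g u.toL2 - nem g v.toL2‖ * ‖φ.dx‖)
        + β * (‖nem c u.toL2 - nem c v.toL2‖ * ‖φ.toL2‖) := by
        gcongr <;> exact norm_inner_le_norm _ _
    _ ≤ α / 2 * ((2 * (1 + agmon u + agmon v) * ‖u.toL2 - v.toL2‖) * ‖φ‖)
        + β * ((4 * (1 + agmon u + agmon v) * ‖u.toL2 - v.toL2‖) * ‖φ‖) := by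
        gcongr
        · exact h.norm_nem_g_sub_le u v
        · exact φ.norm_dx_le
        · exact h.norm_nem_c_sub_le u v
        · exact φ.norm_toL2_le
    _ = _ := by ring

theorem Admissible.nlin_zero (h : Admissible g c) : nlin α β g c 0 = 0 := by
  ext φ
  rw [nlin_apply, H01.toL2_zero, nem_zero h.cont_g h.g_zero, nem_zero h.cont_c h.c_zero]
  simp

theorem Admissible.norm_nlin_le (h : Admissible g c) (hα : 0 < α) (hβ : 0 < β) (u : H01) :
    ‖nlin α β g c u‖ ≤ (α + 4 * β) * (1 + agmon u) * ‖u.toL2‖ := by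
  have := h.norm_nlin_sub_le hα hβ u 0
  have e : nlin α β g c u - nlin α β g c 0 = nlin α β g c u := by
    rw [h.nlin_zero]; ext φ; simp
  rw [e] at this
  simpa [agmon_zero] using this

theorem Admissible.continuous_nlin_apply (h : Admissible g c) (hα : 0 < α) (hβ : 0 < β)
    (φ : H01) : Continuous fun u => nlin α β g c u φ := by
  refine continuous_iff_continuousAt.2 fun v => ?_
  refine tendsto_iff_norm_sub_tendsto_zero.2 ?_
  have hlim : Tendsto (fun u : H01 =>
      (α + 4 * β) * (1 + agmon u + agmon v) * ‖u.toL2 - v.toL2‖ * ‖φ‖) (𝓝 v) (𝓝 0) := by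
    have hc : Continuous fun u : H01 =>
        (α + 4 * β) * (1 + agmon u + agmon v) * ‖u.toL2 - v.toL2‖ * ‖φ‖ :=
      ((continuous_const.mul ((continuous_const.add continuous_agmon).add continuous_const)).mul
        (toL2L.continuous.sub continuous_const).norm).mul continuous_const
    have := hc.tendsto v
    simpa using this
  refine squeeze_zero (fun u => norm_nonneg _) (fun u => ?_) hlim
  have e : nlin α β g c u φ - nlin α β g c v φ = (nlin α β g c u - nlin α β g c v) φ := rfl
  rw [e]
  refine (ContinuousLinearMap.le_opNorm _ _).trans ?_
  gcongr
  exact h.norm_nlin_sub_le hα hβ u v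

theorem Close.norm_nlin_sub_le {δ : ℝ} {g' c' : ℝ → ℝ} (hcl : Close δ g c g' c')
    (h : Admissible g c) (h' : Admissible g' c') (hα : 0 < α) (hβ : 0 < β) (u : H01) :
    ‖nlin α β g c u - nlin α β g' c' u‖ ≤ (α + β) * δ * (1 + agmon u) ^ 2 * ‖u.toL2‖ := by
  have hu := agmon_nonneg u
  have hδ := hcl.nonneg
  refine ContinuousLinearMap.opNorm_le_bound _ (by positivity) fun φ => ?_
  rw [sub_apply, nlin_apply, nlin_apply]
  have e : α / 2 * inner ℝ (nem g u.toL2) φ.dx + β * inner ℝ (nem c u.toL2) φ.toL2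
      - (α / 2 * inner ℝ (nem g' u.toL2) φ.dx + β * inner ℝ (nem c' u.toL2) φ.toL2)
      = α / 2 * inner ℝ (nem g u.toL2 - nem g' u.toL2) φ.dx
        + β * inner ℝ (nem c u.toL2 - nem c' u.toL2) φ.toL2 := by
    rw [inner_sub_left, inner_sub_left]; ring
  rw [e]
  refine (norm_add_le _ _).trans ?_
  rw [norm_mul, norm_mul, Real.norm_of_nonneg (by positivity : 0 ≤ α / 2), Real.norm_of_nonneg hβ.le]
  have hsq : δ * (1 + agmon u) * ‖u.toL2‖ ≤ δ * (1 + agmon u) ^ 2 * ‖u.toL2‖ := by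
    gcongr
    nlinarith
  calc _ ≤ α / 2 * (‖nem g u.toL2 - nem g' u.toL2‖ * ‖φ.dx‖)
        + β * (‖nem c u.toL2 - nem c' u.toL2‖ * ‖φ.toL2‖) := by
        gcongr <;> exact norm_inner_le_norm _ _
    _ ≤ α / 2 * ((δ * (1 + agmon u) ^ 2 * ‖u.toL2‖) * ‖φ‖)
        + β * ((δ * (1 + agmon u) ^ 2 * ‖u.toL2‖) * ‖φ‖) := by
        gcongr
        · exact (hcl.norm_nem_g_sub_le h.cont_g h'.cont_g u).trans hsq
        · exact φ.norm_dx_le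
        · exact hcl.norm_nem_c_sub_le h.cont_c h'.cont_c u
        · exact φ.norm_toL2_le
    _ ≤ _ := by
        have : 0 ≤ α / 2 * ((δ * (1 + agmon u) ^ 2 * ‖u.toL2‖) * ‖φ‖) := by positivity
        linarith

/-- The constant in the energy estimates, as it comes out of Young's inequality; its value plays no
role. -/
def energyConst (ν α β : ℝ) : ℝ := 4 * α ^ 2 / ν + 13 * β

theorem energyConst_nonneg {ν α β : ℝ} (hν : 0 < ν) (hβ : 0 < β) : 0 ≤ energyConst ν α β := by
  unfold energyConst; positivity

/-- Young's inequality, in the form in which it is applied in the energy estimates. -/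
theorem energy_young {ν P w z y d X Y : ℝ} (hν : 0 < ν) (hα : 0 < α) (hβ : 0 < β) (hP : 1 ≤ P)
    (hw : 0 ≤ w) (hX : X ≤ P * (2 * w + 2 * z + y) * d)
    (hz : 0 ≤ z) (hY : Y ≤ 4 * w ^ 2 + 4 * P * z * w + P ^ 2 * y * w) :
    2 * (-ν * d ^ 2 + (α / 2 * X + β * Y))
      ≤ -ν * d ^ 2 + energyConst ν α β * P ^ 2 * (w ^ 2 + z ^ 2 + y ^ 2) := by
  have y1 : α * (P * (2 * w + 2 * z + y) * d)
      ≤ ν * d ^ 2 + α ^ 2 / (4 * ν) * P ^ 2 * (2 * w + 2 * z + y) ^ 2 := by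
    have : 0 ≤ (2 * ν * d - α * P * (2 * w + 2 * z + y)) ^ 2 / (4 * ν) := by positivity
    have e : (2 * ν * d - α * P * (2 * w + 2 * z + y)) ^ 2 / (4 * ν)
        = ν * d ^ 2 + α ^ 2 / (4 * ν) * P ^ 2 * (2 * w + 2 * z + y) ^ 2
          - α * (P * (2 * w + 2 * z + y) * d) := by field_simp; ring
    linarith
  have y2 : (2 * w + 2 * z + y) ^ 2 ≤ 16 * (w ^ 2 + z ^ 2 + y ^ 2) := by
    nlinarith [sq_nonneg (w - z), sq_nonneg (w - y), sq_nonneg (z - y), sq_nonneg w,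
      sq_nonneg z, sq_nonneg y]
  have y3 : α ^ 2 / (4 * ν) * P ^ 2 * (2 * w + 2 * z + y) ^ 2
      ≤ α ^ 2 / (4 * ν) * P ^ 2 * (16 * (w ^ 2 + z ^ 2 + y ^ 2)) := by gcongr
  have y4 : α ^ 2 / (4 * ν) * P ^ 2 * (16 * (w ^ 2 + z ^ 2 + y ^ 2))
      = 4 * α ^ 2 / ν * (P ^ 2 * (w ^ 2 + z ^ 2 + y ^ 2)) := by field_simp; ring
  have hX' : α * X ≤ α * (P * (2 * w + 2 * z + y) * d) := by gcongr
  have hPP : P ≤ P ^ 2 := by nlinarith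
  have hP1 : 1 ≤ P ^ 2 := by linarith
  have t1 : w ^ 2 ≤ P ^ 2 * w ^ 2 := by nlinarith [sq_nonneg w]
  have t2 : P * (z * w) ≤ P ^ 2 * (z * w) := by gcongr
  have t3 : P ^ 2 * (2 * z * w) ≤ P ^ 2 * (z ^ 2 + w ^ 2) := by
    gcongr; nlinarith [sq_nonneg (z - w)]
  have t4 : P ^ 2 * (2 * y * w) ≤ P ^ 2 * (y ^ 2 + w ^ 2) := by
    gcongr; nlinarith [sq_nonneg (y - w)]
  have t5 : 0 ≤ P ^ 2 * z ^ 2 := by positivity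
  have t6 : 0 ≤ P ^ 2 * y ^ 2 := by positivity
  have hY' : 2 * Y ≤ 13 * (P ^ 2 * (w ^ 2 + z ^ 2 + y ^ 2)) := by linarith
  have hY'' : β * (2 * Y) ≤ β * (13 * (P ^ 2 * (w ^ 2 + z ^ 2 + y ^ 2))) := by gcongr
  unfold energyConst
  linarith

/-- The estimate behind stability: `v₁ - v₂` is tested with itself. -/
theorem stability_estimate {ν δ : ℝ} (hν : 0 < ν) (hα : 0 < α) (hβ : 0 < β)
    {g₁ c₁ g₂ c₂ : ℝ → ℝ} (h₁ : Admissible g₁ c₁) (h₂ : Admissible g₂ c₂)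
    (hcl : Close δ g₁ c₁ g₂ c₂) (v₁ v₂ ψ₁ ψ₂ : H01) :
    2 * (-ν * pairA (v₁ - v₂) (v₁ - v₂)
        + (nlin α β g₁ c₁ (v₁ + ψ₁) (v₁ - v₂) - nlin α β g₂ c₂ (v₂ + ψ₂) (v₁ - v₂)))
      ≤ -ν * ‖(v₁ - v₂).dx‖ ^ 2 + energyConst ν α β
        * (1 + agmon (v₁ + ψ₁) + agmon (v₂ + ψ₂) + agmon (v₂ + ψ₁)) ^ 2
        * (‖(v₁ - v₂).toL2‖ ^ 2 + ‖(ψ₁ - ψ₂).toL2‖ ^ 2 + δ ^ 2 * ‖(v₂ + ψ₂).toL2‖ ^ 2) := by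
  have hδ := hcl.nonneg
  have m1 := agmon_nonneg (v₁ + ψ₁)
  have m2 := agmon_nonneg (v₂ + ψ₂)
  have m3 := agmon_nonneg (v₂ + ψ₁)
  have i1 := h₁.norm_nem_g_sub_le (v₁ + ψ₁) (v₂ + ψ₂)
  have i2 := hcl.norm_nem_g_sub_le h₁.cont_g h₂.cont_g (v₂ + ψ₂)
  have i3 := h₁.inner_nem_c_sub_le (v₁ + ψ₁) (v₂ + ψ₁)
  have i4 := h₁.norm_nem_c_sub_le (v₂ + ψ₁) (v₂ + ψ₂)
  have i5 := hcl.norm_nem_c_sub_le h₁.cont_c h₂.cont_c (v₂ + ψ₂)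
  have d1 : (v₁ + ψ₁).toL2 - (v₂ + ψ₂).toL2 = (v₁ - v₂).toL2 + (ψ₁ - ψ₂).toL2 := by
    simp only [H01.toL2_add, H01.toL2_sub]; abel
  have d3 : (v₁ + ψ₁).toL2 - (v₂ + ψ₁).toL2 = (v₁ - v₂).toL2 := by
    simp only [H01.toL2_add, H01.toL2_sub]; abel
  have d4 : (v₂ + ψ₁).toL2 - (v₂ + ψ₂).toL2 = (ψ₁ - ψ₂).toL2 := by
    simp only [H01.toL2_add, H01.toL2_sub]; abel
  rw [d1] at i1
  rw [d3] at i3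
  rw [d4] at i4
  rw [nlin_apply, nlin_apply, pairA_self]
  set U₁ := (v₁ + ψ₁).toL2
  set U₂ := (v₂ + ψ₂).toL2
  set U₃ := (v₂ + ψ₁).toL2
  set W := (v₁ - v₂).toL2
  set D := (v₁ - v₂).dx
  set Z := (ψ₁ - ψ₂).toL2
  set P := 1 + agmon (v₁ + ψ₁) + agmon (v₂ + ψ₂) + agmon (v₂ + ψ₁) with hP
  have j1 : inner ℝ (nem g₁ U₁ - nem g₁ U₂) D ≤ 2 * P * (‖W‖ + ‖Z‖) * ‖D‖ := by
    refine (real_inner_le_norm _ _).trans ?_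
    gcongr
    refine i1.trans ?_
    gcongr ?_ * ?_
    · linarith
    · exact norm_add_le _ _
  have j2 : inner ℝ (nem g₁ U₂ - nem g₂ U₂) D ≤ δ * P * ‖U₂‖ * ‖D‖ := by
    refine (real_inner_le_norm _ _).trans ?_
    gcongr
    refine i2.trans ?_
    gcongr
    linarith
  have j4 : inner ℝ (nem c₁ U₃ - nem c₁ U₂) W ≤ 4 * P * ‖Z‖ * ‖W‖ := by
    refine (real_inner_le_norm _ _).trans ?_
    gcongr
    refine i4.trans ?_
    gcongr
    linarith
  have j5 : inner ℝ (nem c₁ U₂ - nem c₂ U₂) W ≤ δ * P ^ 2 * ‖U₂‖ * ‖W‖ := by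
    refine (real_inner_le_norm _ _).trans ?_
    gcongr
    refine i5.trans ?_
    gcongr
    linarith
  have hP1 : 1 ≤ P := by linarith
  have k1 : inner ℝ (nem g₁ U₁) D - inner ℝ (nem g₂ U₂) D
      ≤ P * (2 * ‖W‖ + 2 * ‖Z‖ + δ * ‖U₂‖) * ‖D‖ := by
    rw [inner_sub_left] at j1 j2
    linarith
  have k2 : inner ℝ (nem c₁ U₁) W - inner ℝ (nem c₂ U₂) W
      ≤ 4 * ‖W‖ ^ 2 + 4 * P * ‖Z‖ * ‖W‖ + δ * P ^ 2 * ‖U₂‖ * ‖W‖ := by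
    rw [inner_sub_left] at j4 j5 i3
    linarith
  have hy := energy_young (y := δ * ‖U₂‖) hν hα hβ hP1 (norm_nonneg W) k1 (norm_nonneg Z)
    (k2.trans_eq (by ring))
  rw [mul_pow] at hy
  refine le_trans (le_of_eq ?_) hy
  ring

/-- The estimate behind the a priori bound: a solution `v` is tested with itself. -/
theorem apriori_estimate {ν : ℝ} (hν : 0 < ν) (hα : 0 < α) (hβ : 0 < β)
    (h : Admissible g c) (v ψ : H01) :
    2 * (-ν * pairA v v + nlin α β g c (v + ψ) v)
      ≤ -ν * ‖v.dx‖ ^ 2 + energyConst ν α β * (1 + agmon ψ) ^ 2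
        * (‖v.toL2‖ ^ 2 + ‖ψ.toL2‖ ^ 2) := by
  have m := agmon_nonneg ψ
  have i0 := h.inner_nem_g_dx v
  have i1 := h.norm_nem_g_add_sub_le v ψ
  have i3 := h.inner_nem_c_sub_le (v + ψ) ψ
  have i4 := h.norm_nem_c_sub_le ψ 0
  rw [H01.toL2_zero, nem_zero h.cont_c h.c_zero, sub_zero, sub_zero, agmon_zero, add_zero] at i4
  rw [H01.toL2_add, add_sub_cancel_right, ← H01.toL2_add] at i3
  rw [nlin_apply, pairA_self]
  have k1 : inner ℝ (nem g (v + ψ).toL2) v.dx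
      ≤ (1 + agmon ψ) * (2 * ‖v.toL2‖ + 2 * ‖ψ.toL2‖ + 0) * ‖v.dx‖ := by
    have j1 : inner ℝ (nem g (v + ψ).toL2 - nem g v.toL2) v.dx
        ≤ (1 + agmon ψ) * (2 * ‖v.toL2‖ + 2 * ‖ψ.toL2‖ + 0) * ‖v.dx‖ := by
      refine (real_inner_le_norm _ _).trans ?_
      gcongr
      refine i1.trans ?_
      have := norm_nonneg ψ.toL2
      gcongr ?_ * ?_
      linarith
    rwa [inner_sub_left, i0, sub_zero] at j1
  have k2 : inner ℝ (nem c (v + ψ).toL2) v.toL2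
      ≤ 4 * ‖v.toL2‖ ^ 2 + 4 * (1 + agmon ψ) * ‖ψ.toL2‖ * ‖v.toL2‖
        + (1 + agmon ψ) ^ 2 * 0 * ‖v.toL2‖ := by
    have j4 : inner ℝ (nem c ψ.toL2) v.toL2 ≤ 4 * (1 + agmon ψ) * ‖ψ.toL2‖ * ‖v.toL2‖ := by
      refine (real_inner_le_norm _ _).trans ?_
      gcongr
    rw [inner_sub_left] at i3
    linarith
  have hy := energy_young hν hα hβ (by linarith : 1 ≤ 1 + agmon ψ) (norm_nonneg v.toL2) k1
    (norm_nonneg ψ.toL2) k2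
  simpa using hy

end Estimates

/-! ### Absolutely continuous functions and Gronwall's inequality -/

theorem _root_.AbsolutelyContinuousOnInterval.lipschitzOnWith_comp {f h : ℝ → ℝ} {a b : ℝ}
    {S : Set ℝ} {K : NNReal} (hf : AbsolutelyContinuousOnInterval f a b)
    (hh : LipschitzOnWith K h S) (hS : ∀ x ∈ uIcc a b, f x ∈ S) :
    AbsolutelyContinuousOnInterval (fun x => h (f x)) a b := by
  rw [absolutelyContinuousOnInterval_iff] at hf ⊢
  intro ε hε
  obtain ⟨δ, hδ, H⟩ := hf (ε / (K + 1)) (by positivity)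
  refine ⟨δ, hδ, fun E hE hlt => ?_⟩
  have h1 := H E hE hlt
  calc _ ≤ ∑ i ∈ Finset.range E.1, K * dist (f (E.2 i).1) (f (E.2 i).2) :=
        Finset.sum_le_sum fun i hi => hh.dist_le_mul _ (hS _ (hE.1 i hi).1) _ (hS _ (hE.1 i hi).2)
    _ = K * ∑ i ∈ Finset.range E.1, dist (f (E.2 i).1) (f (E.2 i).2) := (Finset.mul_sum _ _ _).symm
    _ ≤ K * (ε / (K + 1)) := by gcongr
    _ < (K + 1) * (ε / (K + 1)) := by gcongr; linarith
    _ = ε := by field_simp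

/-- The chain rule for the square of an absolutely continuous function. -/
theorem sq_primitive_eq {f : ℝ → ℝ} {a t : ℝ} (hf : IntervalIntegrable f volume 0 t) :
    (a + ∫ s in (0 : ℝ)..t, f s) ^ 2
      = a ^ 2 + 2 * ∫ s in (0 : ℝ)..t, f s * (a + ∫ r in (0 : ℝ)..s, f r) := by
  have hac : AbsolutelyContinuousOnInterval (fun s => a + ∫ r in (0 : ℝ)..s, f r) 0 t :=
    ((LipschitzWith.const a).lipschitzOnWith.absolutelyContinuousOnInterval).fun_add
      (hf.absolutelyContinuousOnInterval_intervalIntegral (by simp))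
  have h := hac.integral_deriv_mul_eq_sub hac
  have e : ∫ s in (0 : ℝ)..t, (deriv (fun s => a + ∫ r in (0 : ℝ)..s, f r) s
        * (a + ∫ r in (0 : ℝ)..s, f r)
        + (a + ∫ r in (0 : ℝ)..s, f r) * deriv (fun s => a + ∫ r in (0 : ℝ)..s, f r) s)
      = ∫ s in (0 : ℝ)..t, 2 * (f s * (a + ∫ r in (0 : ℝ)..s, f r)) := by
    refine intervalIntegral.integral_congr_ae ?_
    filter_upwards [hf.ae_hasDerivAt_integral] with s hs hst
    have hd := (hs (uIoc_subset_uIcc hst) 0 (by simp)).const_add a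
    rw [hd.deriv]
    ring
  rw [e, intervalIntegral.integral_const_mul] at h
  simp only [intervalIntegral.integral_same, add_zero] at h
  linarith

/-- Gronwall's inequality in integral form, with an integrable coefficient. -/
theorem gronwall {z b : ℝ → ℝ} {A t : ℝ} (ht : 0 ≤ t) (hz : Continuous z)
    (hb : IntervalIntegrable b volume 0 t) (hb0 : ∀ᵐ s, s ∈ Ioc 0 t → 0 ≤ b s)
    (h : ∀ s ∈ Icc 0 t, z s ≤ A + ∫ r in (0 : ℝ)..s, b r * z r) :
    A + ∫ s in (0 : ℝ)..t, b s * z s ≤ A * Real.exp (∫ s in (0 : ℝ)..t, b s) := by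
  have hbz : IntervalIntegrable (fun s => b s * z s) volume 0 t := hb.mul_continuousOn hz.continuousOn
  have hac1 : AbsolutelyContinuousOnInterval (fun s => A + ∫ r in (0 : ℝ)..s, b r * z r) 0 t :=
    ((LipschitzWith.const A).lipschitzOnWith.absolutelyContinuousOnInterval).fun_add
      (hbz.absolutelyContinuousOnInterval_intervalIntegral (by simp))
  have hac2 : AbsolutelyContinuousOnInterval
      (fun s => Real.exp (-∫ r in (0 : ℝ)..s, b r)) 0 t := by
    have hB := hb.absolutelyContinuousOnInterval_intervalIntegral (c := 0) (by simp)
    obtain ⟨C, hC⟩ := hB.exists_bound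
    have hexp : ContDiffOn ℝ 1 (fun x => Real.exp (-x)) (Icc (-C) C) :=
      ContDiff.contDiffOn (by fun_prop)
    obtain ⟨K, hK⟩ := hexp.exists_lipschitzOnWith (by decide) (convex_Icc _ _) isCompact_Icc
    exact hB.lipschitzOnWith_comp (h := fun x => Real.exp (-x)) hK fun x hx => abs_le.1 (hC x hx)
  have hle : ∫ s in (0 : ℝ)..t, (deriv (fun s => A + ∫ r in (0 : ℝ)..s, b r * z r) s
        * Real.exp (-∫ r in (0 : ℝ)..s, b r)
        + (A + ∫ r in (0 : ℝ)..s, b r * z r)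
          * deriv (fun s => Real.exp (-∫ r in (0 : ℝ)..s, b r)) s) ≤ 0 := by
    rw [intervalIntegral.integral_of_le ht]
    refine integral_nonpos_of_ae ?_
    rw [EventuallyLE, ae_restrict_iff' measurableSet_Ioc]
    filter_upwards [hb.ae_hasDerivAt_integral, hbz.ae_hasDerivAt_integral, hb0] with s h1 h2 h3 hs
    have hs' : s ∈ uIcc 0 t := by rw [uIcc_of_le ht]; exact Ioc_subset_Icc_self hs
    have d1 := (h2 hs' 0 (by simp)).const_add A
    have d2 := (h1 hs' 0 (by simp)).neg.exp
    have e2 : deriv (fun s => Real.exp (-∫ r in (0 : ℝ)..s, b r)) s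
        = Real.exp (-∫ r in (0 : ℝ)..s, b r) * -b s := HasDerivAt.deriv d2
    rw [d1.deriv, e2]
    have h4 := h s (Ioc_subset_Icc_self hs)
    have h5 := mul_nonneg (mul_nonneg (h3 hs) (Real.exp_pos (-∫ r in (0 : ℝ)..s, b r)).le)
      (sub_nonneg.2 h4)
    simp only [Pi.zero_apply]
    linarith
  rw [hac1.integral_deriv_mul_eq_sub hac2] at hle
  simp only [intervalIntegral.integral_same, add_zero, neg_zero, Real.exp_zero, mul_one] at hle
  rw [Real.exp_neg, ← div_eq_mul_inv, sub_nonpos, div_le_iff₀ (Real.exp_pos _)] at hle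
  exact hle

/-! ### The solution space -/

section PathSpace

variable {T : ℝ}

local notation "μT" => (volume.restrict (Ioo (0 : ℝ) T))

theorem intervalIntegrable_of_integrable {E : Type*} [NormedAddCommGroup E] {f : ℝ → E}
    (hf : Integrable f μT) {t : ℝ} (ht : t ∈ Icc (0 : ℝ) T) :
    IntervalIntegrable f volume 0 t := by
  rw [intervalIntegrable_iff_integrableOn_Ioo_of_le ht.1]
  exact IntegrableOn.mono_set hf (Ioo_subset_Ioo_right ht.2)

theorem ae_Ioc_of_ae {p : ℝ → Prop} (h : ∀ᵐ s ∂μT, p s) {t : ℝ} (ht : t ∈ Icc (0 : ℝ) T) :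
    ∀ᵐ s, s ∈ Ioc 0 t → p s := by
  rw [← ae_restrict_iff' measurableSet_Ioc, ← restrict_Ioo_eq_restrict_Ioc]
  exact ae_restrict_of_ae_restrict_of_subset (Ioo_subset_Ioo_right ht.2) h

theorem integral_mono_interval {f : ℝ → ℝ} (hf : Integrable f μT) (h0 : ∀ᵐ s ∂μT, 0 ≤ f s)
    {t : ℝ} (ht : t ∈ Icc (0 : ℝ) T) :
    ∫ s in (0 : ℝ)..t, f s ≤ ∫ s in Ioo (0 : ℝ) T, f s := by
  rw [intervalIntegral.integral_of_le ht.1, integral_Ioc_eq_integral_Ioo]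
  exact setIntegral_mono_set hf h0 (Ioo_subset_Ioo_right ht.2).eventuallyLE

/-- The value `u(s)` in `L²(0,1)`, extended to all real times as a constant on either side. -/
def extValue (hT : 0 ≤ T) (u : pathSpace T) (s : ℝ) : L2 := value u (projIcc 0 T hT s)

theorem continuous_extValue (hT : 0 ≤ T) (u : pathSpace T) : Continuous (extValue hT u) :=
  u.1.1.continuous.comp continuous_projIcc

theorem extValue_of_mem (hT : 0 ≤ T) (u : pathSpace T) {s : ℝ} (hs : s ∈ Icc 0 T) :
    extValue hT u s = value u ⟨s, hs⟩ := by
  unfold extValue; rw [projIcc_of_mem hT hs]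

theorem ae_toL2_valueH01 (hT : 0 ≤ T) (u : pathSpace T) :
    ∀ᵐ s ∂μT, (valueH01 u s).toL2 = extValue hT u s := by
  have h : ∀ᵐ s ∂μT, ∀ hs : s ∈ Icc (0 : ℝ) T, u.1.1 ⟨s, hs⟩ = (u.1.2 s).toL2 := u.2
  filter_upwards [h, ae_restrict_mem measurableSet_Ioo] with s hs hs'
  rw [extValue_of_mem hT u (Ioo_subset_Icc_self hs')]
  exact (hs _).symm

theorem extValue_sub (hT : 0 ≤ T) (u v : pathSpace T) (s : ℝ) :
    extValue hT (u - v) s = extValue hT u s - extValue hT v s := rfl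

theorem ae_valueH01_sub (u v : pathSpace T) :
    ∀ᵐ s ∂μT, valueH01 (u - v) s = valueH01 u s - valueH01 v s := Lp.coeFn_sub u.1.2 v.1.2

theorem ae_valueH01_add (u v : pathSpace T) :
    ∀ᵐ s ∂μT, valueH01 (u + v) s = valueH01 u s + valueH01 v s := Lp.coeFn_add u.1.2 v.1.2

theorem memLp_valueH01 (u : pathSpace T) : MemLp (valueH01 u) 2 μT := Lp.memLp u.1.2

theorem pathSpace.norm_eq (u : pathSpace T) : ‖u‖ = max ‖u.1.1‖ ‖u.1.2‖ := rfl

theorem norm_extValue_le (hT : 0 ≤ T) (u : pathSpace T) (s : ℝ) : ‖extValue hT u s‖ ≤ ‖u‖ :=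
  (u.1.1.norm_coe_le_norm _).trans (le_max_left _ _)

theorem L2H01.norm_sq_eq (f : L2H01 T) : ‖f‖ ^ 2 = ∫ s in Ioo (0 : ℝ) T, ‖f s‖ ^ 2 := by
  have h0 : 0 ≤ ∫ s in Ioo (0 : ℝ) T, ‖f s‖ ^ 2 := integral_nonneg fun _ => by positivity
  have h1 : ∫ s in Ioo (0 : ℝ) T, ‖f s‖ ^ (2 : ℝ) = ∫ s in Ioo (0 : ℝ) T, ‖f s‖ ^ 2 :=
    integral_congr_ae (ae_of_all _ fun s => Real.rpow_two _)
  have h2 : ‖f‖ = (∫ s in Ioo (0 : ℝ) T, ‖f s‖ ^ 2) ^ ((2 : ℝ)⁻¹) := by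
    rw [Lp.norm_def, (Lp.memLp f).eLpNorm_eq_integral_rpow_norm (by norm_num) (by norm_num),
      ENNReal.toReal_ofReal (by positivity), ENNReal.toReal_ofNat, h1]
  rw [h2, ← Real.rpow_natCast, ← Real.rpow_mul h0]
  norm_num

theorem integrable_norm_sq_valueH01 (u : pathSpace T) :
    Integrable (fun s => ‖valueH01 u s‖ ^ 2) μT := (memLp_valueH01 u).norm.integrable_sq

theorem integral_norm_sq_valueH01_le (u : pathSpace T) :
    ∫ s in Ioo (0 : ℝ) T, ‖valueH01 u s‖ ^ 2 ≤ ‖u‖ ^ 2 := by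
  refine (L2H01.norm_sq_eq u.1.2).symm.trans_le ?_
  have : ‖u.1.2‖ ≤ ‖u‖ := le_max_right _ _
  gcongr

theorem integrable_norm_sq_dx (u : pathSpace T) :
    Integrable (fun s => ‖(valueH01 u s).dx‖ ^ 2) μT := by
  refine (integrable_norm_sq_valueH01 u).mono'
    ((dxL.continuous.norm.pow 2).comp_aestronglyMeasurable (memLp_valueH01 u).1)
    (ae_of_all _ fun s => ?_)
  rw [Real.norm_of_nonneg (by positivity)]
  have := (valueH01 u s).norm_dx_le
  gcongr

/-- The norm of the solution space is controlled by the energy. -/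
theorem norm_sq_le_of_energy_le {ν C : ℝ} (hT : 0 ≤ T) (hν : 0 < ν) (u : pathSpace T)
    (h : ∀ t ∈ Icc 0 T, ‖extValue hT u t‖ ^ 2
      + ν * ∫ s in (0 : ℝ)..t, ‖(valueH01 u s).dx‖ ^ 2 ≤ C) :
    ‖u‖ ^ 2 ≤ (1 + 4 / ν) * C := by
  have hpos : ∀ t ∈ Icc 0 T, 0 ≤ ∫ s in (0 : ℝ)..t, ‖(valueH01 u s).dx‖ ^ 2 := fun t ht =>
    intervalIntegral.integral_nonneg ht.1 fun s _ => by positivity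
  have hC : 0 ≤ C := le_trans (add_nonneg (by positivity) (mul_nonneg hν.le (hpos 0 ⟨le_rfl, hT⟩)))
    (h 0 ⟨le_rfl, hT⟩)
  have h1 : ‖u.1.1‖ ^ 2 ≤ C := by
    have : ‖u.1.1‖ ≤ √C := by
      rw [ContinuousMap.norm_le _ (Real.sqrt_nonneg _)]
      intro t
      refine Real.le_sqrt_of_sq_le ?_
      have h2 := h t t.2
      rw [extValue_of_mem hT u t.2] at h2
      have h3 := mul_nonneg hν.le (hpos t t.2)
      have h4 : value u ⟨t, t.2⟩ = u.1.1 t := rfl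
      rw [h4] at h2
      linarith
    calc ‖u.1.1‖ ^ 2 ≤ √C ^ 2 := by gcongr
      _ = C := Real.sq_sqrt hC
  have h2 : ‖u.1.2‖ ^ 2 ≤ 4 / ν * C := by
    rw [L2H01.norm_sq_eq]
    have h3 := h T ⟨hT, le_rfl⟩
    rw [intervalIntegral.integral_of_le hT, integral_Ioc_eq_integral_Ioo] at h3
    have h5 : ∫ s in Ioo (0 : ℝ) T, ‖u.1.2 s‖ ^ 2
        ≤ ∫ s in Ioo (0 : ℝ) T, 4 * ‖(valueH01 u s).dx‖ ^ 2 := by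
      refine integral_mono_ae (integrable_norm_sq_valueH01 u)
        ((integrable_norm_sq_dx u).const_mul 4) (ae_of_all _ fun s => ?_)
      have := H01.norm_le_dx (u.1.2 s)
      calc ‖u.1.2 s‖ ^ 2 ≤ (2 * ‖(u.1.2 s).dx‖) ^ 2 := by gcongr
        _ = 4 * ‖(valueH01 u s).dx‖ ^ 2 := by rw [mul_pow]; norm_num; rfl
    rw [integral_const_mul] at h5
    refine h5.trans ?_
    rw [div_mul_eq_mul_div, le_div_iff₀ hν]
    nlinarith [sq_nonneg ‖extValue hT u T‖]
  have h3 : 0 ≤ 4 / ν * C := by positivity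
  rw [pathSpace.norm_eq]
  rcases max_cases ‖u.1.1‖ ‖u.1.2‖ with h4 | h4 <;> rw [h4.1] <;> linarith

theorem isClosed_pathSpace : IsClosed (pathSpace T : Set (C(Icc (0 : ℝ) T, L2) × L2H01 T)) := by
  refine IsSeqClosed.isClosed fun p q hp hpq => ?_
  have h1 : Tendsto (fun n => (p n).1) atTop (𝓝 q.1) := (continuous_fst.tendsto q).comp hpq
  have h2 : Tendsto (fun n => (p n).2) atTop (𝓝 q.2) := (continuous_snd.tendsto q).comp hpq
  obtain ⟨ns, hns, hae⟩ := (tendstoInMeasure_of_tendsto_Lp h2).exists_seq_tendsto_ae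
  have hp' : ∀ᵐ s ∂μT, ∀ n, ∀ hs : s ∈ Icc (0 : ℝ) T, (p n).1 ⟨s, hs⟩ = ((p n).2 s).toL2 :=
    ae_all_iff.2 hp
  change ∀ᵐ s ∂μT, ∀ hs : s ∈ Icc (0 : ℝ) T, q.1 ⟨s, hs⟩ = (q.2 s).toL2
  filter_upwards [hae, hp'] with s hs hps hsT
  have h3 : Tendsto (fun n => (p (ns n)).1 ⟨s, hsT⟩) atTop (𝓝 (q.1 ⟨s, hsT⟩)) :=
    ((continuous_eval_const (F := C(Icc (0 : ℝ) T, L2)) (⟨s, hsT⟩ : Icc (0 : ℝ) T)).tendsto _).comp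
      (h1.comp hns.tendsto_atTop)
  have h4 : Tendsto (fun n => ((p (ns n)).2 s).toL2) atTop (𝓝 (q.2 s).toL2) :=
    (toL2L.continuous.tendsto _).comp hs
  exact tendsto_nhds_unique (h3.congr fun n => hps (ns n) hsT) h4

instance : CompleteSpace (pathSpace T) := isClosed_pathSpace.completeSpace_coe

/-- The Agmon constants are square integrable in time. -/
theorem ae_agmon_le (hT : 0 ≤ T) (u : pathSpace T) :
    ∀ᵐ s ∂μT, agmon (valueH01 u s) ≤ 2 * ‖u‖ * ‖valueH01 u s‖ := by
  filter_upwards [ae_toL2_valueH01 hT u] with s hs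
  unfold agmon
  rw [hs]
  have h1 := norm_extValue_le hT u s
  have h2 := (valueH01 u s).norm_dx_le
  gcongr

theorem memLp_agmon (hT : 0 ≤ T) (u : pathSpace T) :
    MemLp (fun s => agmon (valueH01 u s)) 2 μT := by
  refine ((memLp_valueH01 u).norm.const_mul (2 * ‖u‖)).of_le
    (continuous_agmon.comp_aestronglyMeasurable (memLp_valueH01 u).1) ?_
  filter_upwards [ae_agmon_le hT u] with s hs
  rw [Real.norm_of_nonneg (agmon_nonneg _)]
  exact hs.trans (le_abs_self _)

theorem integral_agmon_sq_le (hT : 0 ≤ T) (u : pathSpace T) :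
    ∫ s in Ioo (0 : ℝ) T, agmon (valueH01 u s) ^ 2 ≤ 4 * ‖u‖ ^ 4 := by
  calc _ ≤ ∫ s in Ioo (0 : ℝ) T, 4 * ‖u‖ ^ 2 * ‖valueH01 u s‖ ^ 2 := by
        refine integral_mono_ae (memLp_agmon hT u).integrable_sq
          ((integrable_norm_sq_valueH01 u).const_mul _) ?_
        filter_upwards [ae_agmon_le hT u] with s hs
        have := agmon_nonneg (valueH01 u s)
        calc _ ≤ (2 * ‖u‖ * ‖valueH01 u s‖) ^ 2 := by gcongr
          _ = _ := by ring
    _ = 4 * ‖u‖ ^ 2 * ∫ s in Ioo (0 : ℝ) T, ‖valueH01 u s‖ ^ 2 := integral_const_mul _ _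
    _ ≤ 4 * ‖u‖ ^ 2 * ‖u‖ ^ 2 := by
        gcongr
        exact integral_norm_sq_valueH01_le u
    _ = _ := by ring

end PathSpace

/-! ### Weak solutions and the energy identity -/

section Weak

variable {T : ℝ}

local notation "μT" => (volume.restrict (Ioo (0 : ℝ) T))

/-- A right-hand side in `L²(0,T; H⁻¹)`: weakly measurable in time, with norms bounded by a square
integrable function. -/
def IsForcing (T : ℝ) (ℓ : ℝ → H01 →L[ℝ] ℝ) : Prop :=
  (∀ φ, AEStronglyMeasurable (fun s => ℓ s φ) (volume.restrict (Ioo (0 : ℝ) T))) ∧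
    ∃ K : ℝ → ℝ, MemLp K 2 (volume.restrict (Ioo (0 : ℝ) T)) ∧
      ∀ᵐ s ∂(volume.restrict (Ioo (0 : ℝ) T)), 0 ≤ K s ∧ ∀ φ, |ℓ s φ| ≤ K s * ‖φ‖

/-- `v` solves `dv = ℓ dt`, `v(0) = v₀`, in the weak sense. -/
def Weak (hT : 0 ≤ T) (v₀ : L2) (ℓ : ℝ → H01 →L[ℝ] ℝ) (v : pathSpace T) : Prop :=
  ∀ t ∈ Icc 0 T, ∀ φ : H01, inner ℝ (extValue hT v t) φ.toL2
    = inner ℝ v₀ φ.toL2 + ∫ s in (0 : ℝ)..t, ℓ s φ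

theorem IsForcing.add {ℓ ℓ' : ℝ → H01 →L[ℝ] ℝ} (h : IsForcing T ℓ) (h' : IsForcing T ℓ') :
    IsForcing T (fun s => ℓ s + ℓ' s) := by
  obtain ⟨hm, K, hK, hb⟩ := h
  obtain ⟨hm', K', hK', hb'⟩ := h'
  refine ⟨fun φ => (hm φ).add (hm' φ), fun s => K s + K' s, hK.add hK', ?_⟩
  filter_upwards [hb, hb'] with s h1 h2
  refine ⟨add_nonneg h1.1 h2.1, fun φ => ?_⟩
  change |ℓ s φ + ℓ' s φ| ≤ _
  linarith [abs_add_le (ℓ s φ) (ℓ' s φ), h1.2 φ, h2.2 φ]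

theorem IsForcing.sub {ℓ ℓ' : ℝ → H01 →L[ℝ] ℝ} (h : IsForcing T ℓ) (h' : IsForcing T ℓ') :
    IsForcing T (fun s => ℓ s - ℓ' s) := by
  obtain ⟨hm, K, hK, hb⟩ := h
  obtain ⟨hm', K', hK', hb'⟩ := h'
  refine ⟨fun φ => (hm φ).sub (hm' φ), fun s => K s + K' s, hK.add hK', ?_⟩
  filter_upwards [hb, hb'] with s h1 h2
  refine ⟨add_nonneg h1.1 h2.1, fun φ => ?_⟩
  change |ℓ s φ - ℓ' s φ| ≤ _
  linarith [abs_sub (ℓ s φ) (ℓ' s φ), h1.2 φ, h2.2 φ]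

theorem IsForcing.const_smul {ℓ : ℝ → H01 →L[ℝ] ℝ} (h : IsForcing T ℓ) (a : ℝ) :
    IsForcing T (fun s => a • ℓ s) := by
  obtain ⟨hm, K, hK, hb⟩ := h
  refine ⟨fun φ => (hm φ).const_smul a, fun s => |a| * K s, hK.const_mul _, ?_⟩
  filter_upwards [hb] with s h1
  refine ⟨mul_nonneg (abs_nonneg a) h1.1, fun φ => ?_⟩
  change |a * ℓ s φ| ≤ _
  rw [abs_mul, mul_assoc]
  gcongr
  exact h1.2 φ

theorem IsForcing.integrable_apply {ℓ : ℝ → H01 →L[ℝ] ℝ} (h : IsForcing T ℓ) (φ : H01) :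
    Integrable (fun s => ℓ s φ) μT := by
  obtain ⟨hm, K, hK, hb⟩ := h
  refine ((hK.integrable (by norm_num)).mul_const ‖φ‖).mono' (hm φ) ?_
  filter_upwards [hb] with s hs
  exact hs.2 φ

theorem tendsto_integral_of_dominated {f : ℕ → ℝ → ℝ} {F B : ℝ → ℝ}
    (hm : ∀ n, AEStronglyMeasurable (f n) μT) (hB : Integrable B μT)
    (hb : ∀ n, ∀ᵐ s ∂μT, ‖f n s‖ ≤ B s)
    (hl : ∀ᵐ s ∂μT, Tendsto (fun n => f n s) atTop (𝓝 (F s))) {t : ℝ} (ht : t ∈ Icc (0 : ℝ) T) :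
    Tendsto (fun n => ∫ s in (0 : ℝ)..t, f n s) atTop (𝓝 (∫ s in (0 : ℝ)..t, F s)) := by
  have hsub : Ioo 0 t ⊆ Ioo 0 T := Ioo_subset_Ioo_right ht.2
  simp_rw [intervalIntegral.integral_of_le ht.1, integral_Ioc_eq_integral_Ioo]
  exact tendsto_integral_of_dominated_convergence B (fun n => (hm n).mono_set hsub)
    (IntegrableOn.mono_set hB hsub)
    (fun n => ae_restrict_of_ae_restrict_of_subset hsub (hb n))
    (ae_restrict_of_ae_restrict_of_subset hsub hl)

/-- The weak equation only has to be tested with the eigenfunctions. -/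
theorem weak_of_eig (hT : 0 ≤ T) {v₀ : L2} {ℓ : ℝ → H01 →L[ℝ] ℝ} {v : pathSpace T}
    (hℓ : IsForcing T ℓ)
    (h : ∀ t ∈ Icc 0 T, ∀ k, inner ℝ (extValue hT v t) (eig k).toL2
      = inner ℝ v₀ (eig k).toL2 + ∫ s in (0 : ℝ)..t, ℓ s (eig k)) : Weak hT v₀ ℓ v := by
  intro t ht φ
  have hn : ∀ n, inner ℝ (extValue hT v t) (proj n φ).toL2
      = inner ℝ v₀ (proj n φ).toL2 + ∫ s in (0 : ℝ)..t, ℓ s (proj n φ) := by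
    intro n
    have e : ∀ s, ℓ s (proj n φ)
        = ∑ k ∈ Finset.range n, inner ℝ (eig k).toL2 φ.toL2 * ℓ s (eig k) := by
      intro s; simp [proj]
    simp_rw [e]
    rw [intervalIntegral.integral_finsetSum fun k _ => intervalIntegrable_of_integrable
      ((hℓ.integrable_apply (eig k)).const_mul _) ht]
    simp_rw [intervalIntegral.integral_const_mul]
    rw [proj, H01.toL2_sum, inner_sum, inner_sum, ← Finset.sum_add_distrib]
    refine Finset.sum_congr rfl fun k _ => ?_
    rw [H01.toL2_smul, inner_smul_right, inner_smul_right, h t ht k]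
    ring
  have hp := tendsto_proj φ
  have hp2 : Tendsto (fun n => (proj n φ).toL2) atTop (𝓝 φ.toL2) := tendsto_proj_toL2 φ
  have l1 : Tendsto (fun n => inner ℝ (extValue hT v t) (proj n φ).toL2) atTop
      (𝓝 (inner ℝ (extValue hT v t) φ.toL2)) := tendsto_const_nhds.inner hp2
  have l2 : Tendsto (fun n => inner ℝ v₀ (proj n φ).toL2) atTop
      (𝓝 (inner ℝ v₀ φ.toL2)) := tendsto_const_nhds.inner hp2
  have l3 : Tendsto (fun n => ∫ s in (0 : ℝ)..t, ℓ s (proj n φ)) atTop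
      (𝓝 (∫ s in (0 : ℝ)..t, ℓ s φ)) := by
    obtain ⟨hm, K, hK, hb⟩ := hℓ
    refine tendsto_integral_of_dominated (fun n => hm _)
      ((hK.integrable (by norm_num)).mul_const (2 * ‖φ‖)) (fun n => ?_)
      (ae_of_all _ fun s => ((ℓ s).continuous.tendsto φ).comp hp) ht
    filter_upwards [hb] with s hs
    refine (hs.2 _).trans ?_
    have h0 := hs.1
    have := norm_proj_le n φ
    gcongr
  exact tendsto_nhds_unique l1 ((l2.add l3).congr fun n => (hn n).symm)

theorem tendsto_sum_inner_eig_sq (a : L2) :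
    Tendsto (fun n => ∑ k ∈ Finset.range n, inner ℝ a (eig k).toL2 ^ 2) atTop (𝓝 (‖a‖ ^ 2)) := by
  have h := (sineBasis.hasSum_inner_mul_inner a a).tendsto_sum_nat
  rw [real_inner_self_eq_norm_sq] at h
  refine h.congr fun n => Finset.sum_congr rfl fun k _ => ?_
  rw [coe_sineBasis, real_inner_comm a (eig k).toL2]
  ring

/-- The pairing of a right-hand side with an element of `L²(0,T; H₀¹)`. -/
theorem IsForcing.tendsto_integral_proj {ℓ : ℝ → H01 →L[ℝ] ℝ} (hℓ : IsForcing T ℓ)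
    (v : pathSpace T) :
    Integrable (fun s => ℓ s (valueH01 v s)) μT ∧
    (∀ k, Integrable (fun s => inner ℝ (eig k).toL2 (valueH01 v s).toL2 * ℓ s (eig k)) μT) ∧
    ∀ t ∈ Icc (0 : ℝ) T, Tendsto (fun n => ∑ k ∈ Finset.range n, ∫ s in (0 : ℝ)..t,
      inner ℝ (eig k).toL2 (valueH01 v s).toL2 * ℓ s (eig k)) atTop
      (𝓝 (∫ s in (0 : ℝ)..t, ℓ s (valueH01 v s))) := by
  have hmeas : ∀ k, AEStronglyMeasurable (fun s =>
      inner ℝ (eig k).toL2 (valueH01 v s).toL2 * ℓ s (eig k)) μT := fun k =>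
    (((continuous_const.inner toL2L.continuous :
      Continuous fun u : H01 => inner ℝ (eig k).toL2 u.toL2)).comp_aestronglyMeasurable
        (memLp_valueH01 v).1).mul (hℓ.1 (eig k))
  obtain ⟨hm, K, hK, hb⟩ := id hℓ
  have hKv : Integrable (fun s => K s * (2 * ‖valueH01 v s‖)) μT :=
    hK.integrable_mul ((memLp_valueH01 v).norm.const_mul 2)
  have hbound : ∀ n, ∀ᵐ s ∂μT, ‖ℓ s (proj n (valueH01 v s))‖ ≤ K s * (2 * ‖valueH01 v s‖) := by
    intro n
    filter_upwards [hb] with s hs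
    refine (hs.2 _).trans ?_
    have h0 := hs.1
    have := norm_proj_le n (valueH01 v s)
    gcongr
  have e : ∀ n s, ℓ s (proj n (valueH01 v s)) = ∑ k ∈ Finset.range n,
      inner ℝ (eig k).toL2 (valueH01 v s).toL2 * ℓ s (eig k) := by
    intro n s; simp [proj]
  have hmeasn : ∀ n, AEStronglyMeasurable (fun s => ℓ s (proj n (valueH01 v s))) μT := by
    intro n
    simp_rw [e]
    exact Finset.aestronglyMeasurable_fun_sum _ fun k _ => hmeas k
  have hlim : ∀ᵐ s ∂μT, Tendsto (fun n => ℓ s (proj n (valueH01 v s))) atTop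
      (𝓝 (ℓ s (valueH01 v s))) :=
    ae_of_all _ fun s => ((ℓ s).continuous.tendsto _).comp (tendsto_proj _)
  have hk : ∀ k, Integrable (fun s =>
      inner ℝ (eig k).toL2 (valueH01 v s).toL2 * ℓ s (eig k)) μT := by
    intro k
    refine (hK.integrable_mul ((memLp_valueH01 v).norm.const_mul ‖eig k‖)).mono' (hmeas k) ?_
    filter_upwards [hb] with s hs
    rw [norm_mul]
    have h1 : ‖inner ℝ (eig k).toL2 (valueH01 v s).toL2‖ ≤ 1 * ‖valueH01 v s‖ := by
      refine (norm_inner_le_norm (𝕜 := ℝ) _ _).trans ?_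
      rw [norm_eig]
      have := (valueH01 v s).norm_toL2_le
      gcongr
    calc _ ≤ 1 * ‖valueH01 v s‖ * (K s * ‖eig k‖) := by
          gcongr
          exact hs.2 _
      _ = _ := by simp only [Pi.mul_apply]; ring
  refine ⟨?_, hk, fun t ht => ?_⟩
  · refine (hKv).mono' (aestronglyMeasurable_of_tendsto_ae _ hmeasn hlim) ?_
    filter_upwards [ae_all_iff.2 hbound, hlim] with s h1 h2
    exact le_of_tendsto' h2.norm h1
  · refine (tendsto_integral_of_dominated hmeasn hKv hbound hlim ht).congr fun n => ?_
    simp_rw [e]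
    exact intervalIntegral.integral_finsetSum fun k _ => intervalIntegrable_of_integrable (hk k) ht

theorem IsForcing.integrable_self {ℓ : ℝ → H01 →L[ℝ] ℝ} (hℓ : IsForcing T ℓ) (v : pathSpace T) :
    Integrable (fun s => ℓ s (valueH01 v s)) μT := (hℓ.tendsto_integral_proj v).1

/-- The energy identity: the weak equation may be tested with the solution itself. It is the sum
of the identities for the coefficients with respect to the sine basis. -/
theorem Weak.energy (hT : 0 ≤ T) {v₀ : L2} {ℓ : ℝ → H01 →L[ℝ] ℝ} {v : pathSpace T}
    (hℓ : IsForcing T ℓ) (h : Weak hT v₀ ℓ v) {t : ℝ} (ht : t ∈ Icc (0 : ℝ) T) :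
    ‖extValue hT v t‖ ^ 2 = ‖v₀‖ ^ 2 + 2 * ∫ s in (0 : ℝ)..t, ℓ s (valueH01 v s) := by
  have hmode : ∀ k, inner ℝ (extValue hT v t) (eig k).toL2 ^ 2 = inner ℝ v₀ (eig k).toL2 ^ 2
      + 2 * ∫ s in (0 : ℝ)..t, inner ℝ (eig k).toL2 (valueH01 v s).toL2 * ℓ s (eig k) := by
    intro k
    have hint := intervalIntegrable_of_integrable (hℓ.integrable_apply (eig k)) ht
    rw [h t ht (eig k), sq_primitive_eq hint]
    congr 2
    refine intervalIntegral.integral_congr_ae ?_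
    rw [uIoc_of_le ht.1]
    filter_upwards [ae_Ioc_of_ae (ae_toL2_valueH01 hT v) ht] with s hs hs'
    rw [hs hs', ← h s ⟨hs'.1.le, hs'.2.trans ht.2⟩ (eig k), real_inner_comm]
    ring
  have l1 := tendsto_sum_inner_eig_sq (extValue hT v t)
  have l2 := (tendsto_sum_inner_eig_sq v₀).add
    (((hℓ.tendsto_integral_proj v).2.2 t ht).const_mul 2)
  refine tendsto_nhds_unique l1 (l2.congr fun n => ?_)
  rw [Finset.mul_sum, ← Finset.sum_add_distrib]
  exact Finset.sum_congr rfl fun k _ => (hmode k).symm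

theorem Weak.sub (hT : 0 ≤ T) {v₀ w₀ : L2} {ℓ ℓ' : ℝ → H01 →L[ℝ] ℝ} {v w : pathSpace T}
    (hℓ : IsForcing T ℓ) (hℓ' : IsForcing T ℓ') (h : Weak hT v₀ ℓ v) (h' : Weak hT w₀ ℓ' w) :
    Weak hT (v₀ - w₀) (fun s => ℓ s - ℓ' s) (v - w) := by
  intro t ht φ
  rw [extValue_sub, inner_sub_left, inner_sub_left, h t ht φ, h' t ht φ]
  have e : ∫ s in (0 : ℝ)..t, (ℓ s - ℓ' s) φ
      = (∫ s in (0 : ℝ)..t, ℓ s φ) - ∫ s in (0 : ℝ)..t, ℓ' s φ :=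
    intervalIntegral.integral_sub (intervalIntegrable_of_integrable (hℓ.integrable_apply φ) ht)
      (intervalIntegrable_of_integrable (hℓ'.integrable_apply φ) ht)
  rw [e]
  ring

/-- Energy estimate: a differential inequality for the energy gives a bound for the norm, by
Gronwall's inequality. -/
theorem Weak.norm_sq_le {ν k : ℝ} (hT : 0 ≤ T) (hν : 0 < ν) (hk : 0 ≤ k) {v₀ : L2}
    {ℓ : ℝ → H01 →L[ℝ] ℝ} {v : pathSpace T} (hℓ : IsForcing T ℓ) (h : Weak hT v₀ ℓ v)
    {b : ℝ → ℝ} (hb : Integrable b μT) (hb0 : ∀ᵐ s ∂μT, 0 ≤ b s)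
    (hle : ∀ᵐ s ∂μT, 2 * ℓ s (valueH01 v s) ≤ -ν * ‖(valueH01 v s).dx‖ ^ 2
      + b s * (‖extValue hT v s‖ ^ 2 + k)) :
    ‖v‖ ^ 2 ≤ (1 + 4 / ν) * ((‖v₀‖ ^ 2 + k) * Real.exp (∫ s in Ioo (0 : ℝ) T, b s)) := by
  refine norm_sq_le_of_energy_le hT hν v fun t ht => ?_
  set z : ℝ → ℝ := fun s => ‖extValue hT v s‖ ^ 2 + k with hz
  have hzc : Continuous z := ((continuous_extValue hT v).norm.pow 2).add continuous_const
  have hen : ∀ s ∈ Icc 0 T, z s + ν * ∫ r in (0 : ℝ)..s, ‖(valueH01 v r).dx‖ ^ 2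
      ≤ (‖v₀‖ ^ 2 + k) + ∫ r in (0 : ℝ)..s, b r * z r := by
    intro s hs
    have i1 := intervalIntegrable_of_integrable (hℓ.integrable_self v) hs
    have i2 := intervalIntegrable_of_integrable (integrable_norm_sq_dx v) hs
    have i3 := (intervalIntegrable_of_integrable hb hs).mul_continuousOn hzc.continuousOn
    have hm : ∫ r in (0 : ℝ)..s, 2 * ℓ r (valueH01 v r)
        ≤ ∫ r in (0 : ℝ)..s, (-ν * ‖(valueH01 v r).dx‖ ^ 2 + b r * z r) := by
      rw [intervalIntegral.integral_of_le hs.1, intervalIntegral.integral_of_le hs.1]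
      refine integral_mono_ae ((i1.const_mul 2).1) ((i2.const_mul (-ν)).add i3).1 ?_
      rw [EventuallyLE, ae_restrict_iff' measurableSet_Ioc]
      exact ae_Ioc_of_ae hle hs
    rw [intervalIntegral.integral_const_mul, intervalIntegral.integral_add (i2.const_mul (-ν)) i3,
      intervalIntegral.integral_const_mul] at hm
    have he := h.energy hT hℓ hs
    simp only [hz] at hm ⊢
    linarith
  have hdx : ∀ s ∈ Icc 0 T, 0 ≤ ν * ∫ r in (0 : ℝ)..s, ‖(valueH01 v r).dx‖ ^ 2 := fun s hs =>
    mul_nonneg hν.le (intervalIntegral.integral_nonneg hs.1 fun r _ => by positivity)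
  have hg := gronwall (z := z) (b := b) (A := ‖v₀‖ ^ 2 + k) ht.1 hzc
    (intervalIntegrable_of_integrable hb ht) (ae_Ioc_of_ae hb0 ht) fun s hs => by
      have hs' : s ∈ Icc 0 T := ⟨hs.1, hs.2.trans ht.2⟩
      linarith [hen s hs', hdx s hs']
  have h1 := hen t ht
  have h2 : (‖v₀‖ ^ 2 + k) * Real.exp (∫ s in (0 : ℝ)..t, b s)
      ≤ (‖v₀‖ ^ 2 + k) * Real.exp (∫ s in Ioo (0 : ℝ) T, b s) := by
    have := integral_mono_interval hb hb0 ht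
    gcongr
  simp only [hz] at h1
  linarith

end Weak

/-! ### The linear heat equation -/

/-- The solution `x' = -μ x + f`, `x(0) = a`. -/
def modeSol (μ a : ℝ) (f : ℝ → ℝ) (t : ℝ) : ℝ :=
  Real.exp (-(μ * t)) * (a + ∫ s in (0 : ℝ)..t, Real.exp (μ * s) * f s)

theorem modeSol_zero (μ a : ℝ) (f : ℝ → ℝ) : modeSol μ a f 0 = a := by simp [modeSol]

theorem hasDerivAt_modeSol {μ a : ℝ} {f : ℝ → ℝ} (hf : Continuous f) (t : ℝ) :
    HasDerivAt (modeSol μ a f) (-(μ * modeSol μ a f t) + f t) t := by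
  have hc : Continuous fun s => Real.exp (μ * s) * f s := by fun_prop
  have h1 := (hc.integral_hasStrictDerivAt 0 t).hasDerivAt.const_add a
  have h2 : HasDerivAt (fun t => Real.exp (-(μ * t))) (Real.exp (-(μ * t)) * (-(μ * 1))) t :=
    ((hasDerivAt_id t).const_mul μ).neg.exp
  refine (h2.fun_mul h1).congr_deriv ?_
  have e : Real.exp (-(μ * t)) * (Real.exp (μ * t) * f t) = f t := by
    rw [← mul_assoc, ← Real.exp_add]; simp
  rw [e]
  unfold modeSol
  ring

theorem continuous_modeSol {μ a : ℝ} {f : ℝ → ℝ} (hf : Continuous f) :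
    Continuous (modeSol μ a f) :=
  continuous_iff_continuousAt.2 fun t => (hasDerivAt_modeSol hf t).continuousAt

theorem modeSol_eq_integral {μ a : ℝ} {f : ℝ → ℝ} (hf : Continuous f) (t : ℝ) :
    modeSol μ a f t = a + ∫ s in (0 : ℝ)..t, (-(μ * modeSol μ a f s) + f s) := by
  have hc : Continuous fun s => -(μ * modeSol μ a f s) + f s :=
    ((continuous_const.mul (continuous_modeSol hf)).neg).add hf
  rw [intervalIntegral.integral_eq_sub_of_hasDerivAt (fun s _ => hasDerivAt_modeSol hf s)
    (hc.intervalIntegrable _ _), modeSol_zero]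
  ring

/-- The energy estimate for a single mode. -/
theorem modeSol_energy {μ a : ℝ} {f : ℝ → ℝ} (hμ : 0 < μ) (hf : Continuous f) {t : ℝ}
    (ht : 0 ≤ t) :
    modeSol μ a f t ^ 2 + μ * ∫ s in (0 : ℝ)..t, modeSol μ a f s ^ 2
      ≤ a ^ 2 + ∫ s in (0 : ℝ)..t, f s ^ 2 / μ := by
  set x := modeSol μ a f with hx
  have hxc : Continuous x := continuous_modeSol hf
  have hd : ∀ s, HasDerivAt (fun s => x s ^ 2) (2 * x s * (-(μ * x s) + f s)) s := fun s =>
    ((hasDerivAt_modeSol hf s).fun_pow 2).congr_deriv (by norm_num; rfl)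
  have hdc : Continuous fun s => 2 * x s * (-(μ * x s) + f s) := by fun_prop
  have h1 := intervalIntegral.integral_eq_sub_of_hasDerivAt (fun s _ => hd s)
    (hdc.intervalIntegrable 0 t)
  have hrc : Continuous fun s => -(μ * x s ^ 2) + f s ^ 2 / μ := by fun_prop
  have h2 : ∫ s in (0 : ℝ)..t, 2 * x s * (-(μ * x s) + f s)
      ≤ ∫ s in (0 : ℝ)..t, (-(μ * x s ^ 2) + f s ^ 2 / μ) := by
    refine intervalIntegral.integral_mono_on ht (hdc.intervalIntegrable _ _)
      (hrc.intervalIntegrable _ _) fun s _ => ?_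
    have : 0 ≤ (μ * x s - f s) ^ 2 / μ := by positivity
    have e : (μ * x s - f s) ^ 2 / μ = μ * x s ^ 2 - 2 * x s * f s + f s ^ 2 / μ := by
      field_simp; ring
    linarith
  have i1 : Continuous fun s => -(μ * x s ^ 2) := by fun_prop
  have i2 : Continuous fun s => f s ^ 2 / μ := by fun_prop
  rw [intervalIntegral.integral_add (i1.intervalIntegrable _ _) (i2.intervalIntegrable _ _),
    intervalIntegral.integral_neg, intervalIntegral.integral_const_mul] at h2
  have h0 : x 0 = a := modeSol_zero _ _ _
  rw [h1, h0] at h2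
  linarith

section Linear

variable {T : ℝ}

local notation "μT" => (volume.restrict (Ioo (0 : ℝ) T))

theorem memLp_of_continuous_time {E : Type*} [NormedAddCommGroup E]
    {w : ℝ → E} (hw : Continuous w) (hm : AEStronglyMeasurable w μT) : MemLp w 2 μT := by
  obtain ⟨C, hC⟩ := (isCompact_Icc (a := (0 : ℝ)) (b := T)).exists_bound_of_continuousOn
    hw.continuousOn
  refine MemLp.of_bound hm C ?_
  filter_upwards [ae_restrict_mem measurableSet_Ioo] with x hx
  exact hC x (Ioo_subset_Icc_self hx)

/-- A continuous function with values in `H₀¹`, as an element of the solution space. -/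
def ofCont (T : ℝ) (w : ℝ → H01) (hw : Continuous w) : pathSpace T :=
  ⟨(⟨fun t => (w t).toL2, toL2L.continuous.comp (hw.comp continuous_subtype_val)⟩,
    (memLp_of_continuous_time hw hw.aestronglyMeasurable).toLp w), by
    have h := (memLp_of_continuous_time (T := T) hw hw.aestronglyMeasurable).coeFn_toLp
    change ∀ᵐ s ∂(volume.restrict (Ioo (0 : ℝ) T)), ∀ hs : s ∈ Icc (0 : ℝ) T, (w s).toL2 = _
    filter_upwards [h] with s hs _
    rw [hs]⟩

theorem extValue_ofCont (hT : 0 ≤ T) {w : ℝ → H01} (hw : Continuous w) {t : ℝ}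
    (ht : t ∈ Icc 0 T) : extValue hT (ofCont T w hw) t = (w t).toL2 := by
  rw [extValue_of_mem hT _ ht]; rfl

theorem ae_valueH01_ofCont {w : ℝ → H01} (hw : Continuous w) :
    ∀ᵐ s ∂μT, valueH01 (ofCont T w hw) s = w s :=
  (memLp_of_continuous_time hw hw.aestronglyMeasurable).coeFn_toLp

theorem ofCont_sub {w w' : ℝ → H01} (hw : Continuous w) (hw' : Continuous w') :
    ofCont T w hw - ofCont T w' hw' = ofCont T (fun s => w s - w' s) (hw.sub hw') := rfl

theorem isForcing_pairAL (v : pathSpace T) : IsForcing T fun s => pairAL (valueH01 v s) := by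
  refine ⟨fun φ => (continuous_pairAL_apply φ).comp_aestronglyMeasurable (memLp_valueH01 v).1,
    fun s => ‖valueH01 v s‖, (memLp_valueH01 v).norm, ae_of_all _ fun s =>
      ⟨norm_nonneg _, fun φ => ?_⟩⟩
  refine ((pairAL (valueH01 v s)).le_opNorm φ).trans ?_
  have := norm_pairAL_le (valueH01 v s)
  gcongr

/-- The functional `φ ↦ (g, ∂ₓφ) + (h, φ)` on `H₀¹`. -/
def pairDual (g h : L2) : H01 →L[ℝ] ℝ := (innerSL ℝ g).comp dxL + (innerSL ℝ h).comp toL2L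

theorem pairDual_apply (g h : L2) (φ : H01) :
    pairDual g h φ = inner ℝ g φ.dx + inner ℝ h φ.toL2 := rfl

theorem abs_pairDual_le (g h : L2) (φ : H01) : |pairDual g h φ| ≤ (‖g‖ + ‖h‖) * ‖φ‖ := by
  rw [pairDual_apply, add_mul]
  refine (abs_add_le _ _).trans ?_
  have h1 := abs_real_inner_le_norm g φ.dx
  have h2 := abs_real_inner_le_norm h φ.toL2
  have h3 := φ.norm_dx_le
  have h4 := φ.norm_toL2_le
  have h5 : ‖g‖ * ‖φ.dx‖ ≤ ‖g‖ * ‖φ‖ := by gcongr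
  have h6 : ‖h‖ * ‖φ.toL2‖ ≤ ‖h‖ * ‖φ‖ := by gcongr
  linarith

theorem isForcing_pairDual {g h : ℝ → L2} (hg : Continuous g) (hh : Continuous h) :
    IsForcing T fun s => pairDual (g s) (h s) := by
  have hc : Continuous fun s => ‖g s‖ + ‖h s‖ := hg.norm.add hh.norm
  refine ⟨fun φ => ?_, fun s => ‖g s‖ + ‖h s‖,
    memLp_of_continuous_time hc hc.aestronglyMeasurable, ae_of_all _ fun s =>
      ⟨by positivity, abs_pairDual_le _ _⟩⟩
  simp_rw [pairDual_apply]
  exact ((hg.inner continuous_const).add (hh.inner continuous_const)).aestronglyMeasurable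

theorem one_le_freq (k : ℕ) : 1 ≤ freq k := by
  unfold freq
  nlinarith [Real.pi_gt_three, Nat.cast_nonneg (α := ℝ) k]

/-- The squared coefficients of a functional, divided by the eigenvalues, have a bounded sum. -/
theorem sum_pairDual_sq_le (g h : L2) (n : ℕ) :
    ∑ k ∈ Finset.range n, pairDual g h (eig k) ^ 2 / freq k ^ 2 ≤ 2 * (‖g‖ ^ 2 + ‖h‖ ^ 2) := by
  have h1 := orthonormal_eig_dx.sum_inner_products_le g (s := Finset.range n)
  have h2 := orthonormal_eig.sum_inner_products_le h (s := Finset.range n)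
  have h3 : ∀ k, pairDual g h (eig k) ^ 2 / freq k ^ 2
      ≤ 2 * (‖inner ℝ ((freq k)⁻¹ • (eig k).dx) g‖ ^ 2 + ‖inner ℝ (eig k).toL2 h‖ ^ 2) := by
    intro k
    have hf := one_le_freq k
    rw [pairDual_apply, real_inner_smul_left, real_inner_comm, real_inner_comm (eig k).toL2 h,
      Real.norm_eq_abs, Real.norm_eq_abs, sq_abs, sq_abs]
    set p := inner ℝ (eig k).dx g
    set q := inner ℝ (eig k).toL2 h
    rw [mul_pow, inv_pow, div_le_iff₀ (by positivity)]
    have hf2 : 1 ≤ freq k ^ 2 := one_le_pow₀ hf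
    have e : 2 * ((freq k ^ 2)⁻¹ * p ^ 2 + q ^ 2) * freq k ^ 2
        = 2 * p ^ 2 + 2 * (q ^ 2 * freq k ^ 2) := by
      have : freq k ≠ 0 := by linarith
      field_simp
    rw [e]
    nlinarith [sq_nonneg (p - q), sq_nonneg q]
  calc _ ≤ ∑ k ∈ Finset.range n, 2 * (‖inner ℝ ((freq k)⁻¹ • (eig k).dx) g‖ ^ 2
          + ‖inner ℝ (eig k).toL2 h‖ ^ 2) := Finset.sum_le_sum fun k _ => h3 k
    _ ≤ _ := by
      rw [← Finset.mul_sum, Finset.sum_add_distrib]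
      linarith

/-- Solvability of the heat equation `dv + ν A v dt = ℓ dt` for `⟨ℓ, φ⟩ = (g, ∂ₓφ) + (h, φ)`, by
expansion in the eigenfunctions of `A`. -/
theorem exists_weak_heat (hT : 0 ≤ T) {ν : ℝ} (hν : 0 < ν) (v₀ : L2) {g h : ℝ → L2}
    (hg : Continuous g) (hh : Continuous h) :
    ∃ v : pathSpace T, Weak hT v₀
      (fun s => (-ν) • pairAL (valueH01 v s) + pairDual (g s) (h s)) v := by
  set f : ℕ → ℝ → ℝ := fun k s => pairDual (g s) (h s) (eig k) with hf
  have hfc : ∀ k, Continuous (f k) := fun k => by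
    simp only [hf, pairDual_apply]
    exact (hg.inner continuous_const).add (hh.inner continuous_const)
  set a : ℕ → ℝ := fun k => inner ℝ v₀ (eig k).toL2 with ha
  set μ : ℕ → ℝ := fun k => ν * freq k ^ 2 with hμ
  have hμ0 : ∀ k, 0 < μ k := fun k => mul_pos hν (pow_pos (freq_pos k) 2)
  set x : ℕ → ℝ → ℝ := fun k => modeSol (μ k) (a k) (f k) with hx
  have hxc : ∀ k, Continuous (x k) := fun k => continuous_modeSol (hfc k)
  set A : ℕ → ℝ := fun k => a k ^ 2 + ∫ s in (0 : ℝ)..T, f k s ^ 2 / μ k with hA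
  have hA0 : ∀ k, 0 ≤ A k := fun k => add_nonneg (sq_nonneg _)
    (intervalIntegral.integral_nonneg hT fun s _ => div_nonneg (sq_nonneg _) (hμ0 k).le)
  have hfi : ∀ k, Continuous fun s => f k s ^ 2 / μ k := fun k => ((hfc k).pow 2).div_const _
  have hAs : Summable A := by
    refine Summable.add ?_ ?_
    · have := orthonormal_eig.inner_products_summable v₀
      refine this.congr fun k => ?_
      rw [Real.norm_eq_abs, sq_abs, real_inner_comm]
    · refine summable_of_sum_range_le
        (c := ∫ s in (0 : ℝ)..T, 2 / ν * (‖g s‖ ^ 2 + ‖h s‖ ^ 2))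
        (fun k => intervalIntegral.integral_nonneg hT fun s _ =>
          div_nonneg (sq_nonneg _) (hμ0 k).le) fun n => ?_
      rw [← intervalIntegral.integral_finsetSum fun k _ => (hfi k).intervalIntegrable _ _]
      refine intervalIntegral.integral_mono_on hT
        ((continuous_finsetSum _ fun k _ => hfi k).intervalIntegrable _ _)
        ((continuous_const.mul ((hg.norm.pow 2).add (hh.norm.pow 2))).intervalIntegrable _ _)
        fun s _ => ?_
      have e : ∑ k ∈ Finset.range n, f k s ^ 2 / μ k
          = (1 / ν) * ∑ k ∈ Finset.range n, pairDual (g s) (h s) (eig k) ^ 2 / freq k ^ 2 := by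
        rw [Finset.mul_sum]
        refine Finset.sum_congr rfl fun k _ => ?_
        simp only [hf, hμ]
        have := (freq_pos k).ne'
        field_simp
      rw [e]
      have := sum_pairDual_sq_le (g s) (h s) n
      calc _ ≤ (1 / ν) * (2 * (‖g s‖ ^ 2 + ‖h s‖ ^ 2)) := by gcongr
        _ = _ := by ring
  set V : ℕ → ℝ → H01 := fun n t => ∑ k ∈ Finset.range n, x k t • eig k with hV
  have hVc : ∀ n, Continuous (V n) := fun n =>
    continuous_finsetSum _ fun k _ => (hxc k).smul continuous_const
  -- The partial sums of the series form a Cauchy sequence, by the energy estimates of the modes.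
  have hVd : ∀ n m, n ≤ m → ‖ofCont T (V m) (hVc m) - ofCont T (V n) (hVc n)‖ ^ 2
      ≤ (1 + 4 / ν) * ∑ k ∈ Finset.Ico n m, A k := by
    intro n m hnm
    have hWc : Continuous fun s => V m s - V n s := (hVc m).sub (hVc n)
    have hW : ∀ t, V m t - V n t = ∑ k ∈ Finset.Ico n m, x k t • eig k := fun t =>
      (Finset.sum_Ico_eq_sub _ hnm).symm
    rw [ofCont_sub]
    refine norm_sq_le_of_energy_le hT hν _ fun t ht => ?_
    rw [extValue_ofCont hT _ ht, hW, norm_sq_sum_eig]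
    have e : ∫ s in (0 : ℝ)..t, ‖(valueH01 (ofCont T (fun s => V m s - V n s) hWc) s).dx‖ ^ 2
        = ∑ k ∈ Finset.Ico n m, freq k ^ 2 * ∫ s in (0 : ℝ)..t, x k s ^ 2 := by
      have e1 : ∫ s in (0 : ℝ)..t, ‖(valueH01 (ofCont T (fun s => V m s - V n s) hWc) s).dx‖ ^ 2
          = ∫ s in (0 : ℝ)..t, ∑ k ∈ Finset.Ico n m, freq k ^ 2 * x k s ^ 2 := by
        refine intervalIntegral.integral_congr_ae ?_
        rw [uIoc_of_le ht.1]
        filter_upwards [ae_Ioc_of_ae (ae_valueH01_ofCont hWc) ht] with s hs hs'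
        rw [hs hs', hW, norm_sq_sum_eig_dx]
      have hi : ∀ k ∈ Finset.Ico n m,
          IntervalIntegrable (fun s => freq k ^ 2 * x k s ^ 2) volume 0 t := fun k _ =>
        (continuous_const.mul ((hxc k).pow 2)).intervalIntegrable _ _
      rw [e1, intervalIntegral.integral_finsetSum hi]
      simp_rw [intervalIntegral.integral_const_mul]
    rw [e, Finset.mul_sum, ← Finset.sum_add_distrib]
    refine Finset.sum_le_sum fun k _ => ?_
    have h1 := modeSol_energy (a := a k) (hμ0 k) (hfc k) ht.1
    have h2 : ∫ s in (0 : ℝ)..t, f k s ^ 2 / μ k ≤ ∫ s in (0 : ℝ)..T, f k s ^ 2 / μ k :=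
      intervalIntegral.integral_mono_interval le_rfl ht.1 ht.2
        (ae_of_all _ fun s => div_nonneg (sq_nonneg _) (hμ0 k).le)
        ((hfi k).intervalIntegrable _ _)
    simp only [hx, hA, hμ] at h1 h2 ⊢
    linarith
  have hcau : CauchySeq fun n => ofCont T (V n) (hVc n) := by
    refine cauchySeq_of_le_tendsto_0'
      (fun n => √((1 + 4 / ν) * (∑' k, A k - ∑ k ∈ Finset.range n, A k))) (fun n m hnm => ?_) ?_
    · rw [dist_comm, dist_eq_norm]
      refine Real.le_sqrt_of_sq_le ((hVd n m hnm).trans ?_)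
      rw [Finset.sum_Ico_eq_sub _ hnm]
      have := hAs.sum_le_tsum (Finset.range m) fun k _ => hA0 k
      gcongr
    · have h1 := ((hAs.hasSum.tendsto_sum_nat.const_sub (∑' k, A k)).const_mul (1 + 4 / ν)).sqrt
      simpa using h1
  obtain ⟨v, hv⟩ := cauchySeq_tendsto_of_complete hcau
  have hcoef : ∀ t ∈ Icc 0 T, ∀ k, inner ℝ (extValue hT v t) (eig k).toL2 = x k t := by
    intro t ht k
    have hl : Tendsto (fun n => extValue hT (ofCont T (V n) (hVc n)) t) atTop
        (𝓝 (extValue hT v t)) := by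
      have hc : Continuous fun u : pathSpace T => extValue hT u t :=
        (continuous_eval_const (F := C(Icc (0 : ℝ) T, L2)) (projIcc 0 T hT t)).comp
          (continuous_fst.comp continuous_subtype_val)
      exact (hc.tendsto v).comp hv
    have hl2 : Tendsto (fun n => inner ℝ (extValue hT (ofCont T (V n) (hVc n)) t) (eig k).toL2)
        atTop (𝓝 (inner ℝ (extValue hT v t) (eig k).toL2)) := hl.inner tendsto_const_nhds
    refine tendsto_nhds_unique hl2 (tendsto_const_nhds.congr' ?_)
    filter_upwards [eventually_gt_atTop k] with n hn
    rw [extValue_ofCont hT _ ht, hV, H01.toL2_sum, sum_inner]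
    rw [Finset.sum_eq_single k]
    · rw [H01.toL2_smul, real_inner_smul_left, real_inner_self_eq_norm_sq, norm_eig]
      ring
    · intro j _ hj
      have hj' : inner ℝ (eig j).toL2 (eig k).toL2 = (0 : ℝ) := orthonormal_eig.2 hj
      rw [H01.toL2_smul, real_inner_smul_left, hj', mul_zero]
    · intro hk
      exact absurd (Finset.mem_range.2 hn) hk
  refine ⟨v, weak_of_eig hT (((isForcing_pairAL v).const_smul (-ν)).add
    (isForcing_pairDual hg hh)) fun t ht k => ?_⟩
  rw [hcoef t ht k]
  refine (modeSol_eq_integral (hfc k) t).trans ?_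
  congr 1
  refine intervalIntegral.integral_congr_ae ?_
  rw [uIoc_of_le ht.1]
  filter_upwards [ae_Ioc_of_ae (ae_toL2_valueH01 hT v) ht] with s hs hs'
  have h1 := inner_eig_dx k (valueH01 v s)
  rw [hs hs', real_inner_comm (extValue hT v s), hcoef s ⟨hs'.1.le, hs'.2.trans ht.2⟩ k] at h1
  have h2 : ((-ν) • pairAL (valueH01 v s) + pairDual (g s) (h s)) (eig k)
      = -ν * inner ℝ (valueH01 v s).dx (eig k).dx + f k s := rfl
  rw [h2, real_inner_comm (eig k).dx, h1]
  simp only [hμ, hx]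
  ring

end Linear

/-! ### The truncated problem -/

section Volterra

variable {T : ℝ} {E : Type*} [NormedAddCommGroup E] [CompleteSpace E]

/-- A map of Volterra type on `C([0,T]; E)` has a fixed point, since one of its iterates is a
contraction. -/
theorem exists_fixedPoint_of_volterra (hT : 0 ≤ T) {C : ℝ} (hC : 0 ≤ C)
    (Φ : C(Icc (0 : ℝ) T, E) → C(Icc (0 : ℝ) T, E))
    (h : ∀ w w' : C(Icc (0 : ℝ) T, E), ∀ t : Icc (0 : ℝ) T, ‖Φ w t - Φ w' t‖ ^ 2
      ≤ C * ∫ s in (0 : ℝ)..t, ‖w (projIcc 0 T hT s) - w' (projIcc 0 T hT s)‖ ^ 2) :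
    ∃ w, Φ w = w := by
  -- The contraction constant of the `n`-th iterate, squared, is at most `(C T)ⁿ / n!`.
  have hit : ∀ (n : ℕ) (w w' : C(Icc (0 : ℝ) T, E)) (t : Icc (0 : ℝ) T),
      ‖Φ^[n] w t - Φ^[n] w' t‖ ^ 2 ≤ (C * t) ^ n / n.factorial * ‖w - w'‖ ^ 2 := by
    intro n
    induction n with
    | zero =>
      intro w w' t
      have h1 : ‖w t - w' t‖ ≤ ‖w - w'‖ := (w - w').norm_coe_le_norm t
      simpa using pow_le_pow_left₀ (norm_nonneg _) h1 2
    | succ n ih =>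
      intro w w' t
      rw [Function.iterate_succ_apply', Function.iterate_succ_apply']
      refine (h _ _ t).trans ?_
      have hc1 : Continuous fun s => ‖Φ^[n] w (projIcc 0 T hT s)
          - Φ^[n] w' (projIcc 0 T hT s)‖ ^ 2 :=
        ((((Φ^[n] w).continuous.comp continuous_projIcc).sub
          ((Φ^[n] w').continuous.comp continuous_projIcc)).norm.pow 2)
      have hc2 : Continuous fun s : ℝ => (C * s) ^ n / n.factorial * ‖w - w'‖ ^ 2 := by fun_prop
      have hle : ∫ s in (0 : ℝ)..t, ‖Φ^[n] w (projIcc 0 T hT s)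
            - Φ^[n] w' (projIcc 0 T hT s)‖ ^ 2
          ≤ ∫ s in (0 : ℝ)..t, (C * s) ^ n / n.factorial * ‖w - w'‖ ^ 2 := by
        refine intervalIntegral.integral_mono_on t.2.1 (hc1.intervalIntegrable _ _)
          (hc2.intervalIntegrable _ _) fun s hs => ?_
        have hsT : s ∈ Icc 0 T := ⟨hs.1, hs.2.trans t.2.2⟩
        have := ih w w' ⟨s, hsT⟩
        rwa [projIcc_of_mem hT hsT]
      refine (mul_le_mul_of_nonneg_left hle hC).trans (le_of_eq ?_)
      rw [intervalIntegral.integral_mul_const, intervalIntegral.integral_div]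
      simp_rw [mul_pow]
      rw [intervalIntegral.integral_const_mul, integral_pow, Nat.factorial_succ]
      push_cast
      have : (n.factorial : ℝ) ≠ 0 := by positivity
      have : (n + 1 : ℝ) ≠ 0 := by positivity
      field_simp
      ring
  have hlim := FloorSemiring.tendsto_pow_div_factorial_atTop (C * T)
  obtain ⟨n, hn⟩ := (hlim.eventually_lt_const (u := 1) one_pos).exists
  have hq0 : 0 ≤ (C * T) ^ n / n.factorial := by positivity
  have hq1 : √((C * T) ^ n / n.factorial) < 1 := by
    rw [Real.sqrt_lt' one_pos]; simpa using hn
  have hcontr : ContractingWith (√((C * T) ^ n / n.factorial)).toNNReal Φ^[n] := by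
    refine ⟨by rwa [← NNReal.coe_lt_coe, Real.coe_toNNReal _ (Real.sqrt_nonneg _)],
      LipschitzWith.of_dist_le_mul fun w w' => ?_⟩
    rw [Real.coe_toNNReal _ (Real.sqrt_nonneg _), dist_eq_norm, dist_eq_norm,
      ContinuousMap.norm_le _ (by positivity)]
    intro t
    have h1 := hit n w w' t
    have h2 : (C * t) ^ n / n.factorial ≤ (C * T) ^ n / n.factorial := by
      have := t.2.1
      have := t.2.2
      gcongr
    have h3 : ‖(Φ^[n] w - Φ^[n] w') t‖ ^ 2
        ≤ (√((C * T) ^ n / n.factorial) * ‖w - w'‖) ^ 2 := by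
      rw [mul_pow, Real.sq_sqrt hq0]
      exact h1.trans (by gcongr)
    exact (pow_le_pow_iff_left₀ (norm_nonneg _) (by positivity) two_ne_zero).1 h3
  exact ⟨_, hcontr.isFixedPt_fixedPoint_iterate⟩

end Volterra

section Truncated

variable {T : ℝ}

local notation "μT" => (volume.restrict (Ioo (0 : ℝ) T))

/-- `v` solves the problem with the nonlinearities `g` and `c` in place of `a²` and
`a (1 - a) (a - γ)`. -/
def IsWeakSol (hT : 0 ≤ T) (ν α β : ℝ) (g c : ℝ → ℝ) (u₀ : L2) (ψ v : pathSpace T) : Prop :=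
  Weak hT u₀ (fun s => (-ν) • pairAL (valueH01 v s)
    + nlin α β g c (valueH01 v s + valueH01 ψ s)) v

/-- Continuous dependence on the right-hand side for the heat equation. -/
theorem Weak.heat_sub_le (hT : 0 ≤ T) {ν : ℝ} (hν : 0 < ν) {v₀ : L2} {g h g' h' : ℝ → L2}
    (hg : Continuous g) (hh : Continuous h) (hg' : Continuous g') (hh' : Continuous h')
    {v v' : pathSpace T}
    (hv : Weak hT v₀ (fun s => (-ν) • pairAL (valueH01 v s) + pairDual (g s) (h s)) v)
    (hv' : Weak hT v₀ (fun s => (-ν) • pairAL (valueH01 v' s) + pairDual (g' s) (h' s)) v')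
    {t : ℝ} (ht : t ∈ Icc 0 T) :
    ‖extValue hT v t - extValue hT v' t‖ ^ 2
      ≤ ∫ s in (0 : ℝ)..t, (‖g s - g' s‖ + 2 * ‖h s - h' s‖) ^ 2 / ν := by
  have f1 := ((isForcing_pairAL v).const_smul (-ν)).add (isForcing_pairDual (T := T) hg hh)
  have f2 := ((isForcing_pairAL v').const_smul (-ν)).add (isForcing_pairDual (T := T) hg' hh')
  have hen := (Weak.sub hT f1 f2 hv hv').energy hT (f1.sub f2) ht
  have hi := intervalIntegrable_of_integrable ((f1.sub f2).integrable_self (v - v')) ht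
  have hc : Continuous fun s => (‖g s - g' s‖ + 2 * ‖h s - h' s‖) ^ 2 / ν := by fun_prop
  rw [sub_self, norm_zero, extValue_sub, ← intervalIntegral.integral_const_mul] at hen
  rw [hen, zero_pow two_ne_zero, zero_add]
  rw [intervalIntegral.integral_of_le ht.1, intervalIntegral.integral_of_le ht.1]
  refine integral_mono_ae ((hi.const_mul 2).1) ((hc.intervalIntegrable 0 t).1) ?_
  rw [EventuallyLE, ae_restrict_iff' measurableSet_Ioc]
  filter_upwards [ae_Ioc_of_ae (ae_valueH01_sub v v') ht] with s hs hs'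
  have e : (((-ν) • pairAL (valueH01 v s) + pairDual (g s) (h s))
      - ((-ν) • pairAL (valueH01 v' s) + pairDual (g' s) (h' s))) (valueH01 (v - v') s)
      = (-ν * inner ℝ (valueH01 v s).dx (valueH01 (v - v') s).dx
        + (inner ℝ (g s) (valueH01 (v - v') s).dx + inner ℝ (h s) (valueH01 (v - v') s).toL2))
        - (-ν * inner ℝ (valueH01 v' s).dx (valueH01 (v - v') s).dx
        + (inner ℝ (g' s) (valueH01 (v - v') s).dx
          + inner ℝ (h' s) (valueH01 (v - v') s).toL2)) := rfl
  have e2 : (valueH01 v s).dx = (valueH01 (v - v') s).dx + (valueH01 v' s).dx := by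
    rw [hs hs', H01.dx_sub]; abel
  rw [e, e2, inner_add_left, real_inner_self_eq_norm_sq]
  set w := valueH01 (v - v') s
  have h1 := real_inner_le_norm (g s - g' s) w.dx
  have h2 := real_inner_le_norm (h s - h' s) w.toL2
  rw [inner_sub_left] at h1 h2
  have h3 : ‖h s - h' s‖ * ‖w.toL2‖ ≤ ‖h s - h' s‖ * (2 * ‖w.dx‖) := by
    gcongr
    exact w.norm_toL2_le_dx
  have h4 : 0 ≤ (ν * ‖w.dx‖ - (‖g s - g' s‖ + 2 * ‖h s - h' s‖)) ^ 2 / ν := by positivity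
  have e4 : (ν * ‖w.dx‖ - (‖g s - g' s‖ + 2 * ‖h s - h' s‖)) ^ 2 / ν
      = ν * ‖w.dx‖ ^ 2 - 2 * (‖g s - g' s‖ + 2 * ‖h s - h' s‖) * ‖w.dx‖
        + (‖g s - g' s‖ + 2 * ‖h s - h' s‖) ^ 2 / ν := by field_simp; ring
  have h5 : 0 ≤ ν * ‖w.dx‖ ^ 2 := by positivity
  linarith

/-- The problem with globally Lipschitz nonlinearities is solvable. -/
theorem exists_isWeakSol_of_lipschitz (hT : 0 ≤ T) {ν α β : ℝ} (hν : 0 < ν) (hα : 0 < α)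
    (hβ : 0 < β) {g c : ℝ → ℝ} {Lg Lc : NNReal} (hg : LipschitzWith Lg g)
    (hc : LipschitzWith Lc c) (hg0 : g 0 = 0) (hc0 : c 0 = 0) (u₀ : L2) (ψ : pathSpace T) :
    ∃ v, IsWeakSol hT ν α β g c u₀ ψ v := by
  set G : C(Icc (0 : ℝ) T, L2) → ℝ → L2 := fun w s =>
    (α / 2) • nem g (w (projIcc 0 T hT s) + extValue hT ψ s) with hG
  set H : C(Icc (0 : ℝ) T, L2) → ℝ → L2 := fun w s =>
    β • nem c (w (projIcc 0 T hT s) + extValue hT ψ s) with hH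
  have hwc : ∀ w : C(Icc (0 : ℝ) T, L2),
      Continuous fun s => w (projIcc 0 T hT s) + extValue hT ψ s := fun w =>
    (w.continuous.comp continuous_projIcc).add (continuous_extValue hT ψ)
  have hGc : ∀ w, Continuous (G w) := fun w =>
    (continuous_const_smul (α / 2)).comp ((lipschitzWith_nem hg hg0).continuous.comp (hwc w))
  have hHc : ∀ w, Continuous (H w) := fun w =>
    (continuous_const_smul β).comp ((lipschitzWith_nem hc hc0).continuous.comp (hwc w))
  -- `S w` solves the heat equation with the nonlinear terms frozen at `w`.
  choose S hS using fun w => exists_weak_heat hT hν u₀ (hGc w) (hHc w)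
  set K : ℝ := α / 2 * Lg + 2 * (β * Lc) with hK
  have hK0 : 0 ≤ K := by positivity
  obtain ⟨w, hw⟩ := exists_fixedPoint_of_volterra hT (C := K ^ 2 / ν) (by positivity)
    (fun w => (S w).1.1) (fun w w' t => by
      have h1 := Weak.heat_sub_le hT hν (hGc w) (hHc w) (hGc w') (hHc w') (hS w) (hS w') t.2
      rw [extValue_of_mem hT _ t.2, extValue_of_mem hT _ t.2] at h1
      refine h1.trans ?_
      rw [← intervalIntegral.integral_const_mul]
      have hc1 : Continuous fun s =>
          (‖G w s - G w' s‖ + 2 * ‖H w s - H w' s‖) ^ 2 / ν :=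
        ((((hGc w).sub (hGc w')).norm.add (continuous_const.mul
          ((hHc w).sub (hHc w')).norm)).pow 2).div_const _
      have hc2 : Continuous fun s =>
          K ^ 2 / ν * ‖w (projIcc 0 T hT s) - w' (projIcc 0 T hT s)‖ ^ 2 :=
        continuous_const.mul (((w.continuous.comp continuous_projIcc).sub
          (w'.continuous.comp continuous_projIcc)).norm.pow 2)
      refine intervalIntegral.integral_mono_on t.2.1 (hc1.intervalIntegrable _ _)
        (hc2.intervalIntegrable _ _) fun s _ => ?_
      have k1 : ‖G w s - G w' s‖
          ≤ α / 2 * (Lg * ‖w (projIcc 0 T hT s) - w' (projIcc 0 T hT s)‖) := by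
        rw [hG, ← smul_sub, norm_smul, Real.norm_of_nonneg (by positivity)]
        gcongr
        have := (lipschitzWith_nem hg hg0).dist_le_mul
          (w (projIcc 0 T hT s) + extValue hT ψ s) (w' (projIcc 0 T hT s) + extValue hT ψ s)
        rwa [dist_eq_norm, dist_eq_norm, add_sub_add_right_eq_sub] at this
      have k2 : ‖H w s - H w' s‖
          ≤ β * (Lc * ‖w (projIcc 0 T hT s) - w' (projIcc 0 T hT s)‖) := by
        rw [hH, ← smul_sub, norm_smul, Real.norm_of_nonneg (by positivity)]
        gcongr
        have := (lipschitzWith_nem hc hc0).dist_le_mul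
          (w (projIcc 0 T hT s) + extValue hT ψ s) (w' (projIcc 0 T hT s) + extValue hT ψ s)
        rwa [dist_eq_norm, dist_eq_norm, add_sub_add_right_eq_sub] at this
      calc _ ≤ (K * ‖w (projIcc 0 T hT s) - w' (projIcc 0 T hT s)‖) ^ 2 / ν := by
            gcongr
            simp only [hK]
            linarith
        _ = _ := by ring)
  refine ⟨S w, fun t ht φ => (hS w t ht φ).trans ?_⟩
  congr 1
  refine intervalIntegral.integral_congr_ae ?_
  rw [uIoc_of_le ht.1]
  filter_upwards [ae_Ioc_of_ae (ae_toL2_valueH01 hT (S w)) ht,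
    ae_Ioc_of_ae (ae_toL2_valueH01 hT ψ) ht] with s h1 h2 hs
  have e1 : w (projIcc 0 T hT s) + extValue hT ψ s = (valueH01 (S w) s + valueH01 ψ s).toL2 := by
    rw [H01.toL2_add, h1 hs, h2 hs]
    congr 1
    exact (congrArg (fun w : C(Icc (0 : ℝ) T, L2) => w (projIcc 0 T hT s)) hw).symm
  have e2 : ((-ν) • pairAL (valueH01 (S w) s) + pairDual (G w s) (H w s)) φ
      = -ν * pairA (valueH01 (S w) s) φ
        + (inner ℝ (G w s) φ.dx + inner ℝ (H w s) φ.toL2) := rfl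
  have e3 : ((-ν) • pairAL (valueH01 (S w) s)
      + nlin α β g c (valueH01 (S w) s + valueH01 ψ s)) φ
      = -ν * pairA (valueH01 (S w) s) φ + nlin α β g c (valueH01 (S w) s + valueH01 ψ s) φ := rfl
  rw [e2, e3, nlin_apply, ← e1, ← real_inner_smul_left, ← real_inner_smul_left]

end Truncated

/-! ### Stability, uniqueness and existence -/

section Stability

variable {T ν α β : ℝ} {g c : ℝ → ℝ}

local notation "μT" => (volume.restrict (Ioo (0 : ℝ) T))

theorem isForcing_nlin (hT : 0 ≤ T) (h : Admissible g c) (hα : 0 < α) (hβ : 0 < β)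
    (v ψ : pathSpace T) :
    IsForcing T fun s => nlin α β g c (valueH01 v s + valueH01 ψ s) := by
  have h1 : MemLp (fun _ : ℝ => (1 : ℝ)) 2 μT := memLp_const 1
  have hK : MemLp (fun s => (α + 4 * β) * (1 + agmon (valueH01 (v + ψ) s)) * ‖v + ψ‖) 2 μT :=
    MemLp.mul_const (MemLp.const_mul (h1.add (memLp_agmon hT (v + ψ))) (α + 4 * β)) _
  refine ⟨fun φ => (h.continuous_nlin_apply hα hβ φ).comp_aestronglyMeasurable
    ((memLp_valueH01 v).1.add (memLp_valueH01 ψ).1), _, hK, ?_⟩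
  filter_upwards [ae_valueH01_add v ψ, ae_toL2_valueH01 hT (v + ψ)] with s h1 h2
  have h0 := agmon_nonneg (valueH01 (v + ψ) s)
  refine ⟨by positivity, fun φ => ?_⟩
  rw [← h1]
  refine ((nlin α β g c (valueH01 (v + ψ) s)).le_opNorm φ).trans ?_
  gcongr
  refine (h.norm_nlin_le hα hβ _).trans ?_
  gcongr
  rw [h2]
  exact norm_extValue_le hT _ s

theorem isForcing_rhs (hT : 0 ≤ T) (h : Admissible g c) (hα : 0 < α) (hβ : 0 < β)
    (v ψ : pathSpace T) : IsForcing T fun s =>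
      (-ν) • pairAL (valueH01 v s) + nlin α β g c (valueH01 v s + valueH01 ψ s) :=
  ((isForcing_pairAL v).const_smul (-ν)).add (isForcing_nlin hT h hα hβ v ψ)

/-- The weight that bounds the growth of the energy in the estimates. -/
def weight (u₁ u₂ u₃ : pathSpace T) (s : ℝ) : ℝ :=
  (1 + agmon (valueH01 u₁ s) + agmon (valueH01 u₂ s) + agmon (valueH01 u₃ s)) ^ 2

theorem weight_nonneg (u₁ u₂ u₃ : pathSpace T) (s : ℝ) : 0 ≤ weight u₁ u₂ u₃ s := sq_nonneg _

theorem integrable_weight (hT : 0 ≤ T) (u₁ u₂ u₃ : pathSpace T) :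
    Integrable (weight u₁ u₂ u₃) μT := by
  have h0 : MemLp (fun _ : ℝ => (1 : ℝ)) 2 μT := memLp_const 1
  exact (((h0.add (memLp_agmon hT u₁)).add (memLp_agmon hT u₂)).add
    (memLp_agmon hT u₃)).integrable_sq

theorem integral_weight_le (hT : 0 ≤ T) {M : ℝ} {u₁ u₂ u₃ : pathSpace T} (h₁ : ‖u₁‖ ≤ M)
    (h₂ : ‖u₂‖ ≤ M) (h₃ : ‖u₃‖ ≤ M) :
    ∫ s in Ioo (0 : ℝ) T, weight u₁ u₂ u₃ s ≤ 4 * (T + 12 * M ^ 4) := by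
  have i₁ := (memLp_agmon hT u₁).integrable_sq
  have i₂ := (memLp_agmon hT u₂).integrable_sq
  have i₃ := (memLp_agmon hT u₃).integrable_sq
  have i₀ : Integrable (fun _ : ℝ => (1 : ℝ)) μT := integrable_const 1
  have hle : ∫ s in Ioo (0 : ℝ) T, weight u₁ u₂ u₃ s ≤ ∫ s in Ioo (0 : ℝ) T,
      4 * (1 + agmon (valueH01 u₁ s) ^ 2 + agmon (valueH01 u₂ s) ^ 2
        + agmon (valueH01 u₃ s) ^ 2) := by
    refine integral_mono (integrable_weight hT u₁ u₂ u₃)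
      ((((i₀.add i₁).add i₂).add i₃).const_mul 4) fun s => ?_
    unfold weight
    nlinarith [sq_nonneg (1 - agmon (valueH01 u₁ s)), sq_nonneg (1 - agmon (valueH01 u₂ s)),
      sq_nonneg (1 - agmon (valueH01 u₃ s)),
      sq_nonneg (agmon (valueH01 u₁ s) - agmon (valueH01 u₂ s)),
      sq_nonneg (agmon (valueH01 u₁ s) - agmon (valueH01 u₃ s)),
      sq_nonneg (agmon (valueH01 u₂ s) - agmon (valueH01 u₃ s))]
  have i₀₁ : Integrable (fun s => 1 + agmon (valueH01 u₁ s) ^ 2) μT := i₀.add i₁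
  have i₀₂ : Integrable (fun s => 1 + agmon (valueH01 u₁ s) ^ 2 + agmon (valueH01 u₂ s) ^ 2) μT :=
    i₀₁.add i₂
  rw [integral_const_mul, integral_add i₀₂ i₃, integral_add i₀₁ i₂, integral_add i₀ i₁] at hle
  have e0 : ∫ _ in Ioo (0 : ℝ) T, (1 : ℝ) = T := by simp [hT]
  have p : ∀ u : pathSpace T, ‖u‖ ≤ M →
      ∫ s in Ioo (0 : ℝ) T, agmon (valueH01 u s) ^ 2 ≤ 4 * M ^ 4 := fun u hu =>
    (integral_agmon_sq_le hT u).trans (by gcongr)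
  linarith [p u₁ h₁, p u₂ h₂, p u₃ h₃]

/-- The factor in the estimates that Gronwall's inequality gives for paths of norm at most `M`. -/
def growth (T ν α β M : ℝ) : ℝ :=
  (1 + 4 / ν) * Real.exp (energyConst ν α β * (4 * (T + 12 * M ^ 4)))

theorem growth_nonneg (hν : 0 < ν) (M : ℝ) : 0 ≤ growth T ν α β M := by
  unfold growth; positivity

/-- The energy estimate with the weight of three bounded paths. -/
theorem Weak.norm_sq_le_growth {k M : ℝ} (hT : 0 ≤ T) (hν : 0 < ν) (hβ : 0 < β) (hk : 0 ≤ k)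
    {v₀ : L2} {ℓ : ℝ → H01 →L[ℝ] ℝ} {v u₁ u₂ u₃ : pathSpace T} (hℓ : IsForcing T ℓ)
    (h : Weak hT v₀ ℓ v) (h₁ : ‖u₁‖ ≤ M) (h₂ : ‖u₂‖ ≤ M) (h₃ : ‖u₃‖ ≤ M)
    (hle : ∀ᵐ s ∂μT, 2 * ℓ s (valueH01 v s) ≤ -ν * ‖(valueH01 v s).dx‖ ^ 2
      + energyConst ν α β * weight u₁ u₂ u₃ s * (‖extValue hT v s‖ ^ 2 + k)) :
    ‖v‖ ^ 2 ≤ growth T ν α β M * (‖v₀‖ ^ 2 + k) := by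
  have hC := energyConst_nonneg (α := α) hν hβ
  refine (h.norm_sq_le hT hν hk hℓ ((integrable_weight hT u₁ u₂ u₃).const_mul _)
    (ae_of_all _ fun s => mul_nonneg hC (weight_nonneg _ _ _ s)) hle).trans ?_
  have hw := integral_weight_le hT h₁ h₂ h₃
  rw [integral_const_mul]
  calc _ ≤ (1 + 4 / ν) * ((‖v₀‖ ^ 2 + k)
        * Real.exp (energyConst ν α β * (4 * (T + 12 * M ^ 4)))) := by gcongr
    _ = _ := by unfold growth; ring

/-- The a priori bound. It does not depend on the nonlinearities. -/
theorem IsWeakSol.norm_sq_le (hT : 0 ≤ T) (hν : 0 < ν) (hα : 0 < α) (hβ : 0 < β)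
    (h : Admissible g c) {u₀ : L2} {ψ v : pathSpace T} (hv : IsWeakSol hT ν α β g c u₀ ψ v)
    {M : ℝ} (hψ : ‖ψ‖ ≤ M) : ‖v‖ ^ 2 ≤ growth T ν α β M * (‖u₀‖ ^ 2 + M ^ 2) := by
  refine Weak.norm_sq_le_growth hT hν hβ (sq_nonneg M) (isForcing_rhs hT h hα hβ v ψ) hv
    hψ hψ hψ ?_
  have hC := energyConst_nonneg (α := α) hν hβ
  filter_upwards [ae_toL2_valueH01 hT v, ae_toL2_valueH01 hT ψ] with s h1 h2
  have e := apriori_estimate hν hα hβ h (valueH01 v s) (valueH01 ψ s)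
  have h0 := agmon_nonneg (valueH01 ψ s)
  have h3 : ‖(valueH01 ψ s).toL2‖ ≤ M := by
    rw [h2]; exact (norm_extValue_le hT ψ s).trans hψ
  -- Only `ψ` enters the weight, so that the bound is closed.
  have h4 : (1 + agmon (valueH01 ψ s)) ^ 2 ≤ weight ψ ψ ψ s := by
    unfold weight
    gcongr
    linarith
  rw [← h1]
  refine e.trans ?_
  have h5 := mul_nonneg hC (weight_nonneg ψ ψ ψ s)
  gcongr

/-- The stability estimate, for two right-hand sides and two pairs of nonlinearities. -/
theorem IsWeakSol.norm_sub_sq_le (hT : 0 ≤ T) (hν : 0 < ν) (hα : 0 < α) (hβ : 0 < β)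
    {δ : ℝ} {g₁ c₁ g₂ c₂ : ℝ → ℝ} (h₁ : Admissible g₁ c₁) (h₂ : Admissible g₂ c₂)
    (hcl : Close δ g₁ c₁ g₂ c₂) {u₀ : L2} {ψ₁ ψ₂ v₁ v₂ : pathSpace T}
    (hv₁ : IsWeakSol hT ν α β g₁ c₁ u₀ ψ₁ v₁) (hv₂ : IsWeakSol hT ν α β g₂ c₂ u₀ ψ₂ v₂)
    {M : ℝ} (k₁ : ‖v₁ + ψ₁‖ ≤ M) (k₂ : ‖v₂ + ψ₂‖ ≤ M) (k₃ : ‖v₂ + ψ₁‖ ≤ M) :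
    ‖v₁ - v₂‖ ^ 2 ≤ growth T ν α β M * (‖ψ₁ - ψ₂‖ ^ 2 + δ ^ 2 * M ^ 2) := by
  have f₁ := isForcing_rhs (ν := ν) hT h₁ hα hβ v₁ ψ₁
  have f₂ := isForcing_rhs (ν := ν) hT h₂ hα hβ v₂ ψ₂
  have hk : 0 ≤ ‖ψ₁ - ψ₂‖ ^ 2 + δ ^ 2 * M ^ 2 := by positivity
  have key := Weak.norm_sq_le_growth (α := α) (β := β) hT hν hβ hk (f₁.sub f₂)
    (Weak.sub hT f₁ f₂ hv₁ hv₂) k₁ k₂ k₃ ?_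
  · rwa [sub_self, norm_zero, zero_pow two_ne_zero, zero_add] at key
  have hC := energyConst_nonneg (α := α) hν hβ
  filter_upwards [ae_valueH01_sub v₁ v₂, ae_valueH01_sub ψ₁ ψ₂, ae_valueH01_add v₁ ψ₁,
    ae_valueH01_add v₂ ψ₂, ae_valueH01_add v₂ ψ₁, ae_toL2_valueH01 hT (v₁ - v₂),
    ae_toL2_valueH01 hT (ψ₁ - ψ₂), ae_toL2_valueH01 hT (v₂ + ψ₂)]
    with s a1 a2 a3 a4 a5 b1 b2 b3
  have e := stability_estimate hν hα hβ h₁ h₂ hcl (valueH01 v₁ s) (valueH01 v₂ s)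
    (valueH01 ψ₁ s) (valueH01 ψ₂ s)
  have n2 : ‖(valueH01 (ψ₁ - ψ₂) s).toL2‖ ≤ ‖ψ₁ - ψ₂‖ := by
    rw [b2]; exact norm_extValue_le hT _ s
  have n3 : ‖(valueH01 (v₂ + ψ₂) s).toL2‖ ≤ M := by
    rw [b3]; exact (norm_extValue_le hT _ s).trans k₂
  rw [← b1]
  rw [a1, weight, a3, a4, a5]
  rw [a2] at n2
  rw [a4] at n3
  have e' : (((-ν) • pairAL (valueH01 v₁ s) + nlin α β g₁ c₁ (valueH01 v₁ s + valueH01 ψ₁ s))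
      - ((-ν) • pairAL (valueH01 v₂ s) + nlin α β g₂ c₂ (valueH01 v₂ s + valueH01 ψ₂ s)))
      (valueH01 v₁ s - valueH01 v₂ s)
      = -ν * pairA (valueH01 v₁ s - valueH01 v₂ s) (valueH01 v₁ s - valueH01 v₂ s)
        + (nlin α β g₁ c₁ (valueH01 v₁ s + valueH01 ψ₁ s) (valueH01 v₁ s - valueH01 v₂ s)
          - nlin α β g₂ c₂ (valueH01 v₂ s + valueH01 ψ₂ s) (valueH01 v₁ s - valueH01 v₂ s)) := by
    have e1 : pairA (valueH01 v₁ s - valueH01 v₂ s) (valueH01 v₁ s - valueH01 v₂ s)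
        = pairAL (valueH01 v₁ s) (valueH01 v₁ s - valueH01 v₂ s)
          - pairAL (valueH01 v₂ s) (valueH01 v₁ s - valueH01 v₂ s) := by
      rw [pairAL_apply, pairAL_apply, pairA, pairA, pairA, ← inner_sub_left, H01.dx_sub]
    rw [e1]
    change (-ν * pairAL (valueH01 v₁ s) (valueH01 v₁ s - valueH01 v₂ s)
      + nlin α β g₁ c₁ (valueH01 v₁ s + valueH01 ψ₁ s) (valueH01 v₁ s - valueH01 v₂ s))
      - (-ν * pairAL (valueH01 v₂ s) (valueH01 v₁ s - valueH01 v₂ s)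
      + nlin α β g₂ c₂ (valueH01 v₂ s + valueH01 ψ₂ s) (valueH01 v₁ s - valueH01 v₂ s)) = _
    ring
  rw [e']
  refine e.trans ?_
  rw [add_assoc (‖(valueH01 v₁ s - valueH01 v₂ s).toL2‖ ^ 2)]
  gcongr

/-- Solutions for bounded `ψ` are bounded, and they depend in a Lipschitz way on `ψ` and on the
nonlinearities. -/
theorem exists_stability_const (hT : 0 ≤ T) (hν : 0 < ν) (hα : 0 < α) (hβ : 0 < β) (u₀ : L2)
    (M : ℝ) : ∃ C, 0 ≤ C ∧
      (∀ g c, Admissible g c → ∀ ψ v : pathSpace T, ‖ψ‖ ≤ M →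
        IsWeakSol hT ν α β g c u₀ ψ v → ‖v‖ ≤ C) ∧
      ∀ δ g₁ c₁ g₂ c₂, Admissible g₁ c₁ → Admissible g₂ c₂ → Close δ g₁ c₁ g₂ c₂ →
        ∀ ψ₁ ψ₂ v₁ v₂ : pathSpace T, ‖ψ₁‖ ≤ M → ‖ψ₂‖ ≤ M →
        IsWeakSol hT ν α β g₁ c₁ u₀ ψ₁ v₁ → IsWeakSol hT ν α β g₂ c₂ u₀ ψ₂ v₂ →
        ‖v₁ - v₂‖ ≤ C * (‖ψ₁ - ψ₂‖ + δ) := by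
  set B := √(growth T ν α β M * (‖u₀‖ ^ 2 + M ^ 2)) with hB
  set M' := B + M with hM'
  set D := √(growth T ν α β M') * (1 + |M'|) with hD
  have hbound : ∀ g c, Admissible g c → ∀ ψ v : pathSpace T, ‖ψ‖ ≤ M →
      IsWeakSol hT ν α β g c u₀ ψ v → ‖v‖ ≤ B := fun g c h ψ v hψ hv =>
    Real.le_sqrt_of_sq_le (hv.norm_sq_le hT hν hα hβ h hψ)
  have hB0 : 0 ≤ B := Real.sqrt_nonneg _
  have hD0 : 0 ≤ D := by positivity
  refine ⟨B + D, add_nonneg hB0 hD0, fun g c h ψ v hψ hv =>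
    (hbound g c h ψ v hψ hv).trans (by linarith), ?_⟩
  intro δ g₁ c₁ g₂ c₂ h₁ h₂ hcl ψ₁ ψ₂ v₁ v₂ hψ₁ hψ₂ hv₁ hv₂
  have b₁ := hbound _ _ h₁ _ _ hψ₁ hv₁
  have b₂ := hbound _ _ h₂ _ _ hψ₂ hv₂
  have hs := hv₁.norm_sub_sq_le hT hν hα hβ h₁ h₂ hcl hv₂ (M := M')
    ((norm_add_le _ _).trans (add_le_add b₁ hψ₁)) ((norm_add_le _ _).trans (add_le_add b₂ hψ₂))
    ((norm_add_le _ _).trans (add_le_add b₂ hψ₁))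
  have hδ := hcl.nonneg
  have hle : ‖v₁ - v₂‖ ≤ D * (‖ψ₁ - ψ₂‖ + δ) := by
    refine le_of_sq_le_sq (hs.trans ?_) (by positivity)
    rw [hD, mul_assoc, mul_pow, Real.sq_sqrt (growth_nonneg hν M')]
    have := growth_nonneg (T := T) (α := α) (β := β) hν M'
    gcongr
    have hx := norm_nonneg (ψ₁ - ψ₂)
    have hy := abs_nonneg M'
    rw [← sq_abs M']
    have : ‖ψ₁ - ψ₂‖ ^ 2 + δ ^ 2 * |M'| ^ 2 ≤ (‖ψ₁ - ψ₂‖ + δ * |M'|) ^ 2 := by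
      nlinarith [mul_nonneg hx (mul_nonneg hδ hy)]
    refine this.trans ?_
    gcongr
    nlinarith [mul_nonneg hx hy]
  refine hle.trans ?_
  gcongr
  linarith

/-- By Young's inequality; a bound of first order in `η` is all that the limit passage needs. -/
theorem integral_norm_valueH01_le (hT : 0 ≤ T) {η : ℝ} (hη : 0 < η) {u : pathSpace T}
    (hu : ‖u‖ ≤ η) : ∫ s in Ioo (0 : ℝ) T, ‖valueH01 u s‖ ≤ (T + 1) * η := by
  have i₀ : Integrable (fun _ : ℝ => η) μT := integrable_const η
  have i₁ := (integrable_norm_sq_valueH01 u).const_mul η⁻¹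
  have h : ∫ s in Ioo (0 : ℝ) T, ‖valueH01 u s‖
      ≤ ∫ s in Ioo (0 : ℝ) T, (η + η⁻¹ * ‖valueH01 u s‖ ^ 2) := by
    refine integral_mono ((memLp_valueH01 u).norm.integrable (by norm_num)) (i₀.add i₁)
      fun s => ?_
    have e : η + η⁻¹ * ‖valueH01 u s‖ ^ 2 - ‖valueH01 u s‖
        = η⁻¹ * ((η - ‖valueH01 u s‖ / 2) ^ 2 + 3 / 4 * ‖valueH01 u s‖ ^ 2) := by
      field_simp; ring
    have : 0 ≤ η⁻¹ * ((η - ‖valueH01 u s‖ / 2) ^ 2 + 3 / 4 * ‖valueH01 u s‖ ^ 2) := by positivity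
    change ‖valueH01 u s‖ ≤ η + η⁻¹ * ‖valueH01 u s‖ ^ 2
    linarith
  rw [integral_add i₀ i₁, integral_const_mul] at h
  have e0 : ∫ _ in Ioo (0 : ℝ) T, η = T * η := by simp [hT]
  have h2 : η⁻¹ * ∫ s in Ioo (0 : ℝ) T, ‖valueH01 u s‖ ^ 2 ≤ η⁻¹ * η ^ 2 := by
    have : ‖u‖ ^ 2 ≤ η ^ 2 := by gcongr
    gcongr
    exact (integral_norm_sq_valueH01_le u).trans this
  have e2 : η⁻¹ * η ^ 2 = η := by field_simp
  linarith

/-- A path close to the solution of a problem with close nonlinearities nearly solves the weak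
equation. -/
theorem IsWeakSol.abs_residual_le (hT : 0 ≤ T) (hν : 0 < ν) (hα : 0 < α) (hβ : 0 < β)
    {δ : ℝ} {g' c' : ℝ → ℝ} (h' : Admissible g' c') (h : Admissible g c)
    (hcl : Close δ g' c' g c) {u₀ : L2} {ψ v' : pathSpace T}
    (hv' : IsWeakSol hT ν α β g' c' u₀ ψ v') (v : pathSpace T) {M η : ℝ} (hη : 0 < η)
    (hδ : δ ≤ η) (hd : ‖v' - v‖ ≤ η) (k' : ‖v' + ψ‖ ≤ M) (k : ‖v + ψ‖ ≤ M)
    {t : ℝ} (ht : t ∈ Icc 0 T) (φ : H01) :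
    |inner ℝ (extValue hT v t) φ.toL2 - inner ℝ u₀ φ.toL2 - ∫ s in (0 : ℝ)..t,
      ((-ν) • pairAL (valueH01 v s) + nlin α β g c (valueH01 v s + valueH01 ψ s)) φ|
      ≤ (1 + ν * (T + 1) + (α + 4 * β) * (1 + M) * (4 * (T + 12 * M ^ 4))) * ‖φ‖ * η := by
  have hM : 0 ≤ M := (norm_nonneg _).trans k
  have f' := isForcing_rhs (ν := ν) hT h' hα hβ v' ψ
  have f := isForcing_rhs (ν := ν) hT h hα hβ v ψ
  have i := (f'.sub f).integrable_apply φ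
  have ev : ∫ s in (0 : ℝ)..t,
      (((-ν) • pairAL (valueH01 v' s) + nlin α β g' c' (valueH01 v' s + valueH01 ψ s))
      - ((-ν) • pairAL (valueH01 v s) + nlin α β g c (valueH01 v s + valueH01 ψ s))) φ
      = (∫ s in (0 : ℝ)..t,
        ((-ν) • pairAL (valueH01 v' s) + nlin α β g' c' (valueH01 v' s + valueH01 ψ s)) φ)
      - ∫ s in (0 : ℝ)..t,
        ((-ν) • pairAL (valueH01 v s) + nlin α β g c (valueH01 v s + valueH01 ψ s)) φ :=
    intervalIntegral.integral_sub (intervalIntegrable_of_integrable (f'.integrable_apply φ) ht)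
      (intervalIntegrable_of_integrable (f.integrable_apply φ) ht)
  have iw := integrable_weight hT (v' + ψ) (v + ψ) (v + ψ)
  have iv : Integrable (fun s => ‖valueH01 (v' - v) s‖) μT :=
    (memLp_valueH01 (v' - v)).norm.integrable (by norm_num)
  -- The difference of the right-hand sides: the linear term, a change of the argument of the
  -- nonlinearities, and a change of the nonlinearities.
  have hpt : ∀ᵐ s ∂μT,
      ‖(((-ν) • pairAL (valueH01 v' s) + nlin α β g' c' (valueH01 v' s + valueH01 ψ s))
      - ((-ν) • pairAL (valueH01 v s) + nlin α β g c (valueH01 v s + valueH01 ψ s))) φ‖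
      ≤ ν * ‖φ‖ * ‖valueH01 (v' - v) s‖
        + (α + 4 * β) * (1 + M) * η * ‖φ‖ * weight (v' + ψ) (v + ψ) (v + ψ) s := by
    filter_upwards [ae_valueH01_sub v' v, ae_valueH01_add v' ψ, ae_valueH01_add v ψ,
      ae_toL2_valueH01 hT (v' - v), ae_toL2_valueH01 hT (v + ψ)] with s a1 a2 a3 b1 b2
    rw [← a2, ← a3]
    have m1 := agmon_nonneg (valueH01 (v' + ψ) s)
    have m2 := agmon_nonneg (valueH01 (v + ψ) s)
    set W := weight (v' + ψ) (v + ψ) (v + ψ) s with hW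
    have hW0 : 0 ≤ W := sq_nonneg _
    have w1 : 1 + agmon (valueH01 (v' + ψ) s) + agmon (valueH01 (v + ψ) s) ≤ W := by
      rw [hW, weight]; nlinarith
    have w2 : (1 + agmon (valueH01 (v + ψ) s)) ^ 2 ≤ W := by
      rw [hW, weight]
      gcongr
      linarith
    have n1 : ‖(valueH01 (v' + ψ) s).toL2 - (valueH01 (v + ψ) s).toL2‖ ≤ η := by
      have e : (valueH01 (v' + ψ) s).toL2 - (valueH01 (v + ψ) s).toL2
          = (valueH01 (v' - v) s).toL2 := by
        rw [a1, a2, a3]; simp only [H01.toL2_add, H01.toL2_sub]; abel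
      rw [e, b1]
      exact (norm_extValue_le hT _ s).trans hd
    have n2 : ‖(valueH01 (v + ψ) s).toL2‖ ≤ M := by
      rw [b2]; exact (norm_extValue_le hT _ s).trans k
    have p1 : |pairAL (valueH01 (v' - v) s) φ| ≤ ‖valueH01 (v' - v) s‖ * ‖φ‖ :=
      ((pairAL (valueH01 (v' - v) s)).le_opNorm φ).trans (by
        have := norm_pairAL_le (valueH01 (v' - v) s)
        gcongr)
    have p2 : |(nlin α β g' c' (valueH01 (v' + ψ) s) - nlin α β g' c' (valueH01 (v + ψ) s)) φ|
        ≤ (α + 4 * β) * W * η * ‖φ‖ := by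
      refine ((nlin α β g' c' (valueH01 (v' + ψ) s)
        - nlin α β g' c' (valueH01 (v + ψ) s)).le_opNorm φ).trans ?_
      gcongr
      refine (h'.norm_nlin_sub_le hα hβ _ _).trans ?_
      gcongr
    have p3 : |(nlin α β g' c' (valueH01 (v + ψ) s) - nlin α β g c (valueH01 (v + ψ) s)) φ|
        ≤ (α + β) * η * W * M * ‖φ‖ := by
      refine ((nlin α β g' c' (valueH01 (v + ψ) s)
        - nlin α β g c (valueH01 (v + ψ) s)).le_opNorm φ).trans ?_
      gcongr
      refine (hcl.norm_nlin_sub_le h' h hα hβ _).trans ?_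
      gcongr
    have e1 : pairAL (valueH01 (v' - v) s) φ
        = pairAL (valueH01 v' s) φ - pairAL (valueH01 v s) φ := by
      rw [pairAL_apply, pairAL_apply, pairAL_apply, pairA, pairA, pairA, ← inner_sub_left, a1,
        H01.dx_sub]
    have e2 : (((-ν) • pairAL (valueH01 v' s) + nlin α β g' c' (valueH01 (v' + ψ) s))
      - ((-ν) • pairAL (valueH01 v s) + nlin α β g c (valueH01 (v + ψ) s))) φ
      = -ν * pairAL (valueH01 (v' - v) s) φ
        + (nlin α β g' c' (valueH01 (v' + ψ) s) - nlin α β g' c' (valueH01 (v + ψ) s)) φ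
        + (nlin α β g' c' (valueH01 (v + ψ) s) - nlin α β g c (valueH01 (v + ψ) s)) φ := by
      rw [e1]
      change (-ν * pairAL (valueH01 v' s) φ + nlin α β g' c' (valueH01 (v' + ψ) s) φ)
        - (-ν * pairAL (valueH01 v s) φ + nlin α β g c (valueH01 (v + ψ) s) φ)
        = -ν * (pairAL (valueH01 v' s) φ - pairAL (valueH01 v s) φ)
        + (nlin α β g' c' (valueH01 (v' + ψ) s) φ - nlin α β g' c' (valueH01 (v + ψ) s) φ)
        + (nlin α β g' c' (valueH01 (v + ψ) s) φ - nlin α β g c (valueH01 (v + ψ) s) φ)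
      ring
    rw [e2]
    refine (norm_add₃_le).trans ?_
    rw [norm_mul, norm_neg, Real.norm_of_nonneg hν.le]
    simp only [Real.norm_eq_abs]
    have q1 := mul_le_mul_of_nonneg_left p1 hν.le
    have q3 : (α + β) * η * W * M * ‖φ‖ ≤ (α + 4 * β) * η * W * M * ‖φ‖ := by
      gcongr
      linarith
    linarith
  have hint : |∫ s in (0 : ℝ)..t,
      (((-ν) • pairAL (valueH01 v' s) + nlin α β g' c' (valueH01 v' s + valueH01 ψ s))
      - ((-ν) • pairAL (valueH01 v s) + nlin α β g c (valueH01 v s + valueH01 ψ s))) φ|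
      ≤ ν * ‖φ‖ * ((T + 1) * η)
        + (α + 4 * β) * (1 + M) * η * ‖φ‖ * (4 * (T + 12 * M ^ 4)) := by
    refine (intervalIntegral.abs_integral_le_integral_abs ht.1).trans ?_
    refine (integral_mono_interval i.norm (ae_of_all _ fun s => norm_nonneg _) ht).trans ?_
    refine (integral_mono_ae i.norm ((iv.const_mul _).add (iw.const_mul _)) hpt).trans ?_
    have j1 := integral_norm_valueH01_le hT hη hd
    have j2 := integral_weight_le hT k' k k
    refine (integral_add (iv.const_mul _) (iw.const_mul _)).trans_le ?_
    rw [integral_const_mul, integral_const_mul]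
    gcongr
  have hinn : |inner ℝ (extValue hT (v' - v) t) φ.toL2| ≤ η * ‖φ‖ := by
    refine (abs_real_inner_le_norm _ _).trans ?_
    have := (norm_extValue_le hT (v' - v) t).trans hd
    have := φ.norm_toL2_le
    gcongr
  have e := hv' t ht φ
  rw [ev] at hint
  rw [extValue_sub, inner_sub_left] at hinn
  rw [abs_le] at hint hinn ⊢
  constructor <;> linarith

theorem pathSpace.norm_sub_self (u : pathSpace T) : ‖u - u‖ = 0 :=
  (congrArg norm (sub_self u)).trans norm_zero

/-- Existence: the solutions of the truncated problems converge. -/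
theorem exists_isWeakSol (hT : 0 ≤ T) (hν : 0 < ν) (hα : 0 < α) (hβ : 0 < β)
    (h : Admissible g c) (u₀ : L2) (ψ : pathSpace T) : ∃ v, IsWeakSol hT ν α β g c u₀ ψ v := by
  have hR : ∀ n : ℕ, (0 : ℝ) < n + 1 := fun n => by positivity
  have hadm := fun n : ℕ => h.truncate (hR n).le
  have hclose := fun n : ℕ => h.close_truncate (hR n)
  have hex : ∀ n : ℕ, ∃ v, IsWeakSol hT ν α β (fun a => g (clamp (n + 1) a))
      (fun a => c (clamp (n + 1) a)) u₀ ψ v := fun n =>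
    exists_isWeakSol_of_lipschitz hT hν hα hβ
      (LipschitzWith.of_dist_le_mul (K := ⟨2 * (n + 1), by positivity⟩)
        (h.truncate_g_sub_le (hR n).le))
      (LipschitzWith.of_dist_le_mul (K := ⟨4 * (1 + 2 * (n + 1) ^ 2), by positivity⟩)
        (h.truncate_c_sub_le (hR n).le))
      (hadm n).g_zero (hadm n).c_zero u₀ ψ
  choose f hf using hex
  obtain ⟨C, hC0, hbound, hstab⟩ := exists_stability_const hT hν hα hβ u₀ ‖ψ‖
  have hlim : Tendsto (fun n : ℕ => 1 / ((n : ℝ) + 1)) atTop (𝓝 0) :=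
    tendsto_one_div_add_atTop_nhds_zero_nat
  have hcauchy : CauchySeq f := by
    refine cauchySeq_of_le_tendsto_0 (fun n : ℕ => C * 16 * (1 / ((n : ℝ) + 1)))
      (fun n m N hn hm => ?_) (by simpa using hlim.const_mul (C * 16))
    have hs := hstab _ _ _ _ _ (hadm n) (hadm m) ((hclose n).trans (hclose m).symm) ψ ψ _ _
      le_rfl le_rfl (hf n) (hf m)
    rw [pathSpace.norm_sub_self, zero_add] at hs
    rw [dist_eq_norm]
    refine hs.trans ?_
    have q1 : 8 / ((n : ℝ) + 1) ≤ 8 / ((N : ℝ) + 1) := by gcongr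
    have q2 : 8 / ((m : ℝ) + 1) ≤ 8 / ((N : ℝ) + 1) := by gcongr
    have q3 : 8 / ((N : ℝ) + 1) = 8 * (1 / ((N : ℝ) + 1)) := by ring
    rw [mul_assoc]
    gcongr
    linarith
  obtain ⟨v, hv⟩ := cauchySeq_tendsto_of_complete hcauchy
  refine ⟨v, fun t ht φ => ?_⟩
  have hvC : ‖v‖ ≤ C := le_of_tendsto' hv.norm fun n => hbound _ _ (hadm n) _ _ le_rfl (hf n)
  set η : ℕ → ℝ := fun n => ‖f n - v‖ + 8 / ((n : ℝ) + 1) with hη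
  have hηlim : Tendsto η atTop (𝓝 0) := by
    have h1 := (tendsto_iff_norm_sub_tendsto_zero.1 hv).add (hlim.const_mul 8)
    rw [mul_zero, add_zero] at h1
    exact h1.congr fun n => congrArg (fun x => ‖f n - v‖ + x) (mul_one_div _ _)
  have hle := fun n => (hf n).abs_residual_le hT hν hα hβ (hadm n) h (hclose n) v
    (M := C + ‖ψ‖) (η := η n) (by positivity) (le_add_of_nonneg_left (norm_nonneg _))
    (le_add_of_nonneg_right (by positivity))
    ((norm_add_le _ _).trans (add_le_add_left (hbound _ _ (hadm n) _ _ le_rfl (hf n)) _))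
    ((norm_add_le _ _).trans (add_le_add_left hvC _)) ht φ
  have h0 := ge_of_tendsto' (hηlim.const_mul _) hle
  rw [mul_zero] at h0
  have := abs_nonpos_iff.1 h0
  linarith

theorem IsWeakSol.eq (hT : 0 ≤ T) (hν : 0 < ν) (hα : 0 < α) (hβ : 0 < β)
    (h : Admissible g c) {u₀ : L2} {ψ v w : pathSpace T} (hv : IsWeakSol hT ν α β g c u₀ ψ v)
    (hw : IsWeakSol hT ν α β g c u₀ ψ w) : v = w := by
  obtain ⟨C, -, -, hstab⟩ := exists_stability_const hT hν hα hβ u₀ ‖ψ‖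
  have := hstab _ _ _ _ _ h h (Close.refl g c) ψ ψ v w le_rfl le_rfl hv hw
  rw [pathSpace.norm_sub_self, add_zero, mul_zero] at this
  exact sub_eq_zero.1 (norm_le_zero_iff.1 this)

/-- The Burgers–Huxley problem is the case `g a = a²`, `c a = a (1 - a) (a - γ)`. -/
theorem isSolution_iff_isWeakSol (hT : 0 ≤ T) {γ : ℝ} {u₀ : L2} {ψ v : pathSpace T} :
    IsSolution ν α β γ u₀ ψ v
      ↔ IsWeakSol hT ν α β (fun a => a ^ 2) (fun a => a * (1 - a) * (a - γ)) u₀ ψ v := by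
  have e : ∀ (s : ℝ) (φ : H01), -ν * pairA (valueH01 v s) φ
      - α * pairB (valueH01 v s + valueH01 ψ s) φ
      + β * pairC γ (valueH01 v s + valueH01 ψ s) φ
      = ((-ν) • pairAL (valueH01 v s) + nlin α β (fun a => a ^ 2)
        (fun a => a * (1 - a) * (a - γ)) (valueH01 v s + valueH01 ψ s)) φ := by
    intro s φ
    change _ = -ν * pairA (valueH01 v s) φ + nlin α β (fun a => a ^ 2)
        (fun a => a * (1 - a) * (a - γ)) (valueH01 v s + valueH01 ψ s) φ
    rw [nlin_burgersHuxley]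
    ring
  constructor
  · intro h t ht φ
    rw [extValue_of_mem hT v ht, h.equation ⟨t, ht⟩ φ]
    simp_rw [e]
  · intro h
    have heq : ∀ (t : Icc (0 : ℝ) T) (φ : H01), inner ℝ (value v t) φ.toL2
        = inner ℝ u₀ φ.toL2 + ∫ s in (0 : ℝ)..t, (-ν * pairA (valueH01 v s) φ
          - α * pairB (valueH01 v s + valueH01 ψ s) φ
          + β * pairC γ (valueH01 v s + valueH01 ψ s) φ) := by
      intro t φ
      have := h t t.2 φ
      rw [extValue_of_mem hT v t.2] at this
      simp_rw [e]
      exact this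
    -- At `t = 0` the weak equation says that `v(0) - u₀` is orthogonal to all of `H₀¹`.
    refine ⟨fun h0 => ?_, heq⟩
    rw [← sub_eq_zero]
    refine L2.eq_zero_of_forall_inner_eig fun k => ?_
    have := heq ⟨0, h0⟩ (eig k)
    rw [intervalIntegral.integral_same, add_zero] at this
    rw [real_inner_comm, inner_sub_left, this, sub_self]

end Stability

end BurgersHuxley

end

theorem lemma4 (T ν α β γ : ℝ) (hT : 0 < T) (hν : 0 < ν) (hα : 0 < α) (hβ : 0 < β)
    (hγ : γ ∈ Set.Ioo (0 : ℝ) 1) (u₀ : BurgersHuxley.L2) :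
    ∃ Ψ : BurgersHuxley.pathSpace T → BurgersHuxley.pathSpace T,
      (∀ ψ v : BurgersHuxley.pathSpace T,
        BurgersHuxley.IsSolution ν α β γ u₀ ψ v ↔ v = Ψ ψ) ∧
      Continuous Ψ := by
  have hadm := BurgersHuxley.admissible_burgersHuxley hγ
  choose Ψ hΨ using BurgersHuxley.exists_isWeakSol hT.le hν hα hβ hadm u₀
  refine ⟨Ψ, fun ψ v => ?_, continuous_iff_continuousAt.2 fun ψ₀ => ?_⟩
  · rw [BurgersHuxley.isSolution_iff_isWeakSol hT.le]
    exact ⟨fun h => h.eq hT.le hν hα hβ hadm (hΨ ψ), fun h => h ▸ hΨ ψ⟩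
  · obtain ⟨C, -, -, hstab⟩ :=
      BurgersHuxley.exists_stability_const hT.le hν hα hβ u₀ (‖ψ₀‖ + 1)
    refine continuousAt_of_locally_lipschitz one_pos C fun ψ hψ => ?_
    have hdist : ∀ a b : BurgersHuxley.pathSpace T, dist a b = ‖a - b‖ := fun a b =>
      dist_eq_norm a b
    have hψ' : ‖ψ‖ ≤ ‖ψ₀‖ + 1 := by
      rw [hdist] at hψ
      have : ‖ψ‖ ≤ ‖ψ₀‖ + ‖ψ - ψ₀‖ := norm_le_norm_add_norm_sub' ψ ψ₀
      linarith
    have h := hstab _ _ _ _ _ hadm hadm (BurgersHuxley.Close.refl _ _) ψ ψ₀ _ _ hψ' (by linarith)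
      (hΨ ψ) (hΨ ψ₀)
    rwa [add_zero, ← hdist, ← hdist] at h
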